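/- Theorem 4.1. Let $Q$ be a probability distribution on $\mathbb{R}$ with mean $0$, variance $1/2$ and finite fourth moment $b=\int x^4\,Q(dx)$. For $n\ge m\ge 0$ let $X(n,m)$ be the $n\times m$ random matrix whose entries are i.i.d. complex random variables with independent real and imaginary parts, each having distribution $Q$, and for $\mu,\nu\in\mathbb{C}$ let $$f(n,m;\mu,\nu):=\mathbb{E}\bigl(\det(X(n,m)^*X(n,m)-\mu)\,\det(X(n,m)^*X(n,m)-\nu)\bigr)$$ (the determinant of the $0\times 0$ matrix being $1$). Then this expectation always exists, i.e. the random variable is integrable, and the following holds. Let $\alpha\in\mathbb{N}=\{0,1,2,\dots\}$, $\xi\in(0,4)$, $\mu,\nu\in\mathbb{R}$, and put $$g(\xi):=\frac{1}{2\pi\xi}\sqrt{\xi(4-\xi)},\qquad Z_N(\xi,\mu,\nu):=\bigl(N^2\xi^2+N\xi(\mu+\nu)+\mu\nu\bigr)^{\alpha/2}\exp\bigl(-N\xi-\tfrac12(\mu+\nu)\bigr)$$ (for all large $N$ the base of the power is positive). Then, with $n=N$ and $m=N-\alpha$, $$\lim_{N\to\infty}\; g(\xi)^{-1}\,Z_N\bigl(\xi,\mu/g(\xi),\nu/g(\xi)\bigr)\cdot\frac{f\bigl(n,m;N\xi+\mu/g(\xi),N\xi+\nu/g(\xi)\bigr)}{n!\,m!}=\exp(b^*)\,\mathbb{S}(\mu,\nu),$$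 where $b^*:=2(b-\tfrac34)$ and $\mathbb{S}(x,y):=\dfrac{\sin\pi(x-y)}{\pi(x-y)}$ for $x\neq y$, $\mathbb{S}(x,x):=1$. -/

import Mathlib

open MeasureTheory ProbabilityTheory Filter Topology

namespace SampleCov

/-- The law of a complex random variable whose real and imaginary parts are independent,
each with distribution `Q`. -/
noncomputable def entryLaw (Q : Measure ℝ) : Measure ℂ :=
  (Q.prod Q).map (fun p : ℝ × ℝ => (⟨p.1, p.2⟩ : ℂ))

/-- The law of an `n × m` array of independent complex random variables, each distributed
according to `entryLaw Q`. -/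
noncomputable def matrixLaw (Q : Measure ℝ) (n m : ℕ) : Measure (Fin n → Fin m → ℂ) :=
  Measure.pi fun _ => Measure.pi fun _ => entryLaw Q

/-- The product `det (X* X - μ) · det (X* X - ν)`, where `X` is the `n × m` matrix with entries
`x i j` and `X*` is its conjugate transpose. -/
noncomputable def charPolyProd {n m : ℕ} (μ ν : ℂ) (x : Fin n → Fin m → ℂ) : ℂ :=
  let X : Matrix (Fin n) (Fin m) ℂ := Matrix.of x
  (X.conjTranspose * X - μ • (1 : Matrix (Fin m) (Fin m) ℂ)).det *
    (X.conjTranspose * X - ν • (1 : Matrix (Fin m) (Fin m) ℂ)).det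

/-- The second-order correlation function `f(n, m; μ, ν)` of the characteristic polynomial of the
unrescaled complex sample covariance matrix associated with `Q`. -/
noncomputable def corr (Q : Measure ℝ) (n m : ℕ) (μ ν : ℂ) : ℂ :=
  ∫ x, charPolyProd μ ν x ∂(matrixLaw Q n m)

/-- The Marčenko–Pastur density on `(0, 4)`. -/
noncomputable def mpDensity (ξ : ℝ) : ℝ :=
  1 / (2 * Real.pi * ξ) * Real.sqrt (ξ * (4 - ξ))

/-- The sine kernel `sin π(x - y) / (π(x - y))`, with the value `1` on the diagonal. -/
noncomputable def sineKernel (x y : ℝ) : ℝ :=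
  if x = y then 1 else Real.sin (Real.pi * (x - y)) / (Real.pi * (x - y))

/-- The scaling factor `Z_N(ξ, μ, ν)`, for a given `α`. -/
noncomputable def scaling (α N : ℕ) (ξ μ ν : ℝ) : ℝ :=
  ((N : ℝ) ^ 2 * ξ ^ 2 + N * ξ * (μ + ν) + μ * ν) ^ ((α : ℝ) / 2) *
    Real.exp (-(N * ξ) - (μ + ν) / 2)

end SampleCov

/-! Write κ = 2(b - 3/4), the fourth cumulant of an entry. The proof has an exact algebraic half and
an asymptotic half.

Algebra: adding a row to X perturbs X*X by a rank-one matrix, so det(X*X - z) becomes affine in the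
products of the row's entries with their conjugates, and a product of two such determinants needs
fourth moments only. Every product evaluation p(z)q(w) has the form B(Xp, q) - B(p, Xq) for a
bilinear form B on polynomials (`exists_commForm_eq_eval`). For such forms the resolvent identity
collapses the Gaussian part of the row average to the operator S = 1 - d/dX applied in both
arguments (`commForm_rank_one_moment`). The cumulant contributes κ times diagonal cofactors, which
are characteristic polynomials with one column fewer. This recursion has the closed solution
`expectComm_eq_sum`. The Gaussian terms S^n X^m are Laguerre polynomials, and Christoffel-Darboux
gives f(n, m; x, y)/(n! m!) = ∑ κ^j/j! K_{m-j}(x, y) with Laguerre kernels K (`corr_eq_sum`).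

Asymptotics: each weighted kernel tends to g(ξ) times the sine kernel, and dominated convergence
over j produces exp κ. The kernel limit uses no Plancherel-Rotach asymptotics. The moments of K(x,
x) follow from the three-term recurrence and give weak convergence to the Marchenko-Pastur law. The
derivative of x K(x, x) is a quadratic expression controlled in the bulk by x K(x, x) itself, so a
Harnack inequality upgrades weak to locally uniform convergence (`tendsto_lagFunKer_diag`). Finally
two consecutive Laguerre functions solve a planar linear system which at the microscopic scale is
almost constant with frequency π, and the sine kernel is its oscillation (`tendsto_lagFunKer_sine`).
-/

namespace SampleCov

open Polynomial Matrix

/-! ### Determinants under rank-one perturbation and differentiation -/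

section DeterminantLemma

variable {R : Type*} [CommRing R] {ι : Type*} [Fintype ι] [DecidableEq ι]

/-- Multiplying the bordered matrix (A, -u; v, 1) by (1, adj(A) u; 0, det A) clears the upper right
block. Comparing determinants gives the claim times det A, which regularity cancels. -/
theorem det_add_vecMulVec_of_isRegular (A : Matrix ι ι R) (hA : IsLeftRegular A.det) (u v : ι → R) :
    (A + vecMulVec u v).det = A.det + v ⬝ᵥ (A.adjugate *ᵥ u) := by
  have h1 : (fromBlocks A (-replicateCol Unit u) (replicateRow Unit v) 1 *
      fromBlocks 1 (replicateCol Unit (A.adjugate *ᵥ u)) 0 (A.det • (1 : Matrix Unit Unit R))).det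
      = A.det * (A.det + v ⬝ᵥ (A.adjugate *ᵥ u)) := by
    rw [fromBlocks_multiply]
    have : A * replicateCol Unit (A.adjugate *ᵥ u)
        + -replicateCol Unit u * A.det • (1 : Matrix Unit Unit R) = 0 := by
      ext i j
      have : (A *ᵥ (A.adjugate *ᵥ u)) i = A.det * u i := by
        rw [mulVec_mulVec, mul_adjugate, smul_mulVec, one_mulVec]; rfl
      simp only [mulVec, dotProduct] at this
      simp [mul_apply, mulVec, dotProduct, this]
    rw [this, det_fromBlocks_zero₁₂]
    simp only [mul_one, det_unique]
    simp [mul_apply, dotProduct]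
    ring
  rw [det_mul, det_fromBlocks_one₂₂, det_fromBlocks_zero₂₁] at h1
  have h2 : (A - -replicateCol Unit u * replicateRow Unit v) = A + vecMulVec u v := by
    ext i j; simp [mul_apply, vecMulVec_apply]
  rw [h2] at h1
  simp only [det_one, one_mul, det_smul, Fintype.card_unit, pow_one, mul_one] at h1
  rw [mul_comm] at h1
  exact hA h1

/-- The matrix determinant lemma without invertibility assumption. -/
theorem det_add_vecMulVec (A : Matrix ι ι R) (u v : ι → R) :
    (A + vecMulVec u v).det = A.det + v ⬝ᵥ (A.adjugate *ᵥ u) := by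
  -- The matrix X + A over R[X] has monic, hence regular, determinant; evaluation at X = 0 then
  -- returns to A.
  have hreg : IsLeftRegular (charmatrix (-A)).det :=
    (charpoly_monic (-A)).isRegular.left
  have h := det_add_vecMulVec_of_isRegular (charmatrix (-A)) hreg
    (fun i => C (u i)) (fun i => C (v i))
  have h' := congrArg (eval (0 : R)) h
  have e0 : (evalRingHom (0 : R)).mapMatrix (charmatrix (-A)) = A := by
    ext i j
    by_cases hij : i = j <;> simp [hij]
  have e1 : (evalRingHom (0 : R)).mapMatrix
      (charmatrix (-A) + vecMulVec (fun i => C (u i)) (fun i => C (v i))) = A + vecMulVec u v := by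
    rw [map_add, e0]
    ext i j
    simp [vecMulVec_apply]
  have e2 : (evalRingHom (0 : R)).mapMatrix (charmatrix (-A)).adjugate = A.adjugate := by
    rw [RingHom.map_adjugate, e0]
  rw [← coe_evalRingHom, map_add, RingHom.map_det, RingHom.map_det, e0, e1] at h'
  rw [h']
  congr 1
  simp only [dotProduct, mulVec, map_sum, map_mul, coe_evalRingHom, eval_C]
  refine Finset.sum_congr rfl fun i _ => ?_
  congr 1
  refine Finset.sum_congr rfl fun j _ => ?_
  have := congrFun (congrFun e2 i) j
  simp only [RingHom.mapMatrix_apply, map_apply, coe_evalRingHom] at this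
  rw [this]

/-- Expressing cofactors as differences of determinants lets the later integrability induction stay
within one class of determinants. -/
theorem adjugate_apply_eq_det_sub (A : Matrix ι ι R) (i j : ι) :
    A.adjugate i j = (A + vecMulVec (Pi.single j 1) (Pi.single i 1)).det - A.det := by
  rw [det_add_vecMulVec]
  simp

theorem derivative_det (M : Matrix ι ι R[X]) :
    derivative M.det = ∑ i, (M.updateCol i fun j => derivative (M j i)).det := by
  simp only [det_apply', map_sum]
  rw [Finset.sum_comm]
  refine Finset.sum_congr rfl fun σ _ => ?_
  rw [derivative_intCast_mul, derivative_prod_finset, Finset.mul_sum]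
  refine Finset.sum_congr rfl fun i _ => ?_
  congr 1
  rw [← Finset.mul_prod_erase _ _ (Finset.mem_univ i), mul_comm]
  congr 1
  · simp
  · refine Finset.prod_congr rfl fun j hj => ?_
    rw [updateCol_ne (Finset.ne_of_mem_erase hj)]

/-- Differentiating column i leaves minus the i-th basis vector, so each summand is minus a diagonal
cofactor. -/
theorem derivative_det_sub_X (G : Matrix ι ι R) :
    derivative (G.map C - (X : R[X]) • (1 : Matrix ι ι R[X])).det =
      -(G.map C - (X : R[X]) • (1 : Matrix ι ι R[X])).adjugate.trace := by
  rw [derivative_det, trace, ← Finset.sum_neg_distrib]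
  refine Finset.sum_congr rfl fun i _ => ?_
  set A := G.map C - (X : R[X]) • (1 : Matrix ι ι R[X])
  have h : (fun j => derivative (A j i)) = -(Pi.single i (1 : R[X]) : ι → R[X]) := by
    ext1 j
    by_cases hij : j = i
    · subst hij; simp [A]
    · simp [A, hij]
  rw [h, ← cramer_apply, map_neg, Pi.neg_apply, diag_apply]
  have h2 : A.adjugate i i = Aᵀ.adjugate i i := by rw [← adjugate_transpose, transpose_apply]
  rw [h2, adjugate_def, of_apply, transpose_transpose]

end DeterminantLemma

/-! ### Antisymmetrized bilinear forms and the resolvent identity -/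

/-- The operator `1 - d/dX` on polynomials. -/
noncomputable def oneSubDeriv (R : Type*) [CommRing R] : R[X] →ₗ[R] R[X] :=
  LinearMap.id - derivative

theorem oneSubDeriv_apply {R : Type*} [CommRing R] (p : R[X]) :
    oneSubDeriv R p = p - derivative p := rfl

theorem oneSubDeriv_X_mul {R : Type*} [CommRing R] (p : R[X]) :
    oneSubDeriv R (X * p) = X * oneSubDeriv R p - p := by
  simp only [oneSubDeriv_apply, derivative_mul, derivative_X]; ring

/-- The antisymmetrization `B (X p) q - B p (X q)` of a bilinear form on polynomials. -/
noncomputable def commForm {R : Type*} [CommRing R] (B : R[X] →ₗ[R] R[X] →ₗ[R] R) :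
    R[X] →ₗ[R] R[X] →ₗ[R] R :=
  B.comp (LinearMap.mulLeft R X) - B.compl₂ (LinearMap.mulLeft R X)

theorem commForm_apply {R : Type*} [CommRing R] (B : R[X] →ₗ[R] R[X] →ₗ[R] R) (p q : R[X]) :
    commForm B p q = B (X * p) q - B p (X * q) := by
  simp [commForm]

section Resolvent

variable {R : Type*} [CommRing R] {ι : Type*} [Fintype ι] [DecidableEq ι]

/-- Bilinear form of the resolvent identity for the adjugate of `G - X`. -/
theorem sum_commForm_adjugate (B : R[X] →ₗ[R] R[X] →ₗ[R] R) (G : Matrix ι ι R) :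
    ∑ i, ∑ j, commForm B
        ((G.map C - (X : R[X]) • (1 : Matrix ι ι R[X])).adjugate i j)
        ((G.map C - (X : R[X]) • (1 : Matrix ι ι R[X])).adjugate j i) =
      B (G.map C - (X : R[X]) • (1 : Matrix ι ι R[X])).adjugate.trace
          (G.map C - (X : R[X]) • (1 : Matrix ι ι R[X])).det -
        B (G.map C - (X : R[X]) • (1 : Matrix ι ι R[X])).det
          (G.map C - (X : R[X]) • (1 : Matrix ι ι R[X])).adjugate.trace := by
  set A := G.map C - (X : R[X]) • (1 : Matrix ι ι R[X]) with hA
  -- Since A = G - X, the two identities A adj(A) = det A and adj(A) A = det A let X be traded for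
  -- multiplication by G on the left or on the right.
  have h1 : ∀ i j, X * A.adjugate i j
      = ∑ k, G i k • A.adjugate k j - if i = j then A.det else 0 := by
    intro i j
    have h := congrFun (congrFun (mul_adjugate A) i) j
    rw [hA, sub_mul] at h
    simp only [Matrix.sub_apply, mul_apply, map_apply, smul_mul, one_mul, Matrix.smul_apply, smul_eq_mul,
      one_apply, mul_ite, mul_one, mul_zero] at h
    simp only [smul_eq_C_mul]
    rw [← h, ← hA]; ring
  have h2 : ∀ i j, X * A.adjugate i j
      = ∑ k, G k j • A.adjugate i k - if i = j then A.det else 0 := by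
    intro i j
    have h := congrFun (congrFun (adjugate_mul A) i) j
    rw [hA, mul_sub] at h
    simp only [Matrix.sub_apply, mul_apply, map_apply, Matrix.mul_smul, mul_one, Matrix.smul_apply, smul_eq_mul,
      one_apply, mul_ite, mul_zero] at h
    simp only [smul_eq_C_mul]
    rw [← hA] at h
    rw [← h]
    simp only [mul_comm (C _)]
    ring
  have h3 : ∀ i j, commForm B (A.adjugate i j) (A.adjugate j i) =
      (∑ k, G i k • B (A.adjugate k j) (A.adjugate j i)
        - ∑ k, G k i • B (A.adjugate i j) (A.adjugate j k))
      + ((if i = j then B (A.adjugate i j) A.det else 0)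
        - if i = j then B A.det (A.adjugate j i) else 0) := by
    intro i j
    rw [commForm_apply, h1, h2]
    by_cases hij : i = j
    · subst hij
      simp only [if_true, map_sub, map_sum, LinearMap.sub_apply, LinearMap.sum_apply, map_smul,
        LinearMap.smul_apply]
      ring
    · simp only [if_neg hij, if_neg (Ne.symm hij), sub_zero, map_sum, LinearMap.sum_apply, map_smul,
        LinearMap.smul_apply, add_zero]
  simp only [h3, Finset.sum_add_distrib, Finset.sum_sub_distrib]
  -- The G-terms agree after relabelling indices, as in the cyclicity of a trace; only the det A
  -- terms survive.
  have h4 : ∑ i, ∑ j, ∑ k, G i k • B (A.adjugate k j) (A.adjugate j i)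
      = ∑ i, ∑ j, ∑ k, G k i • B (A.adjugate i j) (A.adjugate j k) := by
    rw [Finset.sum_comm]
    conv_rhs => rw [Finset.sum_comm]
    exact Finset.sum_congr rfl fun j _ => Finset.sum_comm
  rw [h4, sub_self, zero_add]
  simp [trace]

/-- The second moment of the rank one perturbation, expressed through `1 - d/dX`. -/
theorem commForm_rank_one_moment (B : R[X] →ₗ[R] R[X] →ₗ[R] R) (G : Matrix ι ι R) {A : Matrix ι ι R[X]}
    (hA : A = G.map C - (X : R[X]) • (1 : Matrix ι ι R[X])) :
    commForm B A.det A.det + commForm B A.adjugate.trace A.det + commForm B A.det A.adjugate.trace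
        + commForm B A.adjugate.trace A.adjugate.trace
        + ∑ i, ∑ j, commForm B (A.adjugate i j) (A.adjugate j i) =
      commForm (B.compl₁₂ (oneSubDeriv R) (oneSubDeriv R)) A.det A.det := by
  have hS : oneSubDeriv R A.det = A.det + A.adjugate.trace := by
    rw [oneSubDeriv_apply, hA, derivative_det_sub_X]; ring
  have h := sum_commForm_adjugate B G
  rw [← hA] at h
  -- With D = det A, T = tr adj(A) and S D = D + T, the rule S(XD) = X S D - S-free D makes the
  -- right side `commForm B (D + T) (D + T)` plus B(T, D) - B(D, T), which is the resolvent sum.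
  rw [h, commForm_apply (B.compl₁₂ _ _)]
  simp only [LinearMap.compl₁₂_apply, oneSubDeriv_X_mul, hS]
  simp only [commForm_apply, mul_add, map_add, map_sub, LinearMap.add_apply, LinearMap.sub_apply]
  ring

end Resolvent

end SampleCov

/-! ### Second and fourth mixed moments of a row -/

namespace SampleCov

open Polynomial Matrix ComplexConjugate

/-- A law on `ℂ` whose moments up to order four, except the third ones and `E |z|^4 = 2 + κ`, agree
with those of the standard complex Gaussian law. -/
structure IsNormalizedLaw (P : Measure ℂ) (κ : ℂ) : Prop where
  integrable_norm_pow_four : Integrable (fun z : ℂ => ‖z‖ ^ 4) P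
  integral_id : ∫ z, z ∂P = 0
  integral_sq : ∫ z, z ^ 2 ∂P = 0
  integral_conj_mul : ∫ z, conj z * z ∂P = 1
  integral_conj_sq_mul_sq : ∫ z, conj z ^ 2 * z ^ 2 ∂P = 2 + κ

section Moments

variable {P : Measure ℂ} {κ : ℂ}

theorem IsNormalizedLaw.integrable_monomial [IsFiniteMeasure P] (h : IsNormalizedLaw P κ) {a b : ℕ} (hab : a + b ≤ 4) :
    Integrable (fun z : ℂ => conj z ^ a * z ^ b) P := by
  refine ((integrable_const (1 : ℝ)).add h.integrable_norm_pow_four).mono'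
    (Continuous.aestronglyMeasurable (by fun_prop)) (Eventually.of_forall fun z => ?_)
  simp only [norm_mul, norm_pow, RCLike.norm_conj, ← pow_add, Pi.add_apply]
  rcases le_total ‖z‖ 1 with hz | hz
  · have := pow_le_one₀ (n := a + b) (norm_nonneg z) hz
    have := pow_nonneg (norm_nonneg z) 4
    linarith
  · have := pow_le_pow_right₀ hz hab
    linarith

theorem IsNormalizedLaw.integral_conj (h : IsNormalizedLaw P κ) : ∫ z, conj z ∂P = 0 := by
  have := _root_.integral_conj (μ := P) (f := fun z : ℂ => z)
  rw [this, h.integral_id, map_zero]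

theorem IsNormalizedLaw.integral_conj_sq (h : IsNormalizedLaw P κ) : ∫ z, conj z ^ 2 ∂P = 0 := by
  have := _root_.integral_conj (μ := P) (f := fun z : ℂ => z ^ 2)
  simp only [map_pow] at this
  rw [this, h.integral_sq, map_zero]

theorem single_le_one {ι : Type*} [DecidableEq ι] (j i : ι) : (Pi.single j 1 : ι → ℕ) i ≤ 1 := by
  by_cases h : i = j
  · subst h; simp
  · simp [h]

variable [IsProbabilityMeasure P] {ι : Type*} [Fintype ι] [DecidableEq ι]

theorem prod_pow_single (f : ι → ℂ) (j : ι) : ∏ i, f i ^ (Pi.single j 1 : ι → ℕ) i = f j := by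
  rw [Finset.prod_eq_single j]
  · simp
  · intro i _ hi; simp [hi]
  · simp

/-- Exponents written through `Pi.single` turn a mixed monomial into a product over coordinates, so
its integral factorizes by independence. -/
theorem quartic_eq_prod (r : ι → ℂ) (j k j' k' : ι) :
    conj (r j) * r k * (conj (r j') * r k') =
      ∏ i, conj (r i) ^ ((Pi.single j 1 : ι → ℕ) i + (Pi.single j' 1 : ι → ℕ) i)
        * r i ^ ((Pi.single k 1 : ι → ℕ) i + (Pi.single k' 1 : ι → ℕ) i) := by
  simp only [pow_add, Finset.prod_mul_distrib, prod_pow_single (fun i => conj (r i)),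
    prod_pow_single r]
  ring

theorem quadratic_eq_prod (r : ι → ℂ) (j k : ι) :
    conj (r j) * r k =
      ∏ i, conj (r i) ^ ((Pi.single j 1 : ι → ℕ) i) * r i ^ ((Pi.single k 1 : ι → ℕ) i) := by
  simp only [Finset.prod_mul_distrib, prod_pow_single (fun i => conj (r i)), prod_pow_single r]

theorem IsNormalizedLaw.integrable_quartic (h : IsNormalizedLaw P κ) (j k j' k' : ι) :
    Integrable (fun r : ι → ℂ => conj (r j) * r k * (conj (r j') * r k'))
      (Measure.pi fun _ => P) := by
  simp only [quartic_eq_prod]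
  refine Integrable.fintype_prod (f := fun i (z : ℂ) =>
    conj z ^ ((Pi.single j 1 : ι → ℕ) i + (Pi.single j' 1 : ι → ℕ) i)
        * z ^ ((Pi.single k 1 : ι → ℕ) i + (Pi.single k' 1 : ι → ℕ) i)) fun i => ?_
  apply h.integrable_monomial
  have := single_le_one j i; have := single_le_one k i
  have := single_le_one j' i; have := single_le_one k' i
  omega

theorem IsNormalizedLaw.integrable_quadratic (h : IsNormalizedLaw P κ) (j k : ι) :
    Integrable (fun r : ι → ℂ => conj (r j) * r k) (Measure.pi fun _ => P) := by
  simp only [quadratic_eq_prod]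
  refine Integrable.fintype_prod (f := fun i (z : ℂ) =>
    conj z ^ ((Pi.single j 1 : ι → ℕ) i) * z ^ ((Pi.single k 1 : ι → ℕ) i)) fun i => ?_
  apply h.integrable_monomial
  have := single_le_one j i; have := single_le_one k i
  omega

theorem IsNormalizedLaw.integral_quadratic (h : IsNormalizedLaw P κ) (j k : ι) :
    ∫ r : ι → ℂ, conj (r j) * r k ∂(Measure.pi fun _ => P) = if j = k then 1 else 0 := by
  simp only [quadratic_eq_prod]
  rw [integral_fintype_prod_eq_prod (f := fun i (z : ℂ) =>
    conj z ^ ((Pi.single j 1 : ι → ℕ) i) * z ^ ((Pi.single k 1 : ι → ℕ) i))]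
  by_cases hjk : j = k
  · subst hjk
    rw [if_pos rfl, Finset.prod_eq_single j]
    · simpa using h.integral_conj_mul
    · intro i _ hi; simp [hi]
    · simp
  · rw [if_neg hjk]
    refine Finset.prod_eq_zero (Finset.mem_univ j) ?_
    simpa [hjk] using h.integral_conj

/-- Wick's rule with a cumulant correction: the two pairings account for the 2 in E|z|^4 = 2 + κ,
and κ enters only when all indices coincide. Third moments play no role, because three equal indices
leave the fourth factor alone with mean zero. -/
theorem IsNormalizedLaw.integral_quartic (h : IsNormalizedLaw P κ) (j k j' k' : ι) :
    ∫ r : ι → ℂ, conj (r j) * r k * (conj (r j') * r k') ∂(Measure.pi fun _ => P) =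
      (if j = k ∧ j' = k' then 1 else 0) + (if j = k' ∧ j' = k then 1 else 0)
        + (if j = k ∧ j' = k' ∧ j = j' then κ else 0) := by
  simp only [quartic_eq_prod]
  rw [integral_fintype_prod_eq_prod (f := fun i (z : ℂ) =>
    conj z ^ ((Pi.single j 1 : ι → ℕ) i + (Pi.single j' 1 : ι → ℕ) i)
        * z ^ ((Pi.single k 1 : ι → ℕ) i + (Pi.single k' 1 : ι → ℕ) i))]
  by_cases hj : j = j'
  · subst hj
    by_cases hk : k = k'
    · subst hk
      by_cases hjk : j = k
      · subst hjk
        rw [Finset.prod_eq_single j]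
        · simpa [one_add_one_eq_two] using h.integral_conj_sq_mul_sq
        · intro i _ hi; simp [hi]
        · simp
      · rw [Finset.prod_eq_zero (Finset.mem_univ j)]
        · simp [hjk]
        · simpa [hjk, one_add_one_eq_two] using h.integral_conj_sq
    · by_cases hjk : j = k
      · subst hjk
        rw [Finset.prod_eq_zero (Finset.mem_univ k')]
        · simp [hk]
        · simpa [hk, Ne.symm hk] using h.integral_id
      · rw [Finset.prod_eq_zero (Finset.mem_univ k)]
        · simp [hjk]
        · simpa [hk, Ne.symm hjk] using h.integral_id
  · by_cases hk : k = k'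
    · subst hk
      by_cases hjk : j = k
      · subst hjk
        rw [Finset.prod_eq_zero (Finset.mem_univ j')]
        · simp [hj, Ne.symm hj]
        · simpa [hj, Ne.symm hj] using h.integral_conj
      · rw [Finset.prod_eq_zero (Finset.mem_univ j)]
        · simp [hjk]
        · simpa [hjk, hj] using h.integral_conj
    · by_cases h1 : j = k
      · subst h1
        by_cases h2 : j' = k'
        · subst h2
          rw [Finset.prod_eq_one]
          · simp [hj]
          · intro i _
            by_cases hi : i = j
            · subst hi; simpa [hj] using h.integral_conj_mul
            · by_cases hi' : i = j'
              · subst hi'; simpa [hi] using h.integral_conj_mul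
              · simp [hi, hi']
        · rw [Finset.prod_eq_zero (Finset.mem_univ j')]
          · simp [hk, h2]
          · simpa [Ne.symm hj, h2] using h.integral_conj
      · by_cases h3 : j = k'
        · subst h3
          by_cases h2 : j' = k
          · subst h2
            rw [Finset.prod_eq_one]
            · simp [hj]
            · intro i _
              by_cases hi : i = j
              · subst hi; simpa [hj] using h.integral_conj_mul
              · by_cases hi' : i = j'
                · subst hi'; simpa [hi] using h.integral_conj_mul
                · simp [hi, hi']
          · rw [Finset.prod_eq_zero (Finset.mem_univ j')]
            · simp [h1, h2]
            · simpa [Ne.symm hj, h2] using h.integral_conj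
        · rw [Finset.prod_eq_zero (Finset.mem_univ j)]
          · simp [h1, h3]
          · simpa [h1, h3, hj] using h.integral_conj

end Moments

end SampleCov

/-! ### Gram determinants and integration of one row -/

namespace SampleCov

open Polynomial Matrix ComplexConjugate

/-- The law of an `n × m` array of independent variables with law `P`. -/
noncomputable def arrayLaw (P : Measure ℂ) (n m : ℕ) : Measure (Fin n → Fin m → ℂ) :=
  Measure.pi fun _ => Measure.pi fun _ => P

instance (P : Measure ℂ) [IsProbabilityMeasure P] (n m : ℕ) :
    IsProbabilityMeasure (arrayLaw P n m) := by
  unfold arrayLaw; infer_instance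

/-- The polynomial `det (X* X + K)`, where `K` is a matrix of polynomials. -/
noncomputable def gramDet {n m : ℕ} (K : Matrix (Fin m) (Fin m) ℂ[X]) (x : Fin n → Fin m → ℂ) :
    ℂ[X] :=
  ((((of x)ᴴ * of x).map C : Matrix (Fin m) (Fin m) ℂ[X]) + K).det

/-- The polynomial `det (X* X - z)` in `z`. -/
noncomputable def gramCharpoly {n m : ℕ} (x : Fin n → Fin m → ℂ) : ℂ[X] :=
  gramDet (-((Polynomial.X : ℂ[X]) • (1 : Matrix (Fin m) (Fin m) ℂ[X]))) x

theorem gram_cons {n m : ℕ} (r : Fin m → ℂ) (x : Fin n → Fin m → ℂ) :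
    (of (Fin.cons r x : Fin (n + 1) → Fin m → ℂ))ᴴ * of (Fin.cons r x : Fin (n + 1) → Fin m → ℂ) =
      (of x)ᴴ * of x + vecMulVec (fun j => conj (r j)) r := by
  ext i j
  simp [mul_apply, Fin.sum_univ_succ, vecMulVec_apply, add_comm]

theorem dotProduct_mulVec_C {m : ℕ} (M : Matrix (Fin m) (Fin m) ℂ[X]) (r : Fin m → ℂ) :
    (fun k => C (r k)) ⬝ᵥ (M *ᵥ fun j => C (conj (r j))) =
      ∑ p : Fin m × Fin m, (conj (r p.1) * r p.2) • M p.2 p.1 := by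
  simp only [dotProduct, mulVec, Finset.mul_sum, Fintype.sum_prod_type]
  rw [Finset.sum_comm]
  refine Finset.sum_congr rfl fun j _ => Finset.sum_congr rfl fun k _ => ?_
  rw [smul_eq_C_mul, C_mul]; ring

theorem gramDet_cons {n m : ℕ} (K : Matrix (Fin m) (Fin m) ℂ[X]) (r : Fin m → ℂ)
    (x : Fin n → Fin m → ℂ) :
    gramDet K (Fin.cons r x : Fin (n + 1) → Fin m → ℂ) = gramDet K x +
      ∑ p : Fin m × Fin m, (conj (r p.1) * r p.2) •
        (((of x)ᴴ * of x).map C + K : Matrix (Fin m) (Fin m) ℂ[X]).adjugate p.2 p.1 := by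
  have h : ((of (Fin.cons r x : Fin (n + 1) → Fin m → ℂ))ᴴ *
      of (Fin.cons r x : Fin (n + 1) → Fin m → ℂ)).map C + K
      = (((of x)ᴴ * of x).map C + K : Matrix (Fin m) (Fin m) ℂ[X])
        + vecMulVec (fun j => C (conj (r j))) (fun k => C (r k)) := by
    rw [gram_cons]
    ext1 i j
    simp only [Matrix.add_apply, map_apply, vecMulVec_apply, C_add, C_mul]; ring
  rw [gramDet, h, det_add_vecMulVec, dotProduct_mulVec_C]; rfl

theorem bilin_add_sum_smul {ι : Type*} [Fintype ι] (W : ℂ[X] →ₗ[ℂ] ℂ[X] →ₗ[ℂ] ℂ) (D E : ℂ[X])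
    (c : ι → ℂ) (N N' : ι → ℂ[X]) :
    W (D + ∑ p, c p • N p) (E + ∑ p, c p • N' p) =
      W D E + (∑ p, c p * (W (N p) E + W D (N' p))
        + ∑ p, ∑ q, c p * c q * W (N p) (N' q)) := by
  simp only [map_add, LinearMap.add_apply, map_sum, LinearMap.sum_apply, map_smul,
    LinearMap.smul_apply, smul_eq_mul, mul_add, Finset.sum_add_distrib, Finset.mul_sum, mul_assoc]
  rw [Finset.sum_comm (f := fun p q => c p * (c q * (W (N q)) (N' p)))]
  have : ∀ p q, c q * (c p * W (N p) (N' q)) = c p * (c q * W (N p) (N' q)) := by intros; ring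
  simp only [this]
  ring

/-- This is why `gramDet` allows an arbitrary shift K: cofactors are differences of such
determinants with K changed by an elementary matrix. -/
theorem adjugate_gram_apply {n m : ℕ} (K : Matrix (Fin m) (Fin m) ℂ[X]) (x : Fin n → Fin m → ℂ)
    (k j : Fin m) :
    (((of x)ᴴ * of x).map C + K : Matrix (Fin m) (Fin m) ℂ[X]).adjugate k j =
      gramDet (K + vecMulVec (Pi.single j 1) (Pi.single k 1)) x - gramDet K x := by
  rw [adjugate_apply_eq_det_sub, gramDet, gramDet, add_assoc]

section Fubini

variable {P : Measure ℂ} [IsProbabilityMeasure P]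

theorem measurePreserving_cons (P : Measure ℂ) [IsProbabilityMeasure P] (n m : ℕ) :
    MeasurePreserving
      (fun p : (Fin m → ℂ) × (Fin n → Fin m → ℂ) => (Fin.cons p.1 p.2 : Fin (n + 1) → Fin m → ℂ))
      ((Measure.pi fun _ => P).prod (arrayLaw P n m)) (arrayLaw P (n + 1) m) ∧
    MeasurableEmbedding
      (fun p : (Fin m → ℂ) × (Fin n → Fin m → ℂ) =>
        (Fin.cons p.1 p.2 : Fin (n + 1) → Fin m → ℂ)) := by
  have h := (measurePreserving_piFinSuccAbove
    (fun _ : Fin (n + 1) => Measure.pi fun _ : Fin m => P) 0).symm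
  have e : (fun p : (Fin m → ℂ) × (Fin n → Fin m → ℂ) =>
      (Fin.cons p.1 p.2 : Fin (n + 1) → Fin m → ℂ)) =
      (MeasurableEquiv.piFinSuccAbove (fun _ : Fin (n + 1) => Fin m → ℂ) 0).symm := by
    ext p
    simp [MeasurableEquiv.piFinSuccAbove]
  rw [e]
  exact ⟨h, MeasurableEquiv.measurableEmbedding _⟩

theorem integrable_arrayLaw_succ {E : Type*} [NormedAddCommGroup E] {n m : ℕ}
    {F : (Fin (n + 1) → Fin m → ℂ) → E} :
    Integrable F (arrayLaw P (n + 1) m) ↔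
      Integrable (fun p : (Fin m → ℂ) × (Fin n → Fin m → ℂ) => F (Fin.cons p.1 p.2))
        ((Measure.pi fun _ => P).prod (arrayLaw P n m)) :=
  ((measurePreserving_cons P n m).1.integrable_comp_emb (measurePreserving_cons P n m).2).symm

theorem integral_arrayLaw_succ {n m : ℕ}
    {F : (Fin (n + 1) → Fin m → ℂ) → ℂ} (hF : Integrable F (arrayLaw P (n + 1) m)) :
    ∫ x, F x ∂(arrayLaw P (n + 1) m) =
      ∫ x, ∫ r, F (Fin.cons r x) ∂(Measure.pi fun _ => P) ∂(arrayLaw P n m) := by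
  rw [integrable_arrayLaw_succ] at hF
  rw [← integral_prod_symm _ hF]
  exact ((measurePreserving_cons P n m).1.integral_comp (measurePreserving_cons P n m).2 F).symm

/-- Induction on the number of rows, for all shifts at once. A new row contributes monomials of
degree at most four, independent of coefficients that are again covered by the induction hypothesis.
Only finitely many algebraic expansions occur, so W needs no continuity. -/
theorem IsNormalizedLaw.integrable_gramDet {κ : ℂ} (h : IsNormalizedLaw P κ) {n m : ℕ}
    (W : ℂ[X] →ₗ[ℂ] ℂ[X] →ₗ[ℂ] ℂ) (K₁ K₂ : Matrix (Fin m) (Fin m) ℂ[X]) :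
    Integrable (fun x : Fin n → Fin m → ℂ => W (gramDet K₁ x) (gramDet K₂ x))
      (arrayLaw P n m) := by
  induction n generalizing K₁ K₂ with
  | zero =>
    refine (integrable_const (W (gramDet K₁ (0 : Fin 0 → Fin m → ℂ))
      (gramDet K₂ (0 : Fin 0 → Fin m → ℂ)))).congr (Eventually.of_forall fun x => ?_)
    simp [Subsingleton.elim x 0]
  | succ n ih =>
    rw [integrable_arrayLaw_succ]
    simp only [gramDet_cons, bilin_add_sum_smul, adjugate_gram_apply]
    refine ((ih K₁ K₂).comp_snd _).add ((integrable_finsetSum _ fun p _ => ?_).add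
      (integrable_finsetSum _ fun p _ => integrable_finsetSum _ fun q _ => ?_))
    · have hG : Integrable (fun x : Fin n → Fin m → ℂ =>
          W (gramDet (K₁ + vecMulVec (Pi.single p.1 1) (Pi.single p.2 1)) x - gramDet K₁ x)
            (gramDet K₂ x) + W (gramDet K₁ x)
            (gramDet (K₂ + vecMulVec (Pi.single p.1 1) (Pi.single p.2 1)) x - gramDet K₂ x))
          (arrayLaw P n m) := by
        simp only [map_sub, LinearMap.sub_apply]
        exact ((ih _ _).sub (ih _ _)).add ((ih _ _).sub (ih _ _))
      exact (h.integrable_quadratic p.1 p.2).mul_prod hG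
    · have hG : Integrable (fun x : Fin n → Fin m → ℂ =>
          W (gramDet (K₁ + vecMulVec (Pi.single p.1 1) (Pi.single p.2 1)) x - gramDet K₁ x)
            (gramDet (K₂ + vecMulVec (Pi.single q.1 1) (Pi.single q.2 1)) x - gramDet K₂ x))
          (arrayLaw P n m) := by
        simp only [map_sub, LinearMap.sub_apply]
        exact ((ih _ _).sub (ih _ _)).sub ((ih _ _).sub (ih _ _))
      exact (h.integrable_quartic p.1 p.2 q.1 q.2).mul_prod hG

end Fubini

/-- Integration of one row: the expectation of a bilinear expression in a rank one perturbation of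
the determinant. -/
theorem IsNormalizedLaw.integral_row {P : Measure ℂ} [IsProbabilityMeasure P] {κ : ℂ}
    (h : IsNormalizedLaw P κ) {m : ℕ} (W : ℂ[X] →ₗ[ℂ] ℂ[X] →ₗ[ℂ] ℂ) (D : ℂ[X])
    (M : Matrix (Fin m) (Fin m) ℂ[X]) :
    ∫ r : Fin m → ℂ, W (D + ∑ p : Fin m × Fin m, (conj (r p.1) * r p.2) • M p.2 p.1)
        (D + ∑ p : Fin m × Fin m, (conj (r p.1) * r p.2) • M p.2 p.1) ∂(Measure.pi fun _ => P) =
      W D D + W M.trace D + W D M.trace + W M.trace M.trace + ∑ i, ∑ j, W (M i j) (M j i)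
        + κ * ∑ i, W (M i i) (M i i) := by
  simp only [bilin_add_sum_smul]
  have i1 : ∀ p : Fin m × Fin m, Integrable (fun r : Fin m → ℂ => (conj (r p.1) * r p.2) *
      (W (M p.2 p.1) D + W D (M p.2 p.1))) (Measure.pi fun _ => P) := fun p =>
    (h.integrable_quadratic p.1 p.2).mul_const _
  have i2 : ∀ p q : Fin m × Fin m, Integrable (fun r : Fin m → ℂ =>
      (conj (r p.1) * r p.2 * (conj (r q.1) * r q.2)) * W (M p.2 p.1) (M q.2 q.1))
      (Measure.pi fun _ => P) :=
    fun p q => (h.integrable_quartic p.1 p.2 q.1 q.2).mul_const _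
  have i1' := integrable_finsetSum Finset.univ fun p _ => i1 p
  have i2' := integrable_finsetSum Finset.univ fun p _ =>
    integrable_finsetSum Finset.univ fun q _ => i2 p q
  have hadd : ∀ {f g : (Fin m → ℂ) → ℂ} (c : ℂ), Integrable f (Measure.pi fun _ => P) →
      Integrable g (Measure.pi fun _ => P) → ∫ r, c + (f r + g r) ∂(Measure.pi fun _ => P) =
      c + (∫ r, f r ∂(Measure.pi fun _ => P) + ∫ r, g r ∂(Measure.pi fun _ => P)) := by
    intro f g c hf hg
    have hfg : Integrable (fun r => f r + g r) (Measure.pi fun _ : Fin m => P) := hf.add hg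
    rw [integral_add (integrable_const _) hfg, integral_add hf hg]
    simp
  rw [hadd _ i1' i2',
    integral_finsetSum _ fun p _ => i1 p,
    integral_finsetSum _ fun p _ => integrable_finsetSum _ fun q _ => i2 p q]
  simp only [integral_finsetSum _ fun q _ => i2 _ q, integral_mul_const, h.integral_quadratic,
    h.integral_quartic]
  have s1 : ∑ p : Fin m × Fin m, (if p.1 = p.2 then 1 else 0) *
      (W (M p.2 p.1) D + W D (M p.2 p.1)) = W M.trace D + W D M.trace := by
    simp [Fintype.sum_prod_type, trace, Finset.sum_add_distrib]
  have s2 : ∑ p : Fin m × Fin m, ∑ q : Fin m × Fin m,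
      (if p.1 = p.2 ∧ q.1 = q.2 then 1 else 0) * W (M p.2 p.1) (M q.2 q.1) =
      W M.trace M.trace := by
    simp only [Fintype.sum_prod_type, ite_and, ite_mul, one_mul, zero_mul, trace, diag_apply,
      map_sum, LinearMap.sum_apply]
    simp
    rw [Finset.sum_comm]
  have s3 : ∑ p : Fin m × Fin m, ∑ q : Fin m × Fin m,
      (if p.1 = q.2 ∧ q.1 = p.2 then 1 else 0) * W (M p.2 p.1) (M q.2 q.1) =
      ∑ i, ∑ j, W (M i j) (M j i) := by
    simp only [Fintype.sum_prod_type, ite_and, ite_mul, one_mul, zero_mul]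
    rw [Finset.sum_comm]
    simp
  have s4 : ∑ p : Fin m × Fin m, ∑ q : Fin m × Fin m,
      (if p.1 = p.2 ∧ q.1 = q.2 ∧ p.1 = q.1 then κ else 0) * W (M p.2 p.1) (M q.2 q.1) =
      κ * ∑ i, W (M i i) (M i i) := by
    simp only [Fintype.sum_prod_type, ite_and, ite_mul, zero_mul]
    simp [Finset.mul_sum]
  simp only [add_mul, Finset.sum_add_distrib, s1, s2, s3, s4]
  ring

end SampleCov

/-! ### The recursion in n and m, and its solution -/

namespace SampleCov

open Polynomial Matrix ComplexConjugate

theorem gramCharpoly_eq {n m : ℕ} (x : Fin n → Fin m → ℂ) :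
    gramCharpoly x = ((((of x)ᴴ * of x).map C : Matrix (Fin m) (Fin m) ℂ[X])
      - (Polynomial.X : ℂ[X]) • (1 : Matrix (Fin m) (Fin m) ℂ[X])).det := by
  rw [gramCharpoly, gramDet, sub_eq_add_neg]

theorem gramCharpoly_zero {m : ℕ} (x : Fin 0 → Fin m → ℂ) :
    gramCharpoly x = (-Polynomial.X) ^ m := by
  have : (of x)ᴴ * of x = (0 : Matrix (Fin m) (Fin m) ℂ) := by
    ext i j; simp [mul_apply]
  rw [gramCharpoly_eq, this]
  have e : ((0 : Matrix (Fin m) (Fin m) ℂ).map C : Matrix (Fin m) (Fin m) ℂ[X])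
      - (Polynomial.X : ℂ[X]) • 1 = (-Polynomial.X : ℂ[X]) • 1 := by
    rw [Matrix.map_zero _ (map_zero _), zero_sub, neg_smul]
  rw [e, det_smul, det_one, Fintype.card_fin, mul_one]

/-- Deleting a column of an array. -/
def deleteCol {n m : ℕ} (i : Fin (m + 1)) (x : Fin n → Fin (m + 1) → ℂ) : Fin n → Fin m → ℂ :=
  fun a b => x a (i.succAbove b)

/-- Removing row and column i from X*X gives the Gram matrix of X without column i; the cofactor
sign is even. -/
theorem adjugate_gram_diag {n m : ℕ} (x : Fin n → Fin (m + 1) → ℂ) (i : Fin (m + 1)) :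
    ((((of x)ᴴ * of x).map C : Matrix (Fin (m + 1)) (Fin (m + 1)) ℂ[X])
      - (Polynomial.X : ℂ[X]) • (1 : Matrix (Fin (m + 1)) (Fin (m + 1)) ℂ[X])).adjugate i i =
    gramCharpoly (deleteCol i x) := by
  rw [adjugate_fin_succ_eq_det_submatrix, gramCharpoly_eq, ← two_mul, pow_mul]
  simp only [even_two, Even.neg_pow, one_pow, one_mul]
  congr 1
  ext1 a b
  simp only [submatrix_apply, Matrix.sub_apply, Matrix.smul_apply, map_apply, one_apply,
    Fin.succAbove_right_inj]
  rfl

theorem measurePreserving_deleteCol (P : Measure ℂ) [IsProbabilityMeasure P] {n m : ℕ}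
    (i : Fin (m + 1)) :
    MeasurePreserving (deleteCol (n := n) i) (arrayLaw P n (m + 1)) (arrayLaw P n m) := by
  refine measurePreserving_pi (μ := fun _ : Fin n => Measure.pi fun _ : Fin (m + 1) => P)
    (ν := fun _ : Fin n => Measure.pi fun _ : Fin m => P)
    (f := fun _ (y : Fin (m + 1) → ℂ) (b : Fin m) => y (i.succAbove b)) fun _ => ?_
  have h1 := measurePreserving_piFinSuccAbove (fun _ : Fin (m + 1) => P) i
  have h2 := (measurePreserving_snd (μ := P) (ν := Measure.pi fun _ : Fin m => P)).comp h1
  convert h2 using 1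
  rfl

/-- The expected antisymmetrized bilinear form of the characteristic polynomial. -/
noncomputable def expectComm (P : Measure ℂ) (n m : ℕ) (B : ℂ[X] →ₗ[ℂ] ℂ[X] →ₗ[ℂ] ℂ) : ℂ :=
  ∫ x : Fin n → Fin m → ℂ, commForm B (gramCharpoly x) (gramCharpoly x) ∂(arrayLaw P n m)

section Recursion

variable {P : Measure ℂ} [IsProbabilityMeasure P] {κ : ℂ}

theorem IsNormalizedLaw.integrable_gramCharpoly (h : IsNormalizedLaw P κ) {n m : ℕ}
    (W : ℂ[X] →ₗ[ℂ] ℂ[X] →ₗ[ℂ] ℂ) :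
    Integrable (fun x : Fin n → Fin m → ℂ => W (gramCharpoly x) (gramCharpoly x))
      (arrayLaw P n m) :=
  h.integrable_gramDet W _ _

/-- In the row average, everything except the cumulant term is exactly the left side of
`commForm_rank_one_moment`, hence collapses to `oneSubDeriv` in both arguments. -/
theorem IsNormalizedLaw.expectComm_succ_aux (h : IsNormalizedLaw P κ) (n m : ℕ)
    (B : ℂ[X] →ₗ[ℂ] ℂ[X] →ₗ[ℂ] ℂ) :
    Integrable (fun x : Fin n → Fin m → ℂ => ∑ i, commForm B
        (((((of x)ᴴ * of x).map C : Matrix (Fin m) (Fin m) ℂ[X])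
      - (Polynomial.X : ℂ[X]) • (1 : Matrix (Fin m) (Fin m) ℂ[X])).adjugate i i)
        (((((of x)ᴴ * of x).map C : Matrix (Fin m) (Fin m) ℂ[X])
      - (Polynomial.X : ℂ[X]) • (1 : Matrix (Fin m) (Fin m) ℂ[X])).adjugate i i))
        (arrayLaw P n m) ∧
    expectComm P (n + 1) m B =
      expectComm P n m (B.compl₁₂ (oneSubDeriv ℂ) (oneSubDeriv ℂ))
      + κ * ∫ x : Fin n → Fin m → ℂ, ∑ i, commForm B
        (((((of x)ᴴ * of x).map C : Matrix (Fin m) (Fin m) ℂ[X])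
      - (Polynomial.X : ℂ[X]) • (1 : Matrix (Fin m) (Fin m) ℂ[X])).adjugate i i)
        (((((of x)ᴴ * of x).map C : Matrix (Fin m) (Fin m) ℂ[X])
      - (Polynomial.X : ℂ[X]) • (1 : Matrix (Fin m) (Fin m) ℂ[X])).adjugate i i)
        ∂(arrayLaw P n m) := by
  have hint : Integrable (fun x : Fin n → Fin m → ℂ => ∑ i, commForm B
        (((((of x)ᴴ * of x).map C : Matrix (Fin m) (Fin m) ℂ[X])
      - (Polynomial.X : ℂ[X]) • (1 : Matrix (Fin m) (Fin m) ℂ[X])).adjugate i i)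
        (((((of x)ᴴ * of x).map C : Matrix (Fin m) (Fin m) ℂ[X])
      - (Polynomial.X : ℂ[X]) • (1 : Matrix (Fin m) (Fin m) ℂ[X])).adjugate i i))
        (arrayLaw P n m) := by
    refine integrable_finsetSum _ fun i _ => ?_
    simp only [sub_eq_add_neg _ ((Polynomial.X : ℂ[X]) • (1 : Matrix (Fin m) (Fin m) ℂ[X])),
      adjugate_gram_apply, map_sub, LinearMap.sub_apply]
    exact ((h.integrable_gramDet _ _ _).sub (h.integrable_gramDet _ _ _)).sub
      ((h.integrable_gramDet _ _ _).sub (h.integrable_gramDet _ _ _))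
  refine ⟨hint, ?_⟩
  rw [expectComm, integral_arrayLaw_succ (h.integrable_gramCharpoly _), expectComm,
    ← integral_const_mul, ← integral_add (h.integrable_gramCharpoly _) (hint.const_mul _)]
  refine integral_congr_ae (Eventually.of_forall fun x => ?_)
  simp only [gramCharpoly, gramDet_cons]
  have hB := commForm_rank_one_moment B ((of x)ᴴ * of x) (sub_eq_add_neg _ _).symm
  rw [h.integral_row]
  simp only [gramDet, sub_eq_add_neg] at hB ⊢
  rw [← hB]

theorem IsNormalizedLaw.expectComm_succ_zero (h : IsNormalizedLaw P κ) (n : ℕ)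
    (B : ℂ[X] →ₗ[ℂ] ℂ[X] →ₗ[ℂ] ℂ) :
    expectComm P (n + 1) 0 B =
      expectComm P n 0 (B.compl₁₂ (oneSubDeriv ℂ) (oneSubDeriv ℂ)) := by
  rw [(h.expectComm_succ_aux n 0 B).2]
  simp

/-- Deleting any of the m + 1 columns leaves an n × m array with the same entry law, so the diagonal
cofactors contribute equally. -/
theorem IsNormalizedLaw.expectComm_succ_succ (h : IsNormalizedLaw P κ) (n m : ℕ)
    (B : ℂ[X] →ₗ[ℂ] ℂ[X] →ₗ[ℂ] ℂ) :
    expectComm P (n + 1) (m + 1) B =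
      expectComm P n (m + 1) (B.compl₁₂ (oneSubDeriv ℂ) (oneSubDeriv ℂ))
      + κ * ((m + 1) * expectComm P n m B) := by
  rw [(h.expectComm_succ_aux n (m + 1) B).2]
  simp only [adjugate_gram_diag]
  have hi : ∀ i : Fin (m + 1), Integrable (fun x : Fin n → Fin (m + 1) → ℂ =>
      commForm B (gramCharpoly (deleteCol i x)) (gramCharpoly (deleteCol i x)))
      (arrayLaw P n (m + 1)) := fun i =>
    (measurePreserving_deleteCol P i).integrable_comp_of_integrable
      (g := fun x => commForm B (gramCharpoly x) (gramCharpoly x)) (h.integrable_gramCharpoly _)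
  have hi2 : ∀ i : Fin (m + 1), ∫ x : Fin n → Fin (m + 1) → ℂ,
      commForm B (gramCharpoly (deleteCol i x)) (gramCharpoly (deleteCol i x))
      ∂(arrayLaw P n (m + 1)) = expectComm P n m B := fun i => by
    have hmp := measurePreserving_deleteCol (n := n) P i
    rw [expectComm, ← hmp.map_eq, integral_map hmp.measurable.aemeasurable]
    rw [hmp.map_eq]
    exact (h.integrable_gramCharpoly _).aestronglyMeasurable
  rw [integral_finsetSum _ fun i _ => hi i]
  simp [hi2]

/-- The bilinear expression describing the Gaussian case. -/
noncomputable def gaussComm (n m : ℕ) (B : ℂ[X] →ₗ[ℂ] ℂ[X] →ₗ[ℂ] ℂ) : ℂ :=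
  commForm (B.compl₁₂ (oneSubDeriv ℂ ^ n) (oneSubDeriv ℂ ^ n)) (Polynomial.X ^ m)
    (Polynomial.X ^ m)

theorem gaussComm_succ (n m : ℕ) (B : ℂ[X] →ₗ[ℂ] ℂ[X] →ₗ[ℂ] ℂ) :
    gaussComm n m (B.compl₁₂ (oneSubDeriv ℂ) (oneSubDeriv ℂ)) = gaussComm (n + 1) m B := by
  simp only [gaussComm, commForm_apply, LinearMap.compl₁₂_apply, pow_succ', Module.End.mul_apply]

/-- The form B varies in the induction because the recursion changes it. Terms with j > m vanish
through `m.choose j`, so truncated subtraction is harmless. -/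
theorem IsNormalizedLaw.expectComm_eq_sum (h : IsNormalizedLaw P κ) (n m : ℕ)
    (B : ℂ[X] →ₗ[ℂ] ℂ[X] →ₗ[ℂ] ℂ) :
    expectComm P n m B = ∑ j ∈ Finset.range (n + 1),
      (n.choose j * m.choose j * j.factorial : ℂ) * κ ^ j * gaussComm (n - j) (m - j) B := by
  induction n generalizing m B with
  | zero =>
    simp only [expectComm, gramCharpoly_zero, gaussComm, commForm_apply, neg_pow (Polynomial.X : ℂ[X]) m]
    -- Without rows the determinant is (-X)^m; its sign appears twice and cancels.
    have e : ((-1 : ℂ[X]) ^ m) = C ((-1 : ℂ) ^ m) := by simp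
    have e2 : (-1 : ℂ) ^ m * (-1) ^ m = 1 := by rw [← mul_pow]; simp
    simp only [e, ← smul_eq_C_mul, map_smul, smul_eq_mul,
      LinearMap.smul_apply, integral_const, probReal_univ, one_smul]
    simp
    linear_combination (B (Polynomial.X * Polynomial.X ^ m) (Polynomial.X ^ m)
      - B (Polynomial.X ^ m) (Polynomial.X * Polynomial.X ^ m)) * e2
  | succ n ih =>
    cases m with
    | zero =>
      rw [h.expectComm_succ_zero, ih]
      simp only [Finset.sum_range_succ' _ (n + 1), Finset.sum_range_succ' _ n,
        Nat.choose_zero_succ]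
      simp [gaussComm_succ]
    | succ m =>
      rw [h.expectComm_succ_succ, ih, ih]
      have e1 : ∀ j ∈ Finset.range (n + 1),
          (n.choose j * (m + 1).choose j * j.factorial : ℂ) * κ ^ j *
            gaussComm (n - j) (m + 1 - j) (B.compl₁₂ (oneSubDeriv ℂ) (oneSubDeriv ℂ)) =
          (n.choose j * (m + 1).choose j * j.factorial : ℂ) * κ ^ j *
            gaussComm (n + 1 - j) (m + 1 - j) B := by
        intro j hj
        rw [gaussComm_succ, Nat.succ_sub (Nat.lt_succ_iff.mp (Finset.mem_range.mp hj))]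
      rw [Finset.sum_congr rfl e1, Finset.sum_range_succ' _ (n + 1)]
      have e2 : ∑ j ∈ Finset.range (n + 1),
          (n.choose j * (m + 1).choose j * j.factorial : ℂ) * κ ^ j *
            gaussComm (n + 1 - j) (m + 1 - j) B =
          ∑ j ∈ Finset.range (n + 1),
          (n.choose (j + 1) * (m + 1).choose (j + 1) * (j + 1).factorial : ℂ) * κ ^ (j + 1) *
            gaussComm (n - j) (m - j) B + gaussComm (n + 1) (m + 1) B := by
        rw [Finset.sum_range_succ' _ n, Finset.sum_range_succ _ n]
        simp
      rw [e2, Finset.mul_sum, Finset.mul_sum, add_right_comm, ← Finset.sum_add_distrib]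
      congr 1
      · refine Finset.sum_congr rfl fun j _ => ?_
        -- Absorption in m and Pascal's rule in n combine the two branches of the recursion into one
        -- coefficient.
        have h1 : ((m : ℂ) + 1) * m.choose j = (m + 1).choose (j + 1) * (j + 1) := by
          exact_mod_cast Nat.add_one_mul_choose_eq m j
        rw [Nat.choose_succ_succ n j, Nat.factorial_succ, Nat.add_sub_add_right,
          Nat.add_sub_add_right]
        push_cast
        rw [show κ * (((m : ℂ) + 1) * (n.choose j * m.choose j * j.factorial * κ ^ j
          * gaussComm (n - j) (m - j) B)) = (((m : ℂ) + 1) * m.choose j) * (κ * n.choose j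
            * j.factorial * κ ^ j * gaussComm (n - j) (m - j) B) by ring, h1]
        ring
      · simp

end Recursion

end SampleCov

/-! ### Monic Laguerre polynomials as powers of 1 - d/dX applied to monomials -/

namespace SampleCov

open Polynomial

section Laguerre

variable (R : Type*) [CommRing R]

/-- The polynomial `(1 - d/dX)^n X^m`. -/
noncomputable def lagAux (n m : ℕ) : R[X] := (oneSubDeriv R ^ n) (X ^ m)

/-- The monic Laguerre polynomial of degree `k` with parameter `α`. -/
noncomputable def laguerre (α k : ℕ) : R[X] := lagAux R (k + α) k

theorem lagAux_zero_right (n : ℕ) : lagAux R n 0 = 1 := by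
  induction n with
  | zero => simp [lagAux]
  | succ n ih =>
    rw [lagAux, pow_succ', Module.End.mul_apply]
    rw [lagAux] at ih
    rw [ih, oneSubDeriv_apply]
    simp

theorem lagAux_succ_left (n m : ℕ) :
    lagAux R (n + 1) (m + 1) = lagAux R n (m + 1) - (m + 1 : R[X]) * lagAux R n m := by
  rw [lagAux, pow_succ, Module.End.mul_apply, oneSubDeriv_apply, derivative_X_pow, map_sub]
  have : C ((m + 1 : ℕ) : R) * X ^ (m + 1 - 1) = (m + 1 : R) • (X ^ m : R[X]) := by
    rw [smul_eq_C_mul]; simp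
  rw [this, map_smul, smul_eq_C_mul]
  simp [lagAux]

/-- The commutator of `oneSubDeriv` with multiplication by X is -1, hence that of its (n+1)-st power
is -(n+1) times the n-th power. -/
theorem oneSubDeriv_pow_X_mul (n : ℕ) (p : R[X]) :
    (oneSubDeriv R ^ (n + 1)) (X * p) =
      X * (oneSubDeriv R ^ (n + 1)) p - (n + 1 : R[X]) * (oneSubDeriv R ^ n) p := by
  induction n generalizing p with
  | zero => simp [oneSubDeriv_X_mul]
  | succ n ih =>
    rw [pow_succ, Module.End.mul_apply, oneSubDeriv_X_mul, map_sub, ih, ← Module.End.mul_apply,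
      ← pow_succ, ← Module.End.mul_apply, ← pow_succ]
    push_cast
    ring

theorem lagAux_succ_right (n m : ℕ) :
    lagAux R (n + 1) (m + 1) = X * lagAux R (n + 1) m - (n + 1 : R[X]) * lagAux R n m := by
  rw [lagAux, pow_succ' X, oneSubDeriv_pow_X_mul, lagAux, lagAux]

theorem oneSubDeriv_commute_derivative (n : ℕ) (p : R[X]) :
    derivative ((oneSubDeriv R ^ n) p) = (oneSubDeriv R ^ n) (derivative p) := by
  induction n generalizing p with
  | zero => simp
  | succ n ih =>
    rw [pow_succ, Module.End.mul_apply, ih, Module.End.mul_apply, oneSubDeriv_apply,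
      oneSubDeriv_apply, derivative_sub]

theorem derivative_lagAux (n m : ℕ) :
    derivative (lagAux R n (m + 1)) = (m + 1 : R[X]) * lagAux R n m := by
  rw [lagAux, oneSubDeriv_commute_derivative, derivative_X_pow]
  have : C ((m + 1 : ℕ) : R) * X ^ (m + 1 - 1) = (m + 1 : R) • (X ^ m : R[X]) := by
    rw [smul_eq_C_mul]; simp
  rw [this, map_smul, smul_eq_C_mul]
  simp [lagAux]

theorem laguerre_zero (α : ℕ) : laguerre R α 0 = 1 := lagAux_zero_right R _

theorem laguerre_one (α : ℕ) : laguerre R α 1 = X - (α + 1 : R[X]) := by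
  rw [laguerre, add_comm, lagAux_succ_right, lagAux_zero_right, lagAux_zero_right]; ring

theorem lagAux_eq_laguerre (α k : ℕ) :
    lagAux R (k + α) (k + 1) = laguerre R α (k + 1) + (k + 1 : R[X]) * laguerre R α k := by
  rw [laguerre, laguerre, add_right_comm, lagAux_succ_left]; ring

/-- The three-term recurrence of the monic Laguerre polynomials. -/
theorem X_mul_laguerre (α k : ℕ) :
    X * laguerre R α (k + 1) = laguerre R α (k + 2) + (2 * k + α + 3 : R[X]) * laguerre R α (k + 1)
      + ((k + 1) * (k + 1 + α) : R[X]) * laguerre R α k := by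
  have h1 := lagAux_eq_laguerre R α (k + 1)
  have h2 := lagAux_succ_right R (k + α) (k + 1)
  have h3 := lagAux_eq_laguerre R α k
  rw [add_right_comm] at h1
  rw [h1, h3] at h2
  have h4 : lagAux R (k + α + 1) (k + 1) = laguerre R α (k + 1) := by
    rw [laguerre, add_right_comm]
  rw [h4] at h2
  push_cast at h2 ⊢
  linear_combination -h2

theorem X_mul_laguerre_zero (α : ℕ) :
    X * laguerre R α 0 = laguerre R α 1 + (α + 1 : R[X]) * laguerre R α 0 := by
  rw [laguerre_zero, laguerre_one]; ring

/-- The structure relation for the derivative of the monic Laguerre polynomials. -/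
theorem X_mul_derivative_laguerre (α k : ℕ) :
    X * derivative (laguerre R α (k + 1)) = (k + 1 : R[X]) * laguerre R α (k + 1)
      + ((k + 1) * (k + 1 + α) : R[X]) * laguerre R α k := by
  have h2 := lagAux_succ_right R (k + α) k
  have h4 : lagAux R (k + α + 1) (k + 1) = laguerre R α (k + 1) := by
    rw [laguerre, add_right_comm]
  have h5 : lagAux R (k + α + 1) k = lagAux R (k + 1 + α) k := by rw [add_right_comm]
  rw [laguerre, derivative_lagAux, ← h5, ← laguerre]
  rw [h4, ← laguerre] at h2
  push_cast at h2 ⊢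
  linear_combination -(k + 1 : R[X]) * h2

/-- The structure relation with the lower degree eliminated by the three-term recurrence. The two
versions together close the system for consecutive Laguerre functions. -/
theorem X_mul_derivative_laguerre' (α k : ℕ) :
    X * derivative (laguerre R α k) =
      (X - (k + 1 + α : R[X])) * laguerre R α k - laguerre R α (k + 1) := by
  cases k with
  | zero => simp [laguerre_zero, laguerre_one, add_comm]
  | succ k =>
    rw [X_mul_derivative_laguerre]
    have := X_mul_laguerre R α k
    push_cast
    linear_combination -this

end Laguerre

/-! ### Christoffel-Darboux and the exact formula for the correlation function -/

section ChristoffelDarboux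

/-- The squared norm of the monic Laguerre polynomial of degree `k`. -/
noncomputable def lagNorm (α k : ℕ) : ℝ := (k.factorial : ℝ) * (k + α).factorial

theorem lagNorm_pos (α k : ℕ) : 0 < lagNorm α k := by
  unfold lagNorm; positivity

theorem lagNorm_succ (α k : ℕ) : lagNorm α (k + 1) = (k + 1) * (k + 1 + α) * lagNorm α k := by
  unfold lagNorm
  rw [Nat.factorial_succ, add_right_comm, Nat.factorial_succ]; push_cast; ring

variable {K : Type*} [Field K]

/-- The Christoffel-Darboux formula in bilinear form. -/
theorem christoffelDarboux [CharZero K] (α m : ℕ) (B : K[X] →ₗ[K] K[X] →ₗ[K] K) :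
    ((m.factorial : K) * (m + α).factorial) * ∑ k ∈ Finset.range (m + 1),
        ((k.factorial : K) * (k + α).factorial)⁻¹ * commForm B (laguerre K α k) (laguerre K α k) =
      B (laguerre K α (m + 1)) (laguerre K α m) - B (laguerre K α m) (laguerre K α (m + 1)) := by
  induction m with
  | zero =>
    have hne : ((α.factorial : ℕ) : K) ≠ 0 := Nat.cast_ne_zero.mpr (Nat.factorial_ne_zero _)
    have e : X * laguerre K α 0 = laguerre K α 1 + (α + 1 : K) • laguerre K α 0 := by
      rw [X_mul_laguerre_zero, smul_eq_C_mul]; simp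
    rw [Finset.sum_range_one, commForm_apply, e]
    simp only [map_add, map_smul, LinearMap.add_apply, LinearMap.smul_apply, Nat.factorial_zero,
      Nat.cast_one, zero_add, one_mul]
    field_simp
    ring
  | succ m ih =>
    have hne : (((m + 1).factorial : K) * (m + 1 + α).factorial) ≠ 0 :=
      mul_ne_zero (Nat.cast_ne_zero.mpr (Nat.factorial_ne_zero _))
        (Nat.cast_ne_zero.mpr (Nat.factorial_ne_zero _))
    -- The ratio of successive squared norms is the lowest coefficient of the three-term recurrence,
    -- which makes the sum telescope.
    have hs : (((m + 1).factorial : K) * (m + 1 + α).factorial) =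
        ((m + 1) * (m + 1 + α)) * ((m.factorial : K) * (m + α).factorial) := by
      rw [Nat.factorial_succ, add_right_comm, Nat.factorial_succ]; push_cast; ring
    have e : X * laguerre K α (m + 1) = laguerre K α (m + 2)
        + (2 * m + α + 3 : K) • laguerre K α (m + 1)
        + ((m + 1) * (m + 1 + α) : K) • laguerre K α m := by
      rw [X_mul_laguerre, smul_eq_C_mul, smul_eq_C_mul]
      simp [show (C (2 : K)) = 2 from map_ofNat C 2, show (C (3 : K)) = 3 from map_ofNat C 3]
    rw [Finset.sum_range_succ, mul_add, mul_inv_cancel_left₀ hne, hs, mul_assoc, ih,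
      commForm_apply, e]
    simp only [map_add, map_smul, LinearMap.add_apply, LinearMap.smul_apply, smul_eq_mul]
    ring

/-- Every product evaluation `p(x) q(y)` arises from antisymmetrizing a bilinear form. -/
theorem exists_commForm_eq_eval (x y : K) : ∃ B : K[X] →ₗ[K] K[X] →ₗ[K] K,
    ∀ p q : K[X], commForm B p q = p.eval x * q.eval y := by
  by_cases hxy : x = y
  · subst hxy
    -- On the diagonal B(p, q) = p'(x) q(x) works because (Xp)' - X p' = p; off the diagonal one
    -- divides p(x) q(y) by x - y.
    refine ⟨(LinearMap.mul K K).compl₁₂ ((leval x).comp derivative) (leval x), fun p q => ?_⟩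
    simp only [commForm_apply, LinearMap.compl₁₂_apply, LinearMap.mul_apply', leval_apply,
      LinearMap.comp_apply, derivative_mul, derivative_X, eval_add, eval_mul, eval_X, eval_one]
    ring
  · refine ⟨(x - y)⁻¹ • (LinearMap.mul K K).compl₁₂ (leval x) (leval y), fun p q => ?_⟩
    have : x - y ≠ 0 := sub_ne_zero.mpr hxy
    simp only [commForm_apply, LinearMap.compl₁₂_apply, LinearMap.mul_apply', leval_apply,
      LinearMap.smul_apply, smul_eq_mul, eval_mul, eval_X]
    field_simp

/-- The image of X^(m+1) is the next Laguerre polynomial plus a multiple of the m-th one; that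
multiple cancels by antisymmetry, leaving the Christoffel-Darboux numerator. -/
theorem gaussComm_eq (α m : ℕ) (B : ℂ[X] →ₗ[ℂ] ℂ[X] →ₗ[ℂ] ℂ) :
    gaussComm (m + α) m B = ((m.factorial : ℂ) * (m + α).factorial) * ∑ k ∈ Finset.range (m + 1),
        ((k.factorial : ℂ) * (k + α).factorial)⁻¹ *
          commForm B (laguerre ℂ α k) (laguerre ℂ α k) := by
  rw [christoffelDarboux, gaussComm, commForm_apply, LinearMap.compl₁₂_apply,
    LinearMap.compl₁₂_apply, ← pow_succ']
  have h1 : (oneSubDeriv ℂ ^ (m + α)) (X ^ (m + 1)) =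
      laguerre ℂ α (m + 1) + (m + 1 : ℂ) • laguerre ℂ α m := by
    rw [← lagAux, lagAux_eq_laguerre, smul_eq_C_mul]; simp
  have h2 : (oneSubDeriv ℂ ^ (m + α)) (X ^ m) = laguerre ℂ α m := rfl
  rw [h1, h2]
  simp only [map_add, map_smul, LinearMap.add_apply, LinearMap.smul_apply]
  ring

end ChristoffelDarboux

/-- The unweighted Christoffel-Darboux kernel of the Laguerre polynomials. -/
noncomputable def lagKer (α m : ℕ) (x y : ℝ) : ℝ :=
  ∑ k ∈ Finset.range (m + 1), (laguerre ℝ α k).eval x * (laguerre ℝ α k).eval y / lagNorm α k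

theorem map_lagAux (n m : ℕ) : (lagAux ℝ n m).map Complex.ofRealHom = lagAux ℂ n m := by
  have h : ∀ p : ℝ[X], ((oneSubDeriv ℝ ^ n) p).map Complex.ofRealHom =
      (oneSubDeriv ℂ ^ n) (p.map Complex.ofRealHom) := by
    induction n with
    | zero => intro p; simp
    | succ n ih =>
      intro p
      rw [pow_succ, Module.End.mul_apply, ih, oneSubDeriv_apply, pow_succ, Module.End.mul_apply,
        oneSubDeriv_apply, Polynomial.map_sub, derivative_map]
  rw [lagAux, h]; simp [lagAux]

theorem eval_laguerre_ofReal (α k : ℕ) (x : ℝ) :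
    (laguerre ℂ α k).eval (x : ℂ) = ((laguerre ℝ α k).eval x : ℝ) := by
  rw [laguerre, ← map_lagAux]
  exact eval_map_apply Complex.ofRealHom x

theorem eval_gramCharpoly {n m : ℕ} (x : Fin n → Fin m → ℂ) (z : ℂ) :
    (gramCharpoly x).eval z = (((Matrix.of x).conjTranspose * Matrix.of x -
      z • (1 : Matrix (Fin m) (Fin m) ℂ)).det) := by
  rw [gramCharpoly_eq, ← coe_evalRingHom, RingHom.map_det]
  congr 1
  ext i j
  by_cases h : i = j <;>
  simp [h, Matrix.smul_apply, -Matrix.map_mul]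

theorem charPolyProd_eq_eval {n m : ℕ} (z w : ℂ) (x : Fin n → Fin m → ℂ) :
    charPolyProd z w x = (gramCharpoly x).eval z * (gramCharpoly x).eval w := by
  rw [eval_gramCharpoly, eval_gramCharpoly]; rfl

theorem integrable_charPolyProd {Q : Measure ℝ} [IsProbabilityMeasure (entryLaw Q)] {κ : ℂ}
    (h : IsNormalizedLaw (entryLaw Q) κ) (n m : ℕ) (z w : ℂ) :
    Integrable (charPolyProd z w) (matrixLaw Q n m) := by
  obtain ⟨B, hB⟩ := exists_commForm_eq_eval z w
  have := h.integrable_gramCharpoly (n := n) (m := m) (commForm B)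
  simp only [hB, ← charPolyProd_eq_eval] at this
  exact this

/-- The recursion lowers n and m together, so all kernels share α. The factorials reduce to 1/j!
since C(n,j) C(m,j) j! (n-j)! (m-j)! = n! m!/j!. -/
theorem corr_eq_sum {Q : Measure ℝ} [IsProbabilityMeasure (entryLaw Q)] {κ : ℝ}
    (h : IsNormalizedLaw (entryLaw Q) κ) (α m : ℕ) (x y : ℝ) :
    corr Q (m + α) m x y / (((m + α).factorial : ℂ) * (m.factorial : ℂ)) =
      ((∑ j ∈ Finset.range (m + 1), κ ^ j / j.factorial * lagKer α (m - j) x y : ℝ) : ℂ) := by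
  obtain ⟨B, hB⟩ := exists_commForm_eq_eval (x : ℂ) (y : ℂ)
  have h1 : corr Q (m + α) m x y = expectComm (entryLaw Q) (m + α) m B := by
    rw [expectComm, corr]
    simp only [hB, ← charPolyProd_eq_eval]
    rfl
  have hg : ∀ k, gaussComm (k + α) k B = (k.factorial : ℂ) * (k + α).factorial *
      (lagKer α k x y : ℝ) := by
    intro k
    rw [gaussComm_eq, lagKer]
    push_cast
    congr 1
    refine Finset.sum_congr rfl fun i _ => ?_
    rw [hB, eval_laguerre_ofReal, eval_laguerre_ofReal, lagNorm]
    push_cast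
    rw [div_eq_mul_inv, mul_comm]
  rw [h1, h.expectComm_eq_sum]
  have hsub : Finset.range (m + 1) ⊆ Finset.range (m + α + 1) :=
    Finset.range_subset_range.mpr (by omega)
  rw [← Finset.sum_subset hsub, Finset.sum_div]
  · push_cast
    refine Finset.sum_congr rfl fun j hj => ?_
    have hj' : j ≤ m := Nat.lt_succ_iff.mp (Finset.mem_range.mp hj)
    rw [Nat.sub_add_comm hj', hg, Nat.cast_choose ℂ hj', Nat.cast_choose ℂ (le_add_right hj'),
      Nat.sub_add_comm hj']
    have f1 : ∀ i : ℕ, (i.factorial : ℂ) ≠ 0 := fun i => Nat.cast_ne_zero.mpr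
      (Nat.factorial_ne_zero _)
    have := f1 j; have := f1 (m - j); have := f1 (m - j + α); have := f1 m; have := f1 (m + α)
    field_simp
  · intro j _ hj
    have : m < j := by simpa using hj
    simp [Nat.choose_eq_zero_of_lt this]

end SampleCov

/-! ### Moments of the complex entries -/

namespace SampleCov

open Polynomial ComplexConjugate

theorem measurable_entry : Measurable (fun p : ℝ × ℝ => (⟨p.1, p.2⟩ : ℂ)) :=
  Complex.measurableEquivRealProd.symm.measurable

instance (Q : Measure ℝ) [IsProbabilityMeasure Q] : IsProbabilityMeasure (entryLaw Q) :=
  Measure.isProbabilityMeasure_map measurable_entry.aemeasurable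

section EntryLaw

variable {Q : Measure ℝ} [IsProbabilityMeasure Q]

theorem integrable_pow_of_fourth (h4 : Integrable (fun x : ℝ => x ^ 4) Q) {k : ℕ} (hk : k ≤ 4) :
    Integrable (fun x : ℝ => x ^ k) Q := by
  refine ((integrable_const (1 : ℝ)).add h4).mono' (by fun_prop)
    (Eventually.of_forall fun x => ?_)
  have h4' : x ^ 4 = |x| ^ 4 := by rw [← abs_pow, abs_of_nonneg (by positivity)]
  simp only [Real.norm_eq_abs, abs_pow, Pi.add_apply, h4']
  rcases le_total |x| 1 with hz | hz
  · have := pow_le_one₀ (n := k) (abs_nonneg x) hz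
    have := pow_nonneg (abs_nonneg x) 4
    linarith
  · have := pow_le_pow_right₀ hz hk
    linarith

/-- Integration of a mixed monomial in two independent variables with law `Q`. -/
theorem integral_prod_monomial (k l : ℕ) :
    ∫ p : ℝ × ℝ, ((p.1 : ℂ) ^ k * (p.2 : ℂ) ^ l) ∂(Q.prod Q) =
      ((∫ x, x ^ k ∂Q : ℝ) : ℂ) * ((∫ x, x ^ l ∂Q : ℝ) : ℂ) := by
  rw [integral_prod_mul (fun x : ℝ => (x : ℂ) ^ k) (fun x : ℝ => (x : ℂ) ^ l)]
  simp only [← Complex.ofReal_pow, integral_complex_ofReal]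

theorem integrable_prod_monomial (h4 : Integrable (fun x : ℝ => x ^ 4) Q) {k l : ℕ} (hk : k ≤ 4)
    (hl : l ≤ 4) :
    Integrable (fun p : ℝ × ℝ => ((p.1 : ℂ) ^ k * (p.2 : ℂ) ^ l)) (Q.prod Q) := by
  have h := fun k hk => (integrable_pow_of_fourth h4 (k := k) hk).ofReal (𝕜 := ℂ)
  have := (h k hk).mul_prod (h l hl)
  simpa using this

theorem integral_add_add {X : Type*} [MeasurableSpace X] {ρ : Measure X} {f g h : X → ℂ}
    (hf : Integrable f ρ) (hg : Integrable g ρ) (hh : Integrable h ρ) :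
    ∫ x, (f x + g x + h x) ∂ρ = ∫ x, f x ∂ρ + ∫ x, g x ∂ρ + ∫ x, h x ∂ρ := by
  have hfg : Integrable (fun x => f x + g x) ρ := hf.add hg
  rw [integral_add hfg hh, integral_add hf hg]

/-- The value of κ comes from E|z|^4 = 2b + 2(1/2)^2 = 2 + 2(b - 3/4). -/
theorem isNormalizedLaw_entryLaw {b : ℝ} (hmean : ∫ x, x ∂Q = 0)
    (hvar : Var[fun x => x; Q] = 1 / 2) (hfourth : Integrable (fun x : ℝ => x ^ 4) Q)
    (hb : ∫ x, x ^ 4 ∂Q = b) :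
    IsNormalizedLaw (entryLaw Q) ((2 * (b - 3 / 4) : ℝ) : ℂ) := by
  have h2 : ∫ x, x ^ 2 ∂Q = 1 / 2 := by
    rw [← hvar, variance_of_integral_eq_zero (by fun_prop) hmean]
  have h0 : ∫ x : ℝ, x ^ 0 ∂Q = 1 := by simp
  have h1 : ∫ x : ℝ, x ^ 1 ∂Q = 0 := by simpa using hmean
  have e : ∀ p : ℝ × ℝ, (⟨p.1, p.2⟩ : ℂ) = p.1 + p.2 * Complex.I := fun p =>
    Complex.mk_eq_add_mul_I _ _
  have ec : ∀ p : ℝ × ℝ, conj (⟨p.1, p.2⟩ : ℂ) = p.1 - p.2 * Complex.I := fun p => by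
    rw [e]; simp [sub_eq_add_neg]
  have im := fun (k l : ℕ) (hk : k ≤ 4) (hl : l ≤ 4) =>
    integrable_prod_monomial hfourth (k := k) (l := l) hk hl
  have emap : ∀ f : ℂ → ℂ, Continuous f →
      ∫ z, f z ∂(entryLaw Q) = ∫ p : ℝ × ℝ, f ⟨p.1, p.2⟩ ∂(Q.prod Q) := fun f hf =>
    integral_map measurable_entry.aemeasurable hf.aestronglyMeasurable
  refine ⟨?_, ?_, ?_, ?_, ?_⟩
  · rw [entryLaw, integrable_map_measure (Continuous.aestronglyMeasurable (by fun_prop))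
      measurable_entry.aemeasurable]
    have hi : Integrable (fun p : ℝ × ℝ => p.1 ^ 4 * p.2 ^ 0 + 2 * (p.1 ^ 2 * p.2 ^ 2)
        + p.1 ^ 0 * p.2 ^ 4) (Q.prod Q) := by
      have := fun (k l : ℕ) (hk : k ≤ 4) (hl : l ≤ 4) =>
        (integrable_pow_of_fourth hfourth hk).mul_prod (integrable_pow_of_fourth hfourth hl)
      exact ((this 4 0 (by omega) (by omega)).add ((this 2 2 (by omega) (by omega)).const_mul 2)).add
        (this 0 4 (by omega) (by omega))
    refine hi.congr (Eventually.of_forall fun p => ?_)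
    have : ‖(⟨p.1, p.2⟩ : ℂ)‖ ^ 4 = (Complex.normSq ⟨p.1, p.2⟩) ^ 2 := by
      rw [Complex.normSq_eq_norm_sq]; ring
    simp only [Function.comp_apply, this, Complex.normSq_mk]
    ring
  · rw [emap _ (by fun_prop)]
    have : ∀ p : ℝ × ℝ, (⟨p.1, p.2⟩ : ℂ) =
        (p.1 : ℂ) ^ 1 * (p.2 : ℂ) ^ 0 + Complex.I * ((p.1 : ℂ) ^ 0 * (p.2 : ℂ) ^ 1) := fun p => by
      rw [e]; ring
    simp only [this]
    rw [integral_add (im 1 0 (by omega) (by omega)) ((im 0 1 (by omega) (by omega)).const_mul _),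
      integral_const_mul, integral_prod_monomial, integral_prod_monomial, h1]
    simp
  · rw [emap _ (by fun_prop)]
    have : ∀ p : ℝ × ℝ, (⟨p.1, p.2⟩ : ℂ) ^ 2 =
        (p.1 : ℂ) ^ 2 * (p.2 : ℂ) ^ 0 + (-1) * ((p.1 : ℂ) ^ 0 * (p.2 : ℂ) ^ 2)
          + (2 * Complex.I) * ((p.1 : ℂ) ^ 1 * (p.2 : ℂ) ^ 1) := fun p => by
      rw [e]; linear_combination (p.2 : ℂ) ^ 2 * Complex.I_sq
    simp only [this]
    rw [integral_add_add (im 2 0 (by omega) (by omega)) ((im 0 2 (by omega) (by omega)).const_mul _)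
        ((im 1 1 (by omega) (by omega)).const_mul _),
      integral_const_mul, integral_const_mul, integral_prod_monomial, integral_prod_monomial,
      integral_prod_monomial, h1, h2, h0]
    simp
  · rw [emap _ (by fun_prop)]
    have : ∀ p : ℝ × ℝ, conj (⟨p.1, p.2⟩ : ℂ) * (⟨p.1, p.2⟩ : ℂ) =
        (p.1 : ℂ) ^ 2 * (p.2 : ℂ) ^ 0 + (p.1 : ℂ) ^ 0 * (p.2 : ℂ) ^ 2 := fun p => by
      rw [ec, e]; linear_combination -(p.2 : ℂ) ^ 2 * Complex.I_sq
    simp only [this]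
    rw [integral_add (im 2 0 (by omega) (by omega)) (im 0 2 (by omega) (by omega)),
      integral_prod_monomial, integral_prod_monomial, h2, h0]
    norm_num
  · rw [emap _ (by fun_prop)]
    have : ∀ p : ℝ × ℝ, conj (⟨p.1, p.2⟩ : ℂ) ^ 2 * (⟨p.1, p.2⟩ : ℂ) ^ 2 =
        (p.1 : ℂ) ^ 4 * (p.2 : ℂ) ^ 0 + (p.1 : ℂ) ^ 0 * (p.2 : ℂ) ^ 4
          + 2 * ((p.1 : ℂ) ^ 2 * (p.2 : ℂ) ^ 2) := fun p => by
      have : conj (⟨p.1, p.2⟩ : ℂ) * (⟨p.1, p.2⟩ : ℂ) = (p.1 : ℂ) ^ 2 + (p.2 : ℂ) ^ 2 := by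
        rw [ec, e]; linear_combination -(p.2 : ℂ) ^ 2 * Complex.I_sq
      rw [← mul_pow, this]; ring
    simp only [this]
    rw [integral_add_add (im 4 0 (by omega) (by omega)) (im 0 4 (by omega) (by omega))
        ((im 2 2 (by omega) (by omega)).const_mul _),
      integral_const_mul, integral_prod_monomial, integral_prod_monomial,
      integral_prod_monomial, h2, h0, hb]
    push_cast; ring

end EntryLaw

end SampleCov

/-! ### Orthonormal Laguerre functions and their differential system -/

namespace SampleCov

open Polynomial

section LaguerreFunctions

/-- Square root of the Laguerre weight `x^α e^{-x}`. -/
noncomputable def sqrtWeight (α : ℕ) (x : ℝ) : ℝ := Real.sqrt x ^ α * Real.exp (-x / 2)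

/-- The off-diagonal entry `√((m + 1) (m + 1 + α))` of the Jacobi matrix of the Laguerre
polynomials. -/
noncomputable def lagCoeff (α m : ℕ) : ℝ := Real.sqrt ((m + 1) * (m + 1 + α))

/-- The orthonormal Laguerre functions, with positive leading coefficients. -/
noncomputable def lagFun (α k : ℕ) (x : ℝ) : ℝ :=
  sqrtWeight α x * (laguerre ℝ α k).eval x / Real.sqrt (lagNorm α k)

/-- The weighted Christoffel-Darboux kernel. -/
noncomputable def lagFunKer (α m : ℕ) (x y : ℝ) : ℝ :=
  ∑ k ∈ Finset.range (m + 1), lagFun α k x * lagFun α k y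

theorem lagCoeff_pos (α m : ℕ) : 0 < lagCoeff α m := by
  unfold lagCoeff; positivity

theorem lagCoeff_sq (α m : ℕ) : lagCoeff α m ^ 2 = (m + 1) * (m + 1 + α) := by
  rw [lagCoeff, Real.sq_sqrt (by positivity)]

theorem sqrt_lagNorm_pos (α k : ℕ) : 0 < Real.sqrt (lagNorm α k) :=
  Real.sqrt_pos.mpr (lagNorm_pos α k)

theorem sqrt_lagNorm_succ (α k : ℕ) :
    Real.sqrt (lagNorm α (k + 1)) = lagCoeff α k * Real.sqrt (lagNorm α k) := by
  rw [lagNorm_succ, Real.sqrt_mul (by positivity), lagCoeff]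

theorem sqrtWeight_mul_self (α : ℕ) {x : ℝ} (hx : 0 ≤ x) :
    sqrtWeight α x * sqrtWeight α x = x ^ α * Real.exp (-x) := by
  rw [sqrtWeight, mul_mul_mul_comm, ← mul_pow, Real.mul_self_sqrt hx, ← Real.exp_add]
  congr 2; ring

theorem hasDerivAt_sqrtWeight (α : ℕ) {x : ℝ} (hx : 0 < x) :
    HasDerivAt (sqrtWeight α) (sqrtWeight α x * ((α - x) / 2) / x) x := by
  have hs : Real.sqrt x ≠ 0 := (Real.sqrt_pos.mpr hx).ne'
  have h := ((Real.hasDerivAt_sqrt hx.ne').pow α).mul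
    (((hasDerivAt_id x).neg.div_const 2).exp)
  refine h.congr_deriv ?_
  have hx2 : x = Real.sqrt x * Real.sqrt x := (Real.mul_self_sqrt hx.le).symm
  have h3 : (α : ℝ) * Real.sqrt x ^ (α - 1) * (1 / (2 * Real.sqrt x)) =
      Real.sqrt x ^ α * (α / 2) / x := by
    cases α with
    | zero => simp
    | succ n =>
      rw [Nat.add_sub_cancel, pow_succ]
      nth_rw 5 [hx2]
      field_simp
  rw [h3, sqrtWeight]
  simp only [id, Pi.neg_apply, Pi.pow_apply]
  field_simp
  ring

theorem continuous_lagFun (α k : ℕ) : Continuous (lagFun α k) := by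
  unfold lagFun sqrtWeight
  fun_prop

theorem continuous_lagFunKer_diag (α m : ℕ) : Continuous fun x => lagFunKer α m x x := by
  unfold lagFunKer
  have := continuous_lagFun α
  fun_prop

theorem lagFunKer_eq (α m : ℕ) (x y : ℝ) :
    lagFunKer α m x y = sqrtWeight α x * sqrtWeight α y * lagKer α m x y := by
  rw [lagFunKer, lagKer, Finset.mul_sum]
  refine Finset.sum_congr rfl fun k _ => ?_
  have h1 := Real.mul_self_sqrt (lagNorm_pos α k).le
  have h2 := (sqrt_lagNorm_pos α k).ne'
  rw [lagFun, lagFun]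
  nth_rw 3 [← h1]
  field_simp

theorem hasDerivAt_lagFun_aux (α k : ℕ) {x : ℝ} (hx : 0 < x) :
    HasDerivAt (lagFun α k) (((α - x) / 2 * lagFun α k x + sqrtWeight α x *
      (x * (derivative (laguerre ℝ α k)).eval x) / Real.sqrt (lagNorm α k)) / x) x := by
  have h := ((hasDerivAt_sqrtWeight α hx).mul ((laguerre ℝ α k).hasDerivAt x)).div_const
    (Real.sqrt (lagNorm α k))
  refine h.congr_deriv ?_
  rw [lagFun]
  field_simp

/-- With u, v the functions of index m + 1 and m, a = `lagCoeff α m` and c = m + 1 + (α - x)/2, this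
and `hasDerivAt_lagFun` form the system x u' = c u + a v, x v' = -a u - c v. -/
theorem hasDerivAt_lagFun_succ (α m : ℕ) {x : ℝ} (hx : 0 < x) :
    HasDerivAt (lagFun α (m + 1)) (((m + 1 + (α - x) / 2) * lagFun α (m + 1) x
      + lagCoeff α m * lagFun α m x) / x) x := by
  refine (hasDerivAt_lagFun_aux α (m + 1) hx).congr_deriv ?_
  have h := congrArg (eval x) (X_mul_derivative_laguerre ℝ α m)
  simp only [eval_mul, eval_X, eval_add, eval_natCast, eval_one] at h
  rw [h, lagFun, lagFun, sqrt_lagNorm_succ]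
  have h1 := (lagCoeff_pos α m).ne'
  have h2 := (sqrt_lagNorm_pos α m).ne'
  have h3 := lagCoeff_sq α m
  congr 1
  field_simp
  rw [h3]; ring

theorem hasDerivAt_lagFun (α m : ℕ) {x : ℝ} (hx : 0 < x) :
    HasDerivAt (lagFun α m) ((-(lagCoeff α m * lagFun α (m + 1) x)
      - (m + 1 + (α - x) / 2) * lagFun α m x) / x) x := by
  refine (hasDerivAt_lagFun_aux α m hx).congr_deriv ?_
  have h := congrArg (eval x) (X_mul_derivative_laguerre' ℝ α m)
  simp only [eval_mul, eval_X, eval_add, eval_natCast, eval_one, eval_sub] at h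
  rw [h, lagFun, lagFun, sqrt_lagNorm_succ]
  have h1 := (lagCoeff_pos α m).ne'
  have h2 := (sqrt_lagNorm_pos α m).ne'
  congr 1
  field_simp
  ring

theorem lagFunKer_christoffelDarboux (α m : ℕ) (x y : ℝ) :
    (x - y) * lagFunKer α m x y = lagCoeff α m *
      (lagFun α (m + 1) x * lagFun α m y - lagFun α m x * lagFun α (m + 1) y) := by
  have h := christoffelDarboux α m ((LinearMap.mul ℝ ℝ).compl₁₂ (leval x) (leval y))
  simp only [commForm_apply, LinearMap.compl₁₂_apply, LinearMap.mul_apply', leval_apply,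
    eval_mul, eval_X] at h
  have hk : ∑ k ∈ Finset.range (m + 1), ((k.factorial : ℝ) * (k + α).factorial)⁻¹ *
      (x * eval x (laguerre ℝ α k) * eval y (laguerre ℝ α k) -
        eval x (laguerre ℝ α k) * (y * eval y (laguerre ℝ α k))) =
      (x - y) * lagKer α m x y := by
    rw [lagKer, Finset.mul_sum]
    refine Finset.sum_congr rfl fun k _ => ?_
    rw [lagNorm, div_eq_inv_mul]; ring
  rw [hk, ← lagNorm] at h
  have h1 := (lagCoeff_pos α m).ne'
  have h2 := (sqrt_lagNorm_pos α m).ne'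
  have h4 := Real.sq_sqrt (lagNorm_pos α m).le
  rw [lagFunKer_eq, lagFun, lagFun, lagFun, lagFun, sqrt_lagNorm_succ]
  field_simp
  rw [h4]
  linear_combination (sqrtWeight α x * sqrtWeight α y) * h

/-- Confluent Christoffel-Darboux for B(p, q) = x p'(x) q(x), whose antisymmetrization is x p(x)
q(x). The structure relations turn the derivatives into a quadratic form in u and v. -/
theorem lagFunKer_diag (α m : ℕ) (x : ℝ) :
    x * lagFunKer α m x x = lagCoeff α m * (lagCoeff α m * lagFun α (m + 1) x ^ 2
      + 2 * (m + 1 + (α - x) / 2) * (lagFun α (m + 1) x * lagFun α m x)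
      + lagCoeff α m * lagFun α m x ^ 2) := by
  have h := christoffelDarboux α m ((LinearMap.mul ℝ ℝ).compl₁₂
    ((leval x).comp ((LinearMap.mulLeft ℝ (Polynomial.X : ℝ[X])).comp derivative)) (leval x))
  simp only [commForm_apply, LinearMap.compl₁₂_apply, LinearMap.mul_apply', leval_apply,
    LinearMap.comp_apply, LinearMap.mulLeft_apply, X_mul_derivative_laguerre,
    X_mul_derivative_laguerre' ℝ α m, derivative_mul, derivative_X, eval_sub, eval_natCast,
    eval_mul, eval_X, eval_add, eval_one] at h
  have hk : ∑ k ∈ Finset.range (m + 1), ((k.factorial : ℝ) * (k + α).factorial)⁻¹ *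
      (x * (1 * eval x (laguerre ℝ α k) + x * eval x (derivative (laguerre ℝ α k)))
          * eval x (laguerre ℝ α k) -
        x * eval x (derivative (laguerre ℝ α k)) * (x * eval x (laguerre ℝ α k))) =
      x * lagKer α m x x := by
    rw [lagKer, Finset.mul_sum]
    refine Finset.sum_congr rfl fun k _ => ?_
    rw [lagNorm, div_eq_inv_mul]; ring
  rw [hk, ← lagNorm] at h
  have h1 := (lagCoeff_pos α m).ne'
  have h2 := (sqrt_lagNorm_pos α m).ne'
  have h3 := lagCoeff_sq α m
  have h4 := Real.sq_sqrt (lagNorm_pos α m).le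
  rw [lagFunKer_eq, lagFun, lagFun, sqrt_lagNorm_succ]
  field_simp
  rw [h4, h3]
  linear_combination (sqrtWeight α x ^ 2) * h

/-- The form a u² + 2c u v + a v² is conserved by the system with c frozen, so only c' = -1/2
contributes. -/
theorem hasDerivAt_lagFunKer_diag (α m : ℕ) {x : ℝ} (hx : 0 < x) :
    HasDerivAt (fun x => x * lagFunKer α m x x)
      (-(lagCoeff α m * (lagFun α (m + 1) x * lagFun α m x))) x := by
  simp only [lagFunKer_diag]
  have hu := hasDerivAt_lagFun_succ α m hx
  have hv := hasDerivAt_lagFun α m hx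
  have hc : HasDerivAt (fun x : ℝ => 2 * ((m : ℝ) + 1 + (α - x) / 2)) (-1) x := by
    have := ((((hasDerivAt_id x).const_sub (α : ℝ)).div_const 2).const_add ((m : ℝ) + 1)).const_mul 2
    refine this.congr_deriv (by ring)
  refine ((((hu.pow 2).const_mul (lagCoeff α m)).add (hc.mul (hu.mul hv))).add
    ((hv.pow 2).const_mul (lagCoeff α m))).const_mul (lagCoeff α m) |>.congr_deriv ?_
  simp only [Pi.mul_apply]
  field_simp
  ring

theorem lagFunKer_diag_nonneg (α m : ℕ) (x : ℝ) : 0 ≤ lagFunKer α m x x :=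
  Finset.sum_nonneg fun _ _ => mul_self_nonneg _

/-- Gives a bound uniform in the lower index k, needed for dominated convergence in the sum over j.
-/
theorem abs_lagFunKer_le (α : ℕ) {k m : ℕ} (hk : k ≤ m) (x y : ℝ) :
    |lagFunKer α k x y| ≤ (lagFunKer α m x x + lagFunKer α m y y) / 2 := by
  have h1 : ∀ z, lagFunKer α k z z ≤ lagFunKer α m z z := fun z =>
    Finset.sum_le_sum_of_subset_of_nonneg (Finset.range_subset_range.mpr (by omega))
      fun _ _ _ => mul_self_nonneg _
  have h2 : |lagFunKer α k x y| ≤ (lagFunKer α k x x + lagFunKer α k y y) / 2 := by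
    rw [lagFunKer, lagFunKer, lagFunKer, ← Finset.sum_add_distrib, Finset.sum_div]
    refine (Finset.abs_sum_le_sum_abs _ _).trans (Finset.sum_le_sum fun i _ => ?_)
    rw [abs_le]
    constructor <;> nlinarith [sq_nonneg (lagFun α i x - lagFun α i y),
      sq_nonneg (lagFun α i x + lagFun α i y)]
  linarith [h1 x, h1 y]

end LaguerreFunctions

end SampleCov

/-! ### Orthogonality with respect to the weight x^α e^{-x} -/

namespace SampleCov

open Polynomial

section Orthogonality

theorem integrableOn_eval_mul_exp_neg (q : ℝ[X]) :
    IntegrableOn (fun x => q.eval x * Real.exp (-x)) (Set.Ioi 0) := by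
  induction q using Polynomial.induction_on' with
  | add p q hp hq =>
    simp only [eval_add, add_mul]
    exact hp.add hq
  | monomial n a =>
    have h := (Real.GammaIntegral_convergent (s := n + 1) (by positivity)).const_mul a
    refine h.congr ((ae_restrict_mem measurableSet_Ioi).mono fun x hx => ?_)
    simp only [add_sub_cancel_right, Real.rpow_natCast, eval_monomial]
    ring

theorem tendsto_eval_mul_exp_neg (q : ℝ[X]) :
    Tendsto (fun x => q.eval x * Real.exp (-x)) atTop (𝓝 0) := by
  refine (Polynomial.tendsto_div_exp_atTop q).congr fun x => ?_
  rw [Real.exp_neg, div_eq_mul_inv]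

theorem integral_derivative_sub_mul_exp_neg (q : ℝ[X]) :
    ∫ x in Set.Ioi (0 : ℝ), (derivative q - q).eval x * Real.exp (-x) = -q.eval 0 := by
  have hd : ∀ x : ℝ, HasDerivAt (fun x => q.eval x * Real.exp (-x))
      ((derivative q - q).eval x * Real.exp (-x)) x := fun x => by
    refine ((q.hasDerivAt x).mul ((hasDerivAt_id x).neg.exp)).congr_deriv ?_
    simp only [id, eval_sub, Pi.neg_apply]
    ring
  have h := integral_Ioi_of_hasDerivAt_of_tendsto (a := (0 : ℝ)) (m := 0)
    (hd 0).continuousAt.continuousWithinAt (fun x _ => hd x)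
    (integrableOn_eval_mul_exp_neg _) (tendsto_eval_mul_exp_neg q)
  rw [h]; simp

/-- Integration against the Laguerre weight. -/
noncomputable def lagInt (α : ℕ) : ℝ[X] →ₗ[ℝ] ℝ where
  toFun q := ∫ x in Set.Ioi (0 : ℝ), (Polynomial.X ^ α * q).eval x * Real.exp (-x)
  map_add' p q := by
    simp only [mul_add, eval_add, add_mul]
    exact integral_add (integrableOn_eval_mul_exp_neg (Polynomial.X ^ α * p))
      (integrableOn_eval_mul_exp_neg (Polynomial.X ^ α * q))
  map_smul' c p := by
    simp only [mul_smul_comm, eval_smul, smul_eq_mul, mul_assoc, integral_const_mul,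
      RingHom.id_apply]

theorem lagInt_apply (α : ℕ) (q : ℝ[X]) : lagInt α q =
    ∫ x in Set.Ioi (0 : ℝ), (Polynomial.X ^ α * q).eval x * Real.exp (-x) := rfl

/-- The integrand is the derivative of x^(α+1) q(x) e^{-x}, which vanishes at 0 and at infinity. -/
theorem lagInt_pearson (α : ℕ) (q : ℝ[X]) :
    lagInt α (Polynomial.X * derivative q + (C ((α : ℝ) + 1) - Polynomial.X) * q) = 0 := by
  have h := integral_derivative_sub_mul_exp_neg (Polynomial.X ^ (α + 1) * q)
  rw [lagInt_apply]
  have e : (Polynomial.X ^ α * (Polynomial.X * derivative q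
      + (C ((α : ℝ) + 1) - Polynomial.X) * q) : ℝ[X])
      = derivative (Polynomial.X ^ (α + 1) * q) - Polynomial.X ^ (α + 1) * q := by
    rw [derivative_mul, derivative_X_pow, Nat.add_sub_cancel]
    push_cast
    simp only [map_add, map_natCast, map_one]
    ring
  rw [e, h]
  simp

theorem lagInt_one (α : ℕ) : lagInt α 1 = lagNorm α 0 := by
  rw [lagInt_apply, lagNorm]
  have := Real.Gamma_eq_integral (s := α + 1) (by positivity)
  rw [Real.Gamma_nat_eq_factorial] at this
  rw [Nat.factorial_zero, Nat.cast_one, one_mul, zero_add, this]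
  refine setIntegral_congr_fun measurableSet_Ioi fun x _ => ?_
  simp only [add_sub_cancel_right, Real.rpow_natCast, mul_one, eval_pow, eval_X]
  ring

/-- The derivative formula turns Pearson's identity into a recursion with factor -k, which is zero
at the first step. -/
theorem lagInt_laguerre_succ (α k : ℕ) : lagInt α (laguerre ℝ α (k + 1)) = 0 := by
  have hrec : ∀ k, lagInt α (laguerre ℝ α (k + 1)) = -k * lagInt α (laguerre ℝ α k) := by
    intro k
    have h := lagInt_pearson α (laguerre ℝ α k)
    have e : (Polynomial.X * derivative (laguerre ℝ α k)
        + (C ((α : ℝ) + 1) - Polynomial.X) * laguerre ℝ α k) =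
        -(laguerre ℝ α (k + 1)) - (k : ℝ) • laguerre ℝ α k := by
      rw [X_mul_derivative_laguerre', smul_eq_C_mul]
      simp only [map_add, map_natCast, map_one]
      ring
    rw [e, map_sub, map_neg, map_smul, smul_eq_mul] at h
    linarith
  induction k with
  | zero => rw [hrec]; simp
  | succ k ih => rw [hrec, ih, mul_zero]

/-- Multiplication by X is symmetric; expanding it by the three-term recurrence in either factor
determines the pairings by induction from index 0. -/
theorem lagInt_laguerre_mul (α i j : ℕ) :
    lagInt α (laguerre ℝ α i * laguerre ℝ α j) = if i = j then lagNorm α i else 0 := by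
  have rec1 : ∀ i : ℕ, Polynomial.X * laguerre ℝ α (i + 1) = laguerre ℝ α (i + 2)
      + (2 * i + α + 3 : ℝ) • laguerre ℝ α (i + 1)
      + ((i + 1) * (i + 1 + α) : ℝ) • laguerre ℝ α i := fun i => by
    rw [X_mul_laguerre, smul_eq_C_mul, smul_eq_C_mul]
    simp [show (C (2 : ℝ)) = 2 from map_ofNat C 2, show (C (3 : ℝ)) = 3 from map_ofNat C 3]
  have rec0 : Polynomial.X * laguerre ℝ α 0 = laguerre ℝ α 1 + (α + 1 : ℝ) • laguerre ℝ α 0 := by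
    rw [X_mul_laguerre_zero, smul_eq_C_mul]; simp
  have h0 : ∀ j, lagInt α (laguerre ℝ α 0 * laguerre ℝ α j) = if 0 = j then lagNorm α 0 else 0 := by
    intro j
    cases j with
    | zero => rw [laguerre_zero, mul_one, lagInt_one, if_pos rfl]
    | succ j =>
      rw [laguerre_zero, one_mul, lagInt_laguerre_succ, if_neg (Nat.succ_ne_zero j).symm]
  have hsymm : ∀ p q : ℝ[X], lagInt α (Polynomial.X * p * q) = lagInt α (p * (Polynomial.X * q)) :=
    fun p q => by congr 1; ring
  have h1 : ∀ j, lagInt α (laguerre ℝ α 1 * laguerre ℝ α j) = if 1 = j then lagNorm α 1 else 0 := by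
    intro j
    have h := hsymm (laguerre ℝ α 0) (laguerre ℝ α j)
    cases j with
    | zero =>
      rw [mul_comm (laguerre ℝ α 1), h0]; simp
    | succ j =>
      rw [rec0, rec1] at h
      simp only [add_mul, mul_add, mul_smul_comm, smul_mul_assoc, map_add, map_smul, h0,
        smul_eq_mul] at h
      rcases j with _ | j
      · have hn := lagNorm_succ α 0
        simp at h hn ⊢
        linarith
      · simp at h ⊢
        linarith
  induction i using Nat.strong_induction_on generalizing j with
  | _ i ih =>
    match i, ih with
    | 0, _ => exact h0 j
    | 1, _ => exact h1 j
    | i + 2, ih =>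
      have ih1 := ih (i + 1) (by omega)
      have ih0 := ih i (by omega)
      have h := hsymm (laguerre ℝ α (i + 1)) (laguerre ℝ α j)
      rw [rec1] at h
      match j with
      | 0 =>
        rw [mul_comm, h0]; simp
      | j + 1 =>
        rw [rec1] at h
        simp only [add_mul, mul_add, mul_smul_comm, smul_mul_assoc, map_add, map_smul, ih1, ih0,
          smul_eq_mul] at h
        have hn := lagNorm_succ α (i + 1)
        have hn' := lagNorm_succ α i
        push_cast at hn hn'
        by_cases c1 : i + 2 = j + 1
        · have : j = i + 1 := by omega
          subst this
          simp [show ¬ i = i + 1 + 1 by omega] at h ⊢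
          rw [hn]
          linear_combination h
        · rw [if_neg c1]
          have c1' : ¬ i + 1 = j := by omega
          by_cases c2 : i = j
          · subst c2
            simp at h
            linarith
          · by_cases c3 : i = j + 1
            · subst c3
              simp [show ¬ j + 1 + 1 = j by omega] at h
              rw [hn'] at h
              push_cast at h
              linear_combination h
            · simp [c1', c2, c3] at h
              linarith

end Orthogonality

end SampleCov

/-! ### Limits of the matrix entries of multiplication by x^p -/

namespace SampleCov

open Polynomial

section Moments

theorem eval_mul_lagFun_mul (α i j : ℕ) (q : ℝ[X]) {x : ℝ} (hx : 0 ≤ x) :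
    q.eval x * (lagFun α i x * lagFun α j x) =
      (Polynomial.X ^ α * (q * (laguerre ℝ α i * laguerre ℝ α j))).eval x * Real.exp (-x) *
        (Real.sqrt (lagNorm α i) * Real.sqrt (lagNorm α j))⁻¹ := by
  have h := sqrtWeight_mul_self α hx
  simp only [lagFun, eval_mul, eval_pow, eval_X]
  rw [show x ^ α * (q.eval x * (eval x (laguerre ℝ α i) * eval x (laguerre ℝ α j)))
    * Real.exp (-x) = (x ^ α * Real.exp (-x)) *
    (q.eval x * (eval x (laguerre ℝ α i) * eval x (laguerre ℝ α j))) by ring, ← h]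
  have h1 := (sqrt_lagNorm_pos α i).ne'
  have h2 := (sqrt_lagNorm_pos α j).ne'
  field_simp

theorem integrableOn_eval_mul_lagFun_mul (α i j : ℕ) (q : ℝ[X]) :
    IntegrableOn (fun x => q.eval x * (lagFun α i x * lagFun α j x)) (Set.Ioi 0) := by
  refine ((integrableOn_eval_mul_exp_neg (Polynomial.X ^ α *
    (q * (laguerre ℝ α i * laguerre ℝ α j)))).mul_const
    (Real.sqrt (lagNorm α i) * Real.sqrt (lagNorm α j))⁻¹).congr
    ((ae_restrict_mem measurableSet_Ioi).mono fun x hx => ?_)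
  exact (eval_mul_lagFun_mul α i j q (le_of_lt hx)).symm

theorem integrableOn_pow_mul_lagFun_mul (α i j p : ℕ) :
    IntegrableOn (fun x => x ^ p * (lagFun α i x * lagFun α j x)) (Set.Ioi 0) := by
  simpa using integrableOn_eval_mul_lagFun_mul α i j (Polynomial.X ^ p)

theorem tendsto_pow_mul_lagFun_mul (α i j p : ℕ) :
    Tendsto (fun x => x ^ p * (lagFun α i x * lagFun α j x)) atTop (𝓝 0) := by
  have h := (tendsto_eval_mul_exp_neg (Polynomial.X ^ α *
    (Polynomial.X ^ p * (laguerre ℝ α i * laguerre ℝ α j)))).mul_const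
    (Real.sqrt (lagNorm α i) * Real.sqrt (lagNorm α j))⁻¹
  rw [zero_mul] at h
  refine h.congr' ((eventually_ge_atTop 0).mono fun x hx => ?_)
  have := eval_mul_lagFun_mul α i j (Polynomial.X ^ p) hx
  rw [← this]; simp

/-- The matrix entries of multiplication by `x ^ p` in the basis of Laguerre functions. -/
noncomputable def lagMom (α p i j : ℕ) : ℝ :=
  ∫ x in Set.Ioi (0 : ℝ), x ^ p * (lagFun α i x * lagFun α j x)

theorem lagMom_zero (α i j : ℕ) : lagMom α 0 i j = if i = j then 1 else 0 := by
  have h : lagMom α 0 i j = lagInt α (laguerre ℝ α i * laguerre ℝ α j) *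
      (Real.sqrt (lagNorm α i) * Real.sqrt (lagNorm α j))⁻¹ := by
    rw [lagMom, lagInt_apply, ← integral_mul_const]
    refine setIntegral_congr_fun measurableSet_Ioi fun x hx => ?_
    have := eval_mul_lagFun_mul α i j 1 (le_of_lt hx)
    simpa using this
  rw [h, lagInt_laguerre_mul]
  by_cases hij : i = j
  · subst hij
    rw [if_pos rfl, if_pos rfl, Real.mul_self_sqrt (lagNorm_pos α i).le,
      mul_inv_cancel₀ (lagNorm_pos α i).ne']
  · simp [hij]

theorem x_mul_lagFun_succ (α l : ℕ) (x : ℝ) :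
    x * lagFun α (l + 1) x = lagCoeff α (l + 1) * lagFun α (l + 2) x
      + (2 * l + α + 3) * lagFun α (l + 1) x + lagCoeff α l * lagFun α l x := by
  have h := congrArg (eval x) (X_mul_laguerre ℝ α l)
  simp only [eval_mul, eval_X, eval_add, eval_natCast, eval_one, eval_ofNat] at h
  have e1 := sqrt_lagNorm_succ α (l + 1)
  have e0 := sqrt_lagNorm_succ α l
  have h1 := (lagCoeff_pos α l).ne'
  have h1' := (lagCoeff_pos α (l + 1)).ne'
  have h2 := (sqrt_lagNorm_pos α l).ne'
  have h3 := lagCoeff_sq α l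
  rw [lagFun, lagFun, lagFun, show l + 2 = l + 1 + 1 from rfl, e1, e0]
  field_simp
  rw [h3]
  linear_combination (sqrtWeight α x) * h

theorem lagMom_succ (α p i l : ℕ) :
    lagMom α (p + 1) i (l + 1) = lagCoeff α (l + 1) * lagMom α p i (l + 2)
      + (2 * l + α + 3) * lagMom α p i (l + 1) + lagCoeff α l * lagMom α p i l := by
  have hI := fun j => integrableOn_pow_mul_lagFun_mul α i j p
  have e : ∀ x : ℝ, x ^ (p + 1) * (lagFun α i x * lagFun α (l + 1) x) =
      lagCoeff α (l + 1) * (x ^ p * (lagFun α i x * lagFun α (l + 2) x)) +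
      ((2 * l + α + 3) * (x ^ p * (lagFun α i x * lagFun α (l + 1) x)) +
      lagCoeff α l * (x ^ p * (lagFun α i x * lagFun α l x))) := by
    intro x
    linear_combination (x ^ p * lagFun α i x) * x_mul_lagFun_succ α l x
  rw [lagMom]
  simp only [e]
  have h2 := (hI (l + 1)).const_mul (2 * l + α + 3 : ℝ)
  have h3 := (hI l).const_mul (lagCoeff α l)
  have h23 : IntegrableOn (fun x => (2 * l + α + 3 : ℝ) * (x ^ p * (lagFun α i x * lagFun α (l + 1) x)) +
      lagCoeff α l * (x ^ p * (lagFun α i x * lagFun α l x))) (Set.Ioi 0) := h2.add h3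
  rw [integral_add ((hI (l + 2)).const_mul _) h23, integral_add h2 h3, integral_const_mul,
    integral_const_mul, integral_const_mul, lagMom, lagMom, lagMom]
  ring

/-- The Fourier coefficients of `(2 + 2 cos θ) ^ p`. -/
noncomputable def cosMom (p : ℕ) (i : ℤ) : ℝ :=
  Real.pi⁻¹ * ∫ θ in (0 : ℝ)..Real.pi, (2 + 2 * Real.cos θ) ^ p * Real.cos (i * θ)

theorem cosMom_zero (i : ℤ) : cosMom 0 i = if i = 0 then 1 else 0 := by
  rw [cosMom]
  by_cases hi : i = 0
  · simp [hi, Real.pi_ne_zero]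
  · have hi' : (i : ℝ) ≠ 0 := Int.cast_ne_zero.mpr hi
    simp only [pow_zero, one_mul, if_neg hi]
    rw [intervalIntegral.integral_comp_mul_left (fun x => Real.cos x) hi', integral_cos]
    simp [Real.sin_int_mul_pi]

/-- The limiting form of `lagMom_succ`: after division by n the recurrence coefficients tend to 1,
2, 1. -/
theorem cosMom_succ (p : ℕ) (i : ℤ) :
    cosMom (p + 1) i = cosMom p (i + 1) + 2 * cosMom p i + cosMom p (i - 1) := by
  simp only [cosMom]
  have hc : ∀ j : ℤ, IntervalIntegrable
      (fun θ : ℝ => (2 + 2 * Real.cos θ) ^ p * Real.cos (j * θ)) volume 0 Real.pi :=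
    fun j => Continuous.intervalIntegrable (by fun_prop) _ _
  have e : ∀ θ : ℝ, (2 + 2 * Real.cos θ) ^ (p + 1) * Real.cos (i * θ) =
      (2 + 2 * Real.cos θ) ^ p * Real.cos ((i + 1 : ℤ) * θ)
      + 2 * ((2 + 2 * Real.cos θ) ^ p * Real.cos (i * θ))
      + (2 + 2 * Real.cos θ) ^ p * Real.cos ((i - 1 : ℤ) * θ) := by
    intro θ
    push_cast
    rw [add_mul, sub_mul, one_mul, Real.cos_add, Real.cos_sub]
    ring
  simp only [e]
  rw [intervalIntegral.integral_add ((hc _).add ((hc _).const_mul 2)) (hc _),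
    intervalIntegral.integral_add (hc _) ((hc _).const_mul 2), intervalIntegral.integral_const_mul]
  ring

/-- Integrating the derivative of (2 + 2 cos θ)^(p+1) sin θ converts an arcsine moment into a
Marchenko-Pastur moment. -/
theorem cosMom_neg_one (p : ℕ) : cosMom (p + 1) (-1) =
    (p + 1) * (Real.pi⁻¹ * ∫ θ in (0 : ℝ)..Real.pi,
      (2 + 2 * Real.cos θ) ^ (p + 1) * (1 - Real.cos θ)) := by
  have hd : ∀ θ ∈ Set.uIcc 0 Real.pi, HasDerivAt
      (fun θ : ℝ => (2 + 2 * Real.cos θ) ^ (p + 1) * Real.sin θ)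
      ((2 + 2 * Real.cos θ) ^ (p + 1) * Real.cos ((-1 : ℤ) * θ) -
        (p + 1) * ((2 + 2 * Real.cos θ) ^ (p + 1) * (1 - Real.cos θ))) θ := by
    intro θ _
    have h := ((((Real.hasDerivAt_cos θ).const_mul 2).const_add 2).pow (p + 1)).mul
      (Real.hasDerivAt_sin θ)
    refine h.congr_deriv ?_
    have hs := Real.sin_sq_add_cos_sq θ
    simp only [Pi.pow_apply, Nat.add_sub_cancel]
    push_cast
    rw [neg_one_mul, Real.cos_neg]
    linear_combination (-2 * (p + 1) * (2 + 2 * Real.cos θ) ^ p) * hs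
  have hc1 : IntervalIntegrable (fun θ : ℝ => (2 + 2 * Real.cos θ) ^ (p + 1)
      * Real.cos ((-1 : ℤ) * θ)) volume 0 Real.pi :=
    Continuous.intervalIntegrable (by fun_prop) _ _
  have hc2 : IntervalIntegrable (fun θ : ℝ => ((p : ℝ) + 1) * ((2 + 2 * Real.cos θ) ^ (p + 1)
      * (1 - Real.cos θ))) volume 0 Real.pi :=
    Continuous.intervalIntegrable (by fun_prop) _ _
  have h := intervalIntegral.integral_eq_sub_of_hasDerivAt hd (hc1.sub hc2)
  rw [intervalIntegral.integral_sub hc1 hc2, intervalIntegral.integral_const_mul] at h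
  simp only [Real.sin_pi, Real.sin_zero, mul_zero, sub_zero] at h
  rw [cosMom]
  linear_combination Real.pi⁻¹ * h

theorem tendsto_lagCoeff_div (α : ℕ) {l : ℕ → ℕ} (hl : Tendsto (fun n => (l n : ℝ) / n) atTop (𝓝 1)) :
    Tendsto (fun n => lagCoeff α (l n) / n) atTop (𝓝 1) := by
  have hc : ∀ c : ℝ, Tendsto (fun n : ℕ => c / n) atTop (𝓝 0) := fun c =>
    tendsto_const_div_atTop_nhds_zero_nat c
  have h1 : Tendsto (fun n : ℕ => Real.sqrt (((l n : ℝ) / n + 1 / n) *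
      ((l n : ℝ) / n + (1 + α) / n))) atTop (𝓝 1) := by
    have := ((hl.add (hc 1)).mul (hl.add (hc (1 + α)))).sqrt
    simpa using this
  refine h1.congr' ((eventually_gt_atTop 0).mono fun n hn => ?_)
  have hn' : (0 : ℝ) < n := Nat.cast_pos.mpr hn
  beta_reduce
  rw [lagCoeff, ← Real.sqrt_sq hn'.le, ← Real.sqrt_div (by positivity), Real.sqrt_sq hn'.le]
  congr 1
  field_simp
  ring

theorem tendsto_toNat_div (i : ℤ) :
    Tendsto (fun n : ℕ => (((n : ℤ) + i).toNat : ℝ) / n) atTop (𝓝 1) := by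
  have h1 : Tendsto (fun n : ℕ => (1 : ℝ) + i / n) atTop (𝓝 1) := by
    have := (tendsto_const_div_atTop_nhds_zero_nat (i : ℝ)).const_add (1 : ℝ)
    simpa using this
  refine h1.congr' ((eventually_gt_atTop i.natAbs).mono fun n hn => ?_)
  have hn' : (n : ℝ) ≠ 0 := Nat.cast_ne_zero.mpr (by omega)
  have : (((n : ℤ) + i).toNat : ℤ) = n + i := Int.toNat_of_nonneg (by omega)
  have h2 : (((n : ℤ) + i).toNat : ℝ) = n + i := by exact_mod_cast this
  beta_reduce
  rw [h2]; field_simp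

/-- The moments of the Laguerre functions converge to those of the arcsine law. -/
theorem tendsto_lagMom (α p : ℕ) (i : ℤ) :
    Tendsto (fun n : ℕ => lagMom α p n ((n : ℤ) + i).toNat / (n : ℝ) ^ p) atTop
      (𝓝 (cosMom p i)) := by
  induction p generalizing i with
  | zero =>
    rw [cosMom_zero]
    refine tendsto_const_nhds.congr' ((eventually_gt_atTop i.natAbs).mono fun n hn => ?_)
    beta_reduce
    rw [lagMom_zero, pow_zero, div_one]
    by_cases hi : i = 0
    · simp [hi]
    · rw [if_neg hi, if_neg (by omega)]
  | succ p ih =>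
    rw [cosMom_succ]
    have hc := tendsto_lagCoeff_div α (tendsto_toNat_div i)
    have hc' := tendsto_lagCoeff_div α (tendsto_toNat_div (i - 1))
    have hb : Tendsto (fun n : ℕ => 2 * ((((n : ℤ) + (i - 1)).toNat : ℝ) / n) + (α + 3) / n) atTop
        (𝓝 2) := by
      have := ((tendsto_toNat_div (i - 1)).const_mul 2).add
        (tendsto_const_div_atTop_nhds_zero_nat ((α : ℝ) + 3))
      simpa using this
    have h := ((hc.mul (ih (i + 1))).add (hb.mul (ih i))).add (hc'.mul (ih (i - 1)))
    simp only [one_mul] at h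
    refine h.congr' ((eventually_gt_atTop (i.natAbs + 2)).mono fun n hn => ?_)
    -- For large n the truncation in `toNat` is inactive, and the three indices are l, l + 1, l + 2
    -- as the recurrence requires.
    obtain ⟨l, hl⟩ : ∃ l, ((n : ℤ) + (i - 1)).toNat = l := ⟨_, rfl⟩
    have h1 : ((n : ℤ) + i).toNat = l + 1 := by omega
    have h2 : ((n : ℤ) + (i + 1)).toNat = l + 2 := by omega
    have hn' : (n : ℝ) ≠ 0 := Nat.cast_ne_zero.mpr (by omega)
    beta_reduce
    rw [hl, h1, h2, lagMom_succ, pow_succ]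
    field_simp
    ring

end Moments

/-! ### Moments of the one-point function -/

section KernelMoments

theorem integrableOn_eval_mul_lagFunKer (α m : ℕ) (q : ℝ[X]) :
    IntegrableOn (fun x => q.eval x * lagFunKer α m x x) (Set.Ioi 0) := by
  simp only [lagFunKer, Finset.mul_sum]
  exact integrable_finsetSum _ fun k _ => integrableOn_eval_mul_lagFun_mul α k k q

theorem integral_lagFunKer (α m : ℕ) :
    ∫ x in Set.Ioi (0 : ℝ), lagFunKer α m x x = m + 1 := by
  simp only [lagFunKer]
  have hI : ∀ k, IntegrableOn (fun x => lagFun α k x * lagFun α k x) (Set.Ioi 0) := fun k => by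
    simpa using integrableOn_pow_mul_lagFun_mul α k k 0
  rw [integral_finsetSum _ fun k _ => hI k]
  have h : ∀ k, ∫ x in Set.Ioi (0 : ℝ), lagFun α k x * lagFun α k x = 1 := fun k => by
    have := lagMom_zero α k k
    simpa [lagMom] using this
  simp [h]

/-- Integrate the derivative of x^(p+1) · x K(x, x) over the half-line: the formula for (x K)'
reduces the moment to a single off-diagonal matrix entry. -/
theorem integral_pow_mul_lagFunKer (α m p : ℕ) :
    (p + 1) * ∫ x in Set.Ioi (0 : ℝ), x ^ (p + 1) * lagFunKer α m x x =
      lagCoeff α m * lagMom α (p + 1) (m + 1) m := by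
  have hd : ∀ x ∈ Set.Ioi (0 : ℝ), HasDerivAt (fun x => x ^ (p + 1) * (x * lagFunKer α m x x))
      ((p + 1) * (x ^ (p + 1) * lagFunKer α m x x) -
        lagCoeff α m * (x ^ (p + 1) * (lagFun α (m + 1) x * lagFun α m x))) x := by
    intro x hx
    refine ((hasDerivAt_pow (p + 1) x).mul (hasDerivAt_lagFunKer_diag α m hx)).congr_deriv ?_
    simp only [Nat.add_sub_cancel]
    push_cast
    ring
  have hI1 : IntegrableOn (fun x => ((p : ℝ) + 1) * (x ^ (p + 1) * lagFunKer α m x x))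
      (Set.Ioi 0) := by
    have := (integrableOn_eval_mul_lagFunKer α m (Polynomial.X ^ (p + 1))).const_mul ((p : ℝ) + 1)
    simpa [IntegrableOn] using this
  have hI2 := (integrableOn_pow_mul_lagFun_mul α (m + 1) m (p + 1)).const_mul (lagCoeff α m)
  have ht : Tendsto (fun x => x ^ (p + 1) * (x * lagFunKer α m x x)) atTop (𝓝 0) := by
    have : Tendsto (fun x => ∑ k ∈ Finset.range (m + 1),
        x ^ (p + 2) * (lagFun α k x * lagFun α k x)) atTop (𝓝 0) := by
      have := tendsto_finsetSum (Finset.range (m + 1)) fun k _ =>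
        tendsto_pow_mul_lagFun_mul α k k (p + 2)
      simpa using this
    refine this.congr fun x => ?_
    rw [← Finset.mul_sum, lagFunKer]; ring
  have hcont : Continuous (fun x => x ^ (p + 1) * (x * lagFunKer α m x x)) := by
    have := continuous_lagFunKer_diag α m
    fun_prop
  have h := integral_Ioi_of_hasDerivAt_of_tendsto (a := (0 : ℝ))
    hcont.continuousAt.continuousWithinAt hd (hI1.sub hI2) ht
  rw [integral_sub hI1 hI2, integral_const_mul, integral_const_mul] at h
  simp only [zero_mul, mul_zero, sub_zero] at h
  rw [lagMom]
  linarith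

/-- Integration against the Marchenko-Pastur law, in the coordinate `t = 2 + 2 cos θ`. -/
noncomputable def mpInt (F : ℝ → ℝ) : ℝ :=
  Real.pi⁻¹ * ∫ θ in (0 : ℝ)..Real.pi, F (2 + 2 * Real.cos θ) * (1 - Real.cos θ)

/-- Convergence of the moments of the rescaled one-point function. -/
theorem tendsto_moment_lagFunKer (α p : ℕ) {m : ℕ → ℕ}
    (hm : Tendsto (fun N => (m N : ℝ) / N) atTop (𝓝 1)) :
    Tendsto (fun N : ℕ => (∫ x in Set.Ioi (0 : ℝ), x ^ p * lagFunKer α (m N) x x) / (N : ℝ) ^ (p + 1))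
      atTop (𝓝 (mpInt fun t => t ^ p)) := by
  have hm1 : Tendsto (fun N : ℕ => ((m N : ℝ) + 1) / N) atTop (𝓝 1) := by
    have := hm.add (tendsto_const_div_atTop_nhds_zero_nat (1 : ℝ))
    simpa [add_div] using this
  cases p with
  | zero =>
    have e : mpInt (fun t => t ^ 0) = 1 := by
      simp only [mpInt, pow_zero, one_mul]
      rw [intervalIntegral.integral_sub (by simp) (Continuous.intervalIntegrable (by fun_prop) _ _)]
      simp [Real.pi_ne_zero]
    rw [e]
    simpa [integral_lagFunKer] using hm1
  | succ p =>
    have hinf : Tendsto (fun N => m N + 1) atTop atTop := by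
      have : Tendsto (fun N : ℕ => (m N : ℝ) / N * N) atTop atTop :=
        hm.pos_mul_atTop one_pos tendsto_natCast_atTop_atTop
      have h2 : Tendsto (fun N : ℕ => (m N : ℝ)) atTop atTop := by
        refine this.congr' ((eventually_gt_atTop 0).mono fun N hN => ?_)
        have : (N : ℝ) ≠ 0 := Nat.cast_ne_zero.mpr (by omega)
        field_simp
      exact tendsto_atTop_mono (fun N => Nat.le_succ (m N)) (tendsto_natCast_atTop_iff.mp h2)
    have h1 := (tendsto_lagMom α (p + 1) (-1)).comp hinf
    have h2 := ((tendsto_lagCoeff_div α hm).mul h1).mul (hm1.pow (p + 1))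
    have h3 := h2.const_mul ((p : ℝ) + 1)⁻¹
    rw [one_mul, one_pow, mul_one, cosMom_neg_one, inv_mul_cancel_left₀ (by positivity)] at h3
    refine h3.congr' ((eventually_gt_atTop 0).mono fun N hN => ?_)
    have hN' : (N : ℝ) ≠ 0 := Nat.cast_ne_zero.mpr (by omega)
    have hp : (p : ℝ) + 1 ≠ 0 := by positivity
    have hm' : (m N : ℝ) + 1 ≠ 0 := by positivity
    have e := integral_pow_mul_lagFunKer α (m N) p
    have e2 : (((m N + 1 : ℕ) : ℤ) + -1).toNat = m N := by omega
    simp only [Function.comp_apply, e2]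
    rw [eq_div_iff (by positivity), ← mul_right_inj' hp, e]
    push_cast
    rw [div_pow]
    field_simp
    ring

end KernelMoments

end SampleCov

/-! ### Weak convergence to the Marchenko-Pastur law -/

namespace SampleCov

open Polynomial

section WeakConvergence

/-- Integration against the rescaled one-point function. -/
noncomputable def scaledInt (α m N : ℕ) (F : ℝ → ℝ) : ℝ :=
  (∫ x in Set.Ioi (0 : ℝ), F ((N : ℝ)⁻¹ * x) * lagFunKer α m x x) / N

theorem integrableOn_scaled_eval (α m N : ℕ) (q : ℝ[X]) :
    IntegrableOn (fun x => q.eval ((N : ℝ)⁻¹ * x) * lagFunKer α m x x) (Set.Ioi 0) := by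
  have := integrableOn_eval_mul_lagFunKer α m (q.comp (C ((N : ℝ)⁻¹) * Polynomial.X))
  simpa using this

theorem integrableOn_scaled_of_bounded (α m N : ℕ) {f : ℝ → ℝ} (hf : Continuous f) {c : ℝ}
    (hc : ∀ t, |f t| ≤ c) :
    IntegrableOn (fun x => f ((N : ℝ)⁻¹ * x) * lagFunKer α m x x) (Set.Ioi 0) := by
  have h1 := integrableOn_scaled_eval α m N (C c)
  refine Integrable.mono' h1 ?_ (Eventually.of_forall fun x => ?_)
  · have := continuous_lagFunKer_diag α m
    exact Continuous.aestronglyMeasurable (by fun_prop)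
  · rw [Real.norm_eq_abs, abs_mul, abs_of_nonneg (lagFunKer_diag_nonneg α m x), eval_C]
    exact mul_le_mul_of_nonneg_right (hc _) (lagFunKer_diag_nonneg α m x)

theorem intervalIntegrable_mpInt {F : ℝ → ℝ} (hF : Continuous F) :
    IntervalIntegrable (fun θ => F (2 + 2 * Real.cos θ) * (1 - Real.cos θ)) volume 0 Real.pi :=
  Continuous.intervalIntegrable (by fun_prop) _ _

theorem mpInt_add {F G : ℝ → ℝ} (hF : Continuous F) (hG : Continuous G) :
    mpInt (fun t => F t + G t) = mpInt F + mpInt G := by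
  simp only [mpInt, add_mul]
  rw [intervalIntegral.integral_add (intervalIntegrable_mpInt hF) (intervalIntegrable_mpInt hG),
    mul_add]

theorem mpInt_const_mul (c : ℝ) (F : ℝ → ℝ) : mpInt (fun t => c * F t) = c * mpInt F := by
  simp only [mpInt, mul_assoc, intervalIntegral.integral_const_mul]
  ring

theorem mpInt_mono {F G : ℝ → ℝ} (hF : Continuous F) (hG : Continuous G)
    (h : ∀ t ∈ Set.Icc (0 : ℝ) 4, F t ≤ G t) : mpInt F ≤ mpInt G := by
  refine mul_le_mul_of_nonneg_left ?_ (by positivity)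
  refine intervalIntegral.integral_mono_on Real.pi_pos.le (intervalIntegrable_mpInt hF)
    (intervalIntegrable_mpInt hG) fun θ _ => ?_
  have h1 := Real.neg_one_le_cos θ
  have h2 := Real.cos_le_one θ
  exact mul_le_mul_of_nonneg_right (h _ ⟨by linarith, by linarith⟩) (by linarith)

theorem mpInt_one : mpInt (fun _ => 1) = 1 := by
  simp only [mpInt, one_mul]
  rw [intervalIntegral.integral_sub (by simp) (Continuous.intervalIntegrable (by fun_prop) _ _)]
  simp [Real.pi_ne_zero]

variable {α : ℕ} {m : ℕ → ℕ}

theorem tendsto_scaledInt_eval (hm : Tendsto (fun N => (m N : ℝ) / N) atTop (𝓝 1)) (q : ℝ[X]) :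
    Tendsto (fun N : ℕ => scaledInt α (m N) N fun t => q.eval t) atTop
      (𝓝 (mpInt fun t => q.eval t)) := by
  induction q using Polynomial.induction_on' with
  | add p q hp hq =>
    simp only [eval_add]
    rw [mpInt_add p.continuous q.continuous]
    refine (hp.add hq).congr fun N => ?_
    simp only [scaledInt, add_mul]
    rw [integral_add (integrableOn_scaled_eval _ _ _ p) (integrableOn_scaled_eval _ _ _ q), add_div]
  | monomial n a =>
    simp only [eval_monomial]
    rw [mpInt_const_mul]
    refine ((tendsto_moment_lagFunKer α n hm).const_mul a).congr fun N => ?_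
    simp only [scaledInt, mul_pow, mul_assoc, integral_const_mul]
    rw [pow_succ, inv_pow]
    ring

theorem abs_eval_le_mul_pow (q : ℝ[X]) {t : ℝ} (ht : 1 ≤ t) :
    |q.eval t| ≤ (∑ i ∈ Finset.range (q.natDegree + 1), |q.coeff i|) * t ^ q.natDegree := by
  rw [eval_eq_sum_range, Finset.sum_mul]
  refine (Finset.abs_sum_le_sum_abs _ _).trans (Finset.sum_le_sum fun i hi => ?_)
  rw [abs_mul, abs_of_nonneg (pow_nonneg (zero_le_one.trans ht) i)]
  exact mul_le_mul_of_nonneg_left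
    (pow_le_pow_right₀ ht (Nat.lt_succ_iff.mp (Finset.mem_range.mp hi))) (abs_nonneg _)

/-- Polynomial approximation of a function vanishing on `[5, ∞)`, with an error on `[0, ∞)` that is
controlled by a monomial which is small on `[0, 4]`. -/
theorem exists_polynomial_approx {f : ℝ → ℝ} (hf : Continuous f) (h5 : ∀ t, 5 ≤ t → f t = 0)
    {ε : ℝ} (hε : 0 < ε) : ∃ (q : ℝ[X]) (c : ℝ) (M : ℕ), 0 ≤ c ∧ c * 4 ^ M ≤ ε ∧
      ∀ t, 0 ≤ t → |f t - q.eval t| ≤ ε + c * t ^ M := by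
  obtain ⟨q, hq⟩ := exists_polynomial_near_of_continuousOn 0 5 f hf.continuousOn ε hε
  set A := ∑ i ∈ Finset.range (q.natDegree + 1), |q.coeff i| with hA
  have hA0 : 0 ≤ A := Finset.sum_nonneg fun _ _ => abs_nonneg _
  -- For t ≥ 5 the bound A t^d is at most A 5^{-L} t^(d+L), which on [0, 4] is at most A 4^d (4/5)^L
  -- and so small for large L.
  have hlim : Tendsto (fun L : ℕ => A * 4 ^ q.natDegree * (4 / 5 : ℝ) ^ L) atTop (𝓝 0) := by
    have := (tendsto_pow_atTop_nhds_zero_of_lt_one (r := (4 / 5 : ℝ)) (by norm_num)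
      (by norm_num)).const_mul (A * 4 ^ q.natDegree)
    simpa using this
  obtain ⟨L, hL⟩ := (hlim.eventually (gt_mem_nhds hε)).exists
  refine ⟨q, A / 5 ^ L, q.natDegree + L, by positivity, ?_, fun t ht => ?_⟩
  · rw [div_pow] at hL
    rw [pow_add, div_mul_eq_mul_div, ← mul_assoc, mul_div_assoc]
    exact hL.le
  · rcases le_total t 5 with h | h
    · have := hq t ⟨ht, h⟩
      rw [abs_sub_comm]
      have : 0 ≤ A / 5 ^ L * t ^ (q.natDegree + L) := by positivity
      linarith
    · rw [h5 t h, zero_sub, abs_neg]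
      have h1 := abs_eval_le_mul_pow q (show 1 ≤ t by linarith)
      have h2 : (5 : ℝ) ^ L ≤ t ^ L := pow_le_pow_left₀ (by norm_num) h L
      have h3 : A * t ^ q.natDegree ≤ A / 5 ^ L * t ^ (q.natDegree + L) := by
        rw [pow_add, div_mul_eq_mul_div, le_div_iff₀ (by positivity), ← mul_assoc]
        exact mul_le_mul_of_nonneg_left h2 (by positivity)
      linarith

/-- The rescaled one-point functions converge weakly to the Marchenko-Pastur law. -/
theorem tendsto_scaledInt (hm : Tendsto (fun N => (m N : ℝ) / N) atTop (𝓝 1)) {f : ℝ → ℝ}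
    (hf : Continuous f) {c : ℝ} (hc : ∀ t, |f t| ≤ c) (h5 : ∀ t, 5 ≤ t → f t = 0) :
    Tendsto (fun N : ℕ => scaledInt α (m N) N f) atTop (𝓝 (mpInt f)) := by
  rw [Metric.tendsto_atTop]
  suffices H : ∀ ε > 0, ∀ᶠ N in atTop, dist (scaledInt α (m N) N f) (mpInt f) < ε from
    fun ε hε => eventually_atTop.mp (H ε hε)
  intro ε hε
  -- The polynomial error r = ε/7 + a t^M dominates |f - q| on the whole half-line and has limit
  -- integral at most 2ε/7. The budget is 3ε/7 for replacing f by q, ε/7 for the convergence for q,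
  -- and 2ε/7 for going back.
  obtain ⟨q, a, M, ha, haM, hq⟩ := exists_polynomial_approx hf h5 (show 0 < ε / 7 by positivity)
  set r : ℝ[X] := C (ε / 7) + C a * Polynomial.X ^ M with hr
  have hre : ∀ t, r.eval t = ε / 7 + a * t ^ M := fun t => by simp [hr]
  have hr2 : mpInt (fun t => r.eval t) ≤ 2 * (ε / 7) := by
    have h1 : mpInt (fun t => r.eval t) ≤ mpInt (fun _ => 2 * (ε / 7) * 1) := by
      refine mpInt_mono r.continuous continuous_const fun t ht => ?_
      rw [hre]
      have : a * t ^ M ≤ a * 4 ^ M :=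
        mul_le_mul_of_nonneg_left (pow_le_pow_left₀ ht.1 ht.2 M) ha
      linarith
    rwa [mpInt_const_mul, mpInt_one, mul_one] at h1
  have hmp : |mpInt f - mpInt (fun t => q.eval t)| ≤ 2 * (ε / 7) := by
    have h1 : mpInt f ≤ mpInt (fun t => q.eval t) + mpInt (fun t => r.eval t) := by
      rw [← mpInt_add q.continuous r.continuous]
      refine mpInt_mono hf (q.continuous.add r.continuous) fun t ht => ?_
      rw [hre]
      linarith [(abs_le.mp (hq t ht.1)).2]
    have h2 : mpInt (fun t => q.eval t) ≤ mpInt f + mpInt (fun t => r.eval t) := by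
      rw [← mpInt_add hf r.continuous]
      refine mpInt_mono q.continuous (hf.add r.continuous) fun t ht => ?_
      rw [hre]
      linarith [(abs_le.mp (hq t ht.1)).1]
    rw [abs_le]; constructor <;> linarith
  have hsc : ∀ N, |scaledInt α (m N) N f - scaledInt α (m N) N (fun t => q.eval t)| ≤
      scaledInt α (m N) N (fun t => r.eval t) := by
    intro N
    have i1 := integrableOn_scaled_of_bounded α (m N) N hf hc
    have i2 := integrableOn_scaled_eval α (m N) N q
    have i3 := integrableOn_scaled_eval α (m N) N r
    rw [scaledInt, scaledInt, scaledInt, ← sub_div, abs_div, Nat.abs_cast, ← integral_sub i1 i2]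
    refine div_le_div_of_nonneg_right ?_ (Nat.cast_nonneg _)
    rw [← Real.norm_eq_abs]
    refine norm_integral_le_of_norm_le i3
      ((ae_restrict_mem measurableSet_Ioi).mono fun x hx => ?_)
    rw [Real.norm_eq_abs, ← sub_mul, abs_mul, abs_of_nonneg (lagFunKer_diag_nonneg α _ x), hre]
    exact mul_le_mul_of_nonneg_right
      (hq _ (mul_nonneg (by positivity) (le_of_lt hx))) (lagFunKer_diag_nonneg α _ x)
  have e1 := (Metric.tendsto_nhds.mp (tendsto_scaledInt_eval (α := α) hm q)) (ε / 7) (by positivity)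
  have e2 := (tendsto_scaledInt_eval (α := α) hm r).eventually
    (gt_mem_nhds (show mpInt (fun t => r.eval t) < 3 * (ε / 7) by linarith))
  filter_upwards [e1, e2] with N h1 h2
  have h3 := hsc N
  rw [Real.dist_eq] at h1 ⊢
  rw [abs_le] at h3 hmp
  rw [abs_lt] at h1 ⊢
  constructor <;> linarith

end WeakConvergence

end SampleCov

/-! ### Ellipticity and the Harnack inequality in the bulk -/

namespace SampleCov

section Gronwall

/-- The hypothesis makes f(x) e^{Cx} increasing and f(x) e^{-Cx} decreasing. -/
theorem le_mul_exp_of_abs_deriv_le {f f' : ℝ → ℝ} {a b C : ℝ}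
    (hd : ∀ t ∈ Set.Icc a b, HasDerivAt f (f' t) t)
    (hC : ∀ t ∈ Set.Icc a b, |f' t| ≤ C * f t) {s t : ℝ} (hs : s ∈ Set.Icc a b)
    (ht : t ∈ Set.Icc a b) : f s ≤ f t * Real.exp (C * |s - t|) := by
  have key : ∀ σ : ℝ, |σ| = 1 → ∀ x ∈ Set.Icc a b, HasDerivAt (fun x => f x * Real.exp (σ * C * x))
      ((f' x + σ * (C * f x)) * Real.exp (σ * C * x)) x := by
    intro σ _ x hx
    refine ((hd x hx).mul (((hasDerivAt_id x).const_mul (σ * C)).exp)).congr_deriv ?_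
    simp only [id]; ring
  have hint : ∀ x ∈ interior (Set.Icc a b), x ∈ Set.Icc a b := fun x hx => interior_subset hx
  rcases le_total s t with hst | hst
  · have hmono : MonotoneOn (fun x => f x * Real.exp (1 * C * x)) (Set.Icc a b) := by
      refine monotoneOn_of_deriv_nonneg (convex_Icc a b)
        (fun x hx => (key 1 (by simp) x hx).continuousAt.continuousWithinAt)
        (fun x hx => (key 1 (by simp) x (hint x hx)).differentiableAt.differentiableWithinAt)
        fun x hx => ?_
      rw [(key 1 (by simp) x (hint x hx)).deriv]
      have := (abs_le.mp (hC x (hint x hx))).1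
      exact mul_nonneg (by linarith) (Real.exp_nonneg _)
    have h := hmono hs ht hst
    simp only [one_mul] at h
    rw [abs_of_nonpos (by linarith), ← sub_nonneg]
    have e : Real.exp (C * -(s - t)) = Real.exp (C * t) * (Real.exp (C * s))⁻¹ := by
      rw [← Real.exp_neg, ← Real.exp_add]; congr 1; ring
    rw [e, ← mul_assoc, sub_nonneg, le_mul_inv_iff₀ (Real.exp_pos _)]
    exact h
  · have hanti : AntitoneOn (fun x => f x * Real.exp (-1 * C * x)) (Set.Icc a b) := by
      refine antitoneOn_of_deriv_nonpos (convex_Icc a b)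
        (fun x hx => (key (-1) (by simp) x hx).continuousAt.continuousWithinAt)
        (fun x hx => (key (-1) (by simp) x (hint x hx)).differentiableAt.differentiableWithinAt)
        fun x hx => ?_
      rw [(key (-1) (by simp) x (hint x hx)).deriv]
      have := (abs_le.mp (hC x (hint x hx))).2
      exact mul_nonpos_of_nonpos_of_nonneg (by linarith) (Real.exp_nonneg _)
    have h := hanti ht hs hst
    simp only [neg_mul, one_mul, Real.exp_neg] at h
    rw [abs_of_nonneg (by linarith)]
    have e : Real.exp (C * (s - t)) = (Real.exp (C * t))⁻¹ * Real.exp (C * s) := by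
      rw [← Real.exp_neg, ← Real.exp_add]; congr 1; ring
    rw [e, ← mul_assoc]
    rwa [← div_eq_mul_inv _ (Real.exp (C * s)), div_le_iff₀ (Real.exp_pos _)] at h

end Gronwall

section Bulk

/-- The quadratic form of `lagFunKer_diag` has smallest eigenvalue a - |c|. -/
theorem energy_le (α m : ℕ) (x : ℝ) :
    lagCoeff α m * (lagCoeff α m - |(m : ℝ) + 1 + (α - x) / 2|) *
      (lagFun α (m + 1) x ^ 2 + lagFun α m x ^ 2) ≤ x * lagFunKer α m x x := by
  rw [lagFunKer_diag, mul_assoc]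
  refine mul_le_mul_of_nonneg_left ?_ (lagCoeff_pos α m).le
  set c := (m : ℝ) + 1 + (α - x) / 2
  set u := lagFun α (m + 1) x
  set v := lagFun α m x
  have h1 : |2 * c * (u * v)| ≤ |c| * (u ^ 2 + v ^ 2) := by
    rw [mul_comm 2 c, mul_assoc, abs_mul]
    refine mul_le_mul_of_nonneg_left ?_ (abs_nonneg c)
    rw [abs_le]
    constructor <;> nlinarith [sq_nonneg (u - v), sq_nonneg (u + v)]
  have := (abs_le.mp h1).1
  linarith

variable {α : ℕ} {m : ℕ → ℕ} {ξ : ℝ}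

theorem tendsto_div_prod (hm : Tendsto (fun N => (m N : ℝ) / N) atTop (𝓝 1)) :
    Tendsto (fun p : ℕ × ℝ => ((m p.1 : ℝ) + 1 + (α - p.1 * p.2) / 2) / p.1) (atTop ×ˢ 𝓝 ξ)
      (𝓝 (1 - ξ / 2)) := by
  have h1 : Tendsto (fun N : ℕ => (m N : ℝ) / N + (1 + (α : ℝ) / 2) / N) atTop (𝓝 1) := by
    have := hm.add (tendsto_const_div_atTop_nhds_zero_nat (1 + (α : ℝ) / 2))
    simpa using this
  have h2 := (h1.comp (tendsto_fst (f := atTop) (g := 𝓝 ξ))).sub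
    ((tendsto_snd (f := (atTop : Filter ℕ)) (g := 𝓝 ξ)).div_const 2)
  refine h2.congr' ?_
  have : ∀ᶠ p : ℕ × ℝ in atTop ×ˢ 𝓝 ξ, 0 < p.1 := tendsto_fst.eventually (eventually_gt_atTop 0)
  filter_upwards [this] with p hp
  have : (p.1 : ℝ) ≠ 0 := Nat.cast_ne_zero.mpr (by omega)
  simp only [Function.comp_apply]
  field_simp
  ring

/-- In the bulk, the quadratic form of the Christoffel-Darboux kernel is uniformly elliptic. -/
theorem exists_bulk_bound (hm : Tendsto (fun N => (m N : ℝ) / N) atTop (𝓝 1))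
    (hξ : ξ ∈ Set.Ioo (0 : ℝ) 4) : ∃ η > 0, ∀ᶠ p : ℕ × ℝ in atTop ×ˢ 𝓝 ξ,
      η * p.1 ≤ lagCoeff α (m p.1) - |(m p.1 : ℝ) + 1 + (α - p.1 * p.2) / 2| := by
  -- The bulk condition 0 < ξ < 4 is exactly |1 - ξ/2| < 1, the limiting form of |c| < a.
  have h1 : 0 < 1 - |1 - ξ / 2| := by
    rw [sub_pos, abs_lt]; constructor <;> linarith [hξ.1, hξ.2]
  have h2 := ((tendsto_lagCoeff_div α hm).comp (tendsto_fst (f := atTop) (g := 𝓝 ξ))).sub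
    (tendsto_div_prod (α := α) (ξ := ξ) hm).abs
  refine ⟨(1 - |1 - ξ / 2|) / 2, by positivity, ?_⟩
  have : ∀ᶠ p : ℕ × ℝ in atTop ×ˢ 𝓝 ξ, 0 < p.1 := tendsto_fst.eventually (eventually_gt_atTop 0)
  filter_upwards [this, h2.eventually (lt_mem_nhds (half_lt_self h1))] with p hp hp2
  have hN : (0 : ℝ) < p.1 := Nat.cast_pos.mpr hp
  simp only [Function.comp_apply] at hp2
  rw [abs_div, Nat.abs_cast, ← sub_div, lt_div_iff₀ hN] at hp2
  exact hp2.le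

theorem hasDerivAt_scaled_diag (α m : ℕ) {N : ℕ} (hN : 0 < N) {t : ℝ} (ht : 0 < t) :
    HasDerivAt (fun t : ℝ => t * lagFunKer α m (N * t) (N * t))
      (-(lagCoeff α m * (lagFun α (m + 1) (N * t) * lagFun α m (N * t)))) t := by
  have hN' : (0 : ℝ) < N := Nat.cast_pos.mpr hN
  have h1 : HasDerivAt (fun t : ℝ => (N : ℝ) * t) N t := by
    simpa using (hasDerivAt_id t).const_mul (N : ℝ)
  have h2 := ((hasDerivAt_lagFunKer_diag α m (mul_pos hN' ht)).comp t h1).div_const (N : ℝ)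
  refine (h2.congr_deriv ?_).congr_of_eventuallyEq (Eventually.of_forall fun s => ?_)
  · field_simp
  · simp only [Function.comp_apply]; field_simp

/-- Uniform Harnack inequality for the rescaled one-point function in the bulk. -/
theorem exists_harnack (hm : Tendsto (fun N => (m N : ℝ) / N) atTop (𝓝 1))
    (hξ : ξ ∈ Set.Ioo (0 : ℝ) 4) : ∃ δ₀ > 0, ∃ Γ, δ₀ < ξ ∧ ∀ᶠ N in atTop,
      ∀ s ∈ Set.Icc (ξ - δ₀) (ξ + δ₀), ∀ t ∈ Set.Icc (ξ - δ₀) (ξ + δ₀),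
        s * lagFunKer α (m N) (N * s) (N * s) ≤
          t * lagFunKer α (m N) (N * t) (N * t) * Real.exp (Γ * |s - t|) := by
  obtain ⟨η, hη, hev⟩ := exists_bulk_bound (α := α) hm hξ
  obtain ⟨pa, hpa, pb, hpb, hab⟩ := eventually_prod_iff.mp hev
  obtain ⟨δ, hδ, hball⟩ := Metric.eventually_nhds_iff.mp hpb
  -- The bound ξ/2 keeps the window positive. The rate 1/(2η) comes from a|uv| ≤ a(u² + v²)/2 and
  -- the ellipticity bound.
  refine ⟨min (δ / 2) (ξ / 2), lt_min (by positivity) (by linarith [hξ.1]), 1 / (2 * η),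
    (min_le_right _ _).trans_lt (by linarith [hξ.1]), ?_⟩
  filter_upwards [hpa, eventually_gt_atTop 0] with N hN hN0 s hs t ht
  have hN' : (0 : ℝ) < N := Nat.cast_pos.mpr hN0
  have hmem : ∀ x ∈ Set.Icc (ξ - min (δ / 2) (ξ / 2)) (ξ + min (δ / 2) (ξ / 2)), 0 < x ∧ pb x := by
    intro x hx
    have h1 := min_le_left (δ / 2) (ξ / 2)
    have h2 := min_le_right (δ / 2) (ξ / 2)
    refine ⟨by linarith [hx.1, hξ.1], hball ?_⟩
    rw [Real.dist_eq, abs_lt]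
    constructor <;> linarith [hx.1, hx.2]
  refine le_mul_exp_of_abs_deriv_le
    (fun x hx => hasDerivAt_scaled_diag α (m N) hN0 (hmem x hx).1) (fun x hx => ?_) hs ht
  have h1 := hab hN (hmem x hx).2
  have h2 := energy_le α (m N) (N * x)
  set a := lagCoeff α (m N)
  set u := lagFun α (m N + 1) (N * x)
  set v := lagFun α (m N) (N * x)
  have ha : 0 < a := lagCoeff_pos _ _
  have h3 : a * (η * N) * (u ^ 2 + v ^ 2) ≤ N * x * lagFunKer α (m N) (N * x) (N * x) :=
    le_trans (mul_le_mul_of_nonneg_right (mul_le_mul_of_nonneg_left h1 ha.le) (by positivity)) h2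
  have h4 : |u * v| ≤ (u ^ 2 + v ^ 2) / 2 := by
    rw [abs_le]
    constructor <;> nlinarith [sq_nonneg (u - v), sq_nonneg (u + v)]
  rw [abs_neg, abs_mul, abs_of_pos ha, div_mul_eq_mul_div, one_mul, le_div_iff₀ (by positivity)]
  have h5 : N * (a * η * (u ^ 2 + v ^ 2)) ≤ N * (x * lagFunKer α (m N) (N * x) (N * x)) := by
    linarith
  have h6 := le_of_mul_le_mul_left h5 hN'
  have h7 : a * |u * v| * (2 * η) ≤ a * ((u ^ 2 + v ^ 2) / 2) * (2 * η) := by gcongr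
  linarith

end Bulk

/-! ### Locally uniform convergence of the one-point function -/

section Density

/-- The substitution t = 2 + 2 cos θ identifies `mpInt` with integration against the density. -/
theorem mpDensity_comp_cos {θ : ℝ} (hθ : θ ∈ Set.Ioo 0 Real.pi) :
    mpDensity (2 + 2 * Real.cos θ) * (2 * Real.sin θ) = Real.pi⁻¹ * (1 - Real.cos θ) := by
  have hs := Real.sin_pos_of_pos_of_lt_pi hθ.1 hθ.2
  have hc := Real.sin_sq_add_cos_sq θ
  have e : (2 + 2 * Real.cos θ) * (4 - (2 + 2 * Real.cos θ)) = (2 * Real.sin θ) ^ 2 := by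
    linear_combination (-4) * hc
  have h1 : 0 < 2 + 2 * Real.cos θ := by
    have := Real.neg_one_le_cos θ
    rcases this.lt_or_eq with h | h
    · linarith
    · rw [← h] at hc; nlinarith
  rw [mpDensity, e, Real.sqrt_sq (by positivity)]
  have hpi := Real.pi_pos
  have h2 : 1 + Real.cos θ ≠ 0 := by linarith
  field_simp
  linear_combination hc

theorem integral_eq_integral_cos {f : ℝ → ℝ} (hf : Continuous f) :
    ∫ t in (0 : ℝ)..4, f t = ∫ θ in (0 : ℝ)..Real.pi, f (2 + 2 * Real.cos θ) * (2 * Real.sin θ) := by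
  have h := intervalIntegral.integral_comp_mul_deriv (a := 0) (b := Real.pi)
    (f := fun θ => 2 + 2 * Real.cos θ) (f' := fun θ => 2 * -Real.sin θ) (g := f)
    (fun θ _ => ((Real.hasDerivAt_cos θ).const_mul 2).const_add 2)
    (by fun_prop) hf
  simp only [Function.comp_apply, Real.cos_pi, Real.cos_zero, mul_neg,
    intervalIntegral.integral_neg] at h
  norm_num at h
  rw [intervalIntegral.integral_symm, ← h, neg_neg]

theorem mpInt_le {f : ℝ → ℝ} (hf : Continuous f) {b : ℝ}
    (h : ∀ t ∈ Set.Ioo (0 : ℝ) 4, f t * mpDensity t ≤ f t * b) :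
    mpInt f ≤ b * ∫ t in (0 : ℝ)..4, f t := by
  rw [integral_eq_integral_cos hf, mpInt, ← intervalIntegral.integral_const_mul,
    ← intervalIntegral.integral_const_mul]
  refine intervalIntegral.integral_mono_on_of_le_Ioo Real.pi_pos.le
    ((intervalIntegrable_mpInt hf).const_mul _)
    (Continuous.intervalIntegrable (by fun_prop) _ _) fun θ hθ => ?_
  have hs := Real.sin_pos_of_pos_of_lt_pi hθ.1 hθ.2
  have hc := Real.sin_sq_add_cos_sq θ
  have h1 : -1 < Real.cos θ := by
    rcases (Real.neg_one_le_cos θ).lt_or_eq with h | h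
    · exact h
    · rw [← h] at hc; nlinarith
  have h2 : Real.cos θ < 1 := by
    rcases (Real.cos_le_one θ).lt_or_eq with h | h
    · exact h
    · rw [h] at hc; nlinarith
  have h3 := h (2 + 2 * Real.cos θ) ⟨by linarith, by linarith⟩
  have h4 := mpDensity_comp_cos hθ
  calc Real.pi⁻¹ * (f (2 + 2 * Real.cos θ) * (1 - Real.cos θ))
      = f (2 + 2 * Real.cos θ) * mpDensity (2 + 2 * Real.cos θ) * (2 * Real.sin θ) := by
        linear_combination (-f (2 + 2 * Real.cos θ)) * h4
    _ ≤ f (2 + 2 * Real.cos θ) * b * (2 * Real.sin θ) :=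
        mul_le_mul_of_nonneg_right h3 (by positivity)
    _ = _ := by ring

theorem le_mpInt {f : ℝ → ℝ} (hf : Continuous f) {b : ℝ}
    (h : ∀ t ∈ Set.Ioo (0 : ℝ) 4, f t * b ≤ f t * mpDensity t) :
    b * ∫ t in (0 : ℝ)..4, f t ≤ mpInt f := by
  have h1 := mpInt_le (f := fun t => -f t) (b := b) hf.neg fun t ht => by
    have := h t ht; linarith
  have h2 : mpInt (fun t => -f t) = -mpInt f := by
    have := mpInt_const_mul (-1) f
    simpa using this
  rw [h2, intervalIntegral.integral_neg] at h1
  linarith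

theorem integral_Ioi_comp_inv_mul {f : ℝ → ℝ} (h0 : ∀ t, t ∉ Set.Ioo (0 : ℝ) 4 → f t = 0) {N : ℕ}
    (hN : 0 < N) : ∫ x in Set.Ioi (0 : ℝ), f ((N : ℝ)⁻¹ * x) = N * ∫ t in (0 : ℝ)..4, f t := by
  have hN' : (0 : ℝ) < N := Nat.cast_pos.mpr hN
  rw [integral_comp_mul_left_Ioi _ _ (inv_pos.mpr hN'), inv_inv, mul_zero, smul_eq_mul,
    intervalIntegral.integral_of_le (by norm_num)]
  congr 1
  refine setIntegral_eq_of_subset_of_forall_sdiff_eq_zero measurableSet_Ioi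
    (fun x hx => hx.1) fun x hx => h0 x fun h => hx.2 ⟨h.1, h.2.le⟩

theorem integrableOn_comp_inv_mul {f : ℝ → ℝ} (hf : Continuous f)
    (h0 : ∀ t, t ∉ Set.Ioo (0 : ℝ) 4 → f t = 0) {N : ℕ} (hN : 0 < N) :
    IntegrableOn (fun x => f ((N : ℝ)⁻¹ * x)) (Set.Ioi 0) := by
  have hN' : (0 : ℝ) < N := Nat.cast_pos.mpr hN
  have hcs : HasCompactSupport f :=
    HasCompactSupport.intro (isCompact_Icc (a := (0 : ℝ)) (b := 4)) fun x hx =>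
      h0 x fun h => hx ⟨h.1.le, h.2.le⟩
  exact ((hf.integrable_of_hasCompactSupport hcs).comp_mul_left'
    (inv_pos.mpr hN').ne').integrableOn

theorem scaledInt_le {f : ℝ → ℝ} (hf : Continuous f) {c : ℝ} (hc : ∀ t, |f t| ≤ c)
    (h0 : ∀ t, t ∉ Set.Ioo (0 : ℝ) 4 → f t = 0) {α m N : ℕ} (hN : 0 < N) {b : ℝ}
    (h : ∀ t, f t * lagFunKer α m (N * t) (N * t) ≤ f t * b) :
    scaledInt α m N f ≤ b * ∫ t in (0 : ℝ)..4, f t := by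
  have hN' : (0 : ℝ) < N := Nat.cast_pos.mpr hN
  have h1 : ∫ x in Set.Ioi (0 : ℝ), f ((N : ℝ)⁻¹ * x) * lagFunKer α m x x ≤
      ∫ x in Set.Ioi (0 : ℝ), f ((N : ℝ)⁻¹ * x) * b := by
    refine setIntegral_mono_on (integrableOn_scaled_of_bounded α m N hf hc)
      ((integrableOn_comp_inv_mul hf h0 hN).mul_const b) measurableSet_Ioi fun x _ => ?_
    have := h ((N : ℝ)⁻¹ * x)
    rwa [mul_inv_cancel_left₀ hN'.ne'] at this
  rw [integral_mul_const, integral_Ioi_comp_inv_mul h0 hN] at h1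
  rw [scaledInt, div_le_iff₀ hN']
  linarith

theorem le_scaledInt {f : ℝ → ℝ} (hf : Continuous f) {c : ℝ} (hc : ∀ t, |f t| ≤ c)
    (h0 : ∀ t, t ∉ Set.Ioo (0 : ℝ) 4 → f t = 0) {α m N : ℕ} (hN : 0 < N) {b : ℝ}
    (h : ∀ t, f t * b ≤ f t * lagFunKer α m (N * t) (N * t)) :
    b * ∫ t in (0 : ℝ)..4, f t ≤ scaledInt α m N f := by
  have h1 := scaledInt_le (f := fun t => -f t) hf.neg (c := c) (fun t => by rw [abs_neg]; exact hc t)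
    (fun t ht => by rw [h0 t ht, neg_zero]) (α := α) (m := m) hN (b := b) fun t => by
      have := h t; linarith
  rw [intervalIntegral.integral_neg] at h1
  have h2 : scaledInt α m N (fun t => -f t) = -scaledInt α m N f := by
    simp only [scaledInt, neg_mul, integral_neg, neg_div]
  rw [h2] at h1
  linarith

theorem continuousAt_mpDensity {ξ : ℝ} (hξ : ξ ∈ Set.Ioo (0 : ℝ) 4) : ContinuousAt mpDensity ξ := by
  unfold mpDensity
  have : 2 * Real.pi * ξ ≠ 0 := by have := hξ.1; positivity
  fun_prop (disch := assumption)

theorem mpDensity_pos {ξ : ℝ} (hξ : ξ ∈ Set.Ioo (0 : ℝ) 4) : 0 < mpDensity ξ := by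
  have h1 := hξ.1
  have h2 : 0 < 4 - ξ := by linarith [hξ.2]
  unfold mpDensity
  positivity

/-- Locally uniform convergence of the one-point function to the Marchenko-Pastur density. -/
theorem tendsto_lagFunKer_diag {α : ℕ} {m : ℕ → ℕ} {ξ : ℝ}
    (hm : Tendsto (fun N => (m N : ℝ) / N) atTop (𝓝 1)) (hξ : ξ ∈ Set.Ioo (0 : ℝ) 4) :
    Tendsto (fun p : ℕ × ℝ => lagFunKer α (m p.1) (p.1 * p.2) (p.1 * p.2)) (atTop ×ˢ 𝓝 ξ)
      (𝓝 (mpDensity ξ)) := by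
  obtain ⟨δ₀, hδ₀, Γ, hδξ, hH⟩ := exists_harnack (α := α) hm hξ
  rw [Metric.tendsto_nhds]
  intro ε hε
  set g := mpDensity ξ with hg
  have hg0 : 0 < g := mpDensity_pos hξ
  -- Bounds the ratio of K at two points within δ of ξ: the quotient removes the factor t from t K,
  -- and the exponential is the Harnack constant.
  set ρ : ℝ → ℝ := fun δ => (ξ + δ) / (ξ - δ) * Real.exp (|Γ| * (2 * δ)) with hρ
  have hρc : Tendsto ρ (𝓝[>] 0) (𝓝 1) := by
    have : ContinuousAt ρ 0 := by
      have : ξ - 0 ≠ 0 := by simpa using hξ.1.ne'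
      simp only [hρ]
      fun_prop (disch := assumption)
    have h2 := this.tendsto.mono_left (nhdsWithin_le_nhds (s := Set.Ioi 0))
    simpa [hρ, hξ.1.ne'] using h2
  have hcont := Metric.tendsto_nhds.mp (continuousAt_mpDensity hξ).tendsto (ε / 4) (by positivity)
  obtain ⟨δ₁, hδ₁, hball⟩ := Metric.eventually_nhds_iff.mp hcont
  have hsmall : ∀ᶠ δ : ℝ in 𝓝[>] 0, δ < min (min δ₀ δ₁) (min ξ (4 - ξ)) ∧ 0 < δ ∧
      ρ δ * (g + ε / 2) < g + ε ∧ (g - ε) * ρ δ < g - ε / 2 := by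
    have e1 : Tendsto (fun δ => ρ δ * (g + ε / 2)) (𝓝[>] 0) (𝓝 (g + ε / 2)) := by
      simpa using hρc.mul_const (g + ε / 2)
    have e2 : Tendsto (fun δ => (g - ε) * ρ δ) (𝓝[>] 0) (𝓝 (g - ε)) := by
      simpa using hρc.const_mul (g - ε)
    have hpos : 0 < min (min δ₀ δ₁) (min ξ (4 - ξ)) :=
      lt_min (lt_min hδ₀ hδ₁) (lt_min hξ.1 (by linarith [hξ.2]))
    filter_upwards [e1.eventually (gt_mem_nhds (show g + ε / 2 < g + ε by linarith)),
      e2.eventually (gt_mem_nhds (show g - ε < g - ε / 2 by linarith)),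
      self_mem_nhdsWithin, nhdsWithin_le_nhds (gt_mem_nhds hpos)] with δ h1 h2 h3 h4
    exact ⟨h4, h3, h1, h2⟩
  obtain ⟨δ, hδ, hδ0, hρ1, hρ2⟩ := hsmall.exists
  simp only [lt_min_iff] at hδ
  obtain ⟨⟨hd0, hd1⟩, hdξ, hd4⟩ := hδ
  -- A tent around ξ as test function. By Harnack its average against K lies between k/ρ and ρ k for
  -- the value k at any nearby point, while weak convergence puts the average near g.
  set f : ℝ → ℝ := fun t => max 0 (1 - |t - ξ| / δ) with hf
  have hfc : Continuous f := by simp only [hf]; fun_prop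
  have hf0 : ∀ t, 0 ≤ f t := fun t => le_max_left _ _
  have hf1 : ∀ t, |f t| ≤ 1 := fun t => by
    rw [abs_of_nonneg (hf0 t)]
    refine max_le zero_le_one ?_
    have : 0 ≤ |t - ξ| / δ := by positivity
    linarith
  have hfs : ∀ t, f t ≠ 0 → |t - ξ| < δ := fun t ht => by
    by_contra hcon
    rw [not_lt] at hcon
    refine ht (max_eq_left ?_)
    rw [sub_nonpos, one_le_div hδ0]; exact hcon
  have hfsupp : ∀ t, t ∉ Set.Ioo (0 : ℝ) 4 → f t = 0 := fun t ht => by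
    by_contra hcon
    have := abs_lt.mp (hfs t hcon)
    exact ht ⟨by linarith [this.1], by linarith [this.2]⟩
  set I := ∫ t in (0 : ℝ)..4, f t with hI
  have hI0 : 0 < I := by
    refine intervalIntegral.integral_pos (by norm_num) hfc.continuousOn (fun x _ => hf0 x)
      ⟨ξ, ⟨hξ.1.le, hξ.2.le⟩, ?_⟩
    simp [hf]
  have hup : mpInt f ≤ (g + ε / 4) * I := by
    refine mpInt_le hfc fun t _ => ?_
    by_cases ht : f t = 0
    · simp [ht]
    · have := hball (show dist t ξ < δ₁ from (hfs t ht).trans hd1)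
      rw [Real.dist_eq, abs_lt] at this
      exact mul_le_mul_of_nonneg_left (by linarith [this.2]) (hf0 t)
  have hlow : (g - ε / 4) * I ≤ mpInt f := by
    refine le_mpInt hfc fun t _ => ?_
    by_cases ht : f t = 0
    · simp [ht]
    · have := hball (show dist t ξ < δ₁ from (hfs t ht).trans hd1)
      rw [Real.dist_eq, abs_lt] at this
      exact mul_le_mul_of_nonneg_left (by linarith [this.1]) (hf0 t)
  have hw := Metric.tendsto_nhds.mp (tendsto_scaledInt (α := α) hm hfc hf1
    fun t ht => hfsupp t fun h => by linarith [h.2]) (ε / 4 * I) (by positivity)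
  have hnear : ∀ᶠ t in 𝓝 ξ, |t - ξ| < δ := by
    have := Metric.ball_mem_nhds ξ hδ0
    filter_upwards [this] with t ht
    simpa [Real.dist_eq] using ht
  have hev : ∀ᶠ p : ℕ × ℝ in atTop ×ˢ 𝓝 ξ, (0 < p.1 ∧ (∀ s ∈ Set.Icc (ξ - δ₀) (ξ + δ₀),
      ∀ t ∈ Set.Icc (ξ - δ₀) (ξ + δ₀), s * lagFunKer α (m p.1) (p.1 * s) (p.1 * s) ≤
          t * lagFunKer α (m p.1) (p.1 * t) (p.1 * t) * Real.exp (Γ * |s - t|)) ∧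
      dist (scaledInt α (m p.1) p.1 f) (mpInt f) < ε / 4 * I) ∧ |p.2 - ξ| < δ :=
    (((eventually_gt_atTop 0).and (hH.and hw))).prod_mk hnear
  filter_upwards [hev] with p hp
  obtain ⟨⟨hN, hharn, hdist⟩, ht⟩ := hp
  set N := p.1
  set t := p.2
  have hN' : (0 : ℝ) < N := Nat.cast_pos.mpr hN
  have hρ0 : 0 < ρ δ := by
    simp only [hρ]
    have : 0 < ξ - δ := by linarith
    have : 0 < ξ + δ := by linarith
    positivity
  have hcomp : ∀ s t : ℝ, |s - ξ| < δ → |t - ξ| < δ → lagFunKer α (m N) (N * s) (N * s) ≤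
      ρ δ * lagFunKer α (m N) (N * t) (N * t) := by
    intro s t hs ht
    rw [abs_lt] at hs ht
    have h := hharn s ⟨by linarith [hs.1], by linarith [hs.2]⟩ t
      ⟨by linarith [ht.1], by linarith [ht.2]⟩
    have hs0 : 0 < s := by linarith [hs.1]
    have ht0 : 0 < t := by linarith [ht.1]
    have hK := lagFunKer_diag_nonneg α (m N) (N * t)
    have hexp : Real.exp (Γ * |s - t|) ≤ Real.exp (|Γ| * (2 * δ)) := by
      refine Real.exp_le_exp.mpr ?_
      refine mul_le_mul (le_abs_self Γ) ?_ (abs_nonneg _) (abs_nonneg _)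
      rw [abs_le]; constructor <;> linarith [hs.1, hs.2, ht.1, ht.2]
    have hts : t / s ≤ (ξ + δ) / (ξ - δ) := by
      refine div_le_div₀ (by linarith) (by linarith [ht.2]) (by linarith) (by linarith [hs.1])
    calc lagFunKer α (m N) (N * s) (N * s)
        ≤ (t / s) * Real.exp (Γ * |s - t|) * lagFunKer α (m N) (N * t) (N * t) := by
          rw [div_mul_eq_mul_div, div_mul_eq_mul_div, le_div_iff₀ hs0]
          linarith
      _ ≤ ρ δ * lagFunKer α (m N) (N * t) (N * t) := by
          refine mul_le_mul_of_nonneg_right ?_ hK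
          exact mul_le_mul hts hexp (Real.exp_nonneg _)
            (div_nonneg (by linarith) (by linarith))
  set k := lagFunKer α (m N) (N * t) (N * t) with hk
  have h1 : scaledInt α (m N) N f ≤ (ρ δ * k) * I := by
    refine scaledInt_le hfc hf1 hfsupp hN fun s => ?_
    by_cases hs : f s = 0
    · simp [hs]
    · exact mul_le_mul_of_nonneg_left (hcomp s t (hfs s hs) ht) (hf0 s)
  have h2 : (k / ρ δ) * I ≤ scaledInt α (m N) N f := by
    refine le_scaledInt hfc hf1 hfsupp hN fun s => ?_
    by_cases hs : f s = 0
    · simp [hs]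
    · refine mul_le_mul_of_nonneg_left ?_ (hf0 s)
      rw [div_le_iff₀ hρ0, mul_comm]
      exact hcomp t s ht (hfs s hs)
  rw [Real.dist_eq, abs_lt] at hdist
  have h3 : (k / ρ δ) * I ≤ (g + ε / 2) * I := by linarith [hdist.2]
  have h4 : (g - ε / 2) * I ≤ (ρ δ * k) * I := by linarith [hdist.1]
  have h3' := le_of_mul_le_mul_right h3 hI0
  have h4' := le_of_mul_le_mul_right h4 hI0
  rw [div_le_iff₀ hρ0] at h3'
  rw [Real.dist_eq, abs_lt]
  constructor
  · have : (g - ε) * ρ δ < k * ρ δ := by linarith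
    linarith [lt_of_mul_lt_mul_right this hρ0.le]
  · linarith

end Density

end SampleCov

/-! ### Nearly constant planar systems and their oscillation -/

namespace SampleCov

section Oscillation

/-- Approximate solution of a planar linear system that is close to a rotation. -/
theorem abs_det_sub_sin_le {u v a c : ℝ → ℝ} {r s a₀ c₀ ε k : ℝ} (hπ : a₀ ^ 2 - c₀ ^ 2 = Real.pi ^ 2)
    (hu : ∀ t ∈ Set.uIcc r s, HasDerivAt u (c t * u t + a t * v t) t)
    (hv : ∀ t ∈ Set.uIcc r s, HasDerivAt v (-(a t * u t) - c t * v t) t)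
    (ha : ∀ t ∈ Set.uIcc r s, |a t - a₀| ≤ ε) (hc : ∀ t ∈ Set.uIcc r s, |c t - c₀| ≤ ε)
    (hk : ∀ t ∈ Set.uIcc r s, u t ^ 2 + v t ^ 2 ≤ k) :
    |(u s * v r - v s * u r) - (a₀ * u r ^ 2 + 2 * c₀ * (u r * v r) + a₀ * v r ^ 2) *
        (Real.sin (Real.pi * (s - r)) / Real.pi)| ≤
      4 * (1 + |a₀| + |c₀|) * ε * k * |s - r| := by
  have hpi := Real.pi_pos
  set A : ℝ → ℝ := fun t => u t * v r - v t * u r with hA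
  set B : ℝ → ℝ := fun t => (c₀ * u t + a₀ * v t) * v r + (a₀ * u t + c₀ * v t) * u r with hB
  -- For the frozen coefficients A' = B and B' = -π² A, so W would be constant; it equals A at s and
  -- B(r) sin(π(s - r))/π at r. The actual derivative, e₁ cos + (e₂/π) sin, contains only
  -- coefficient errors.
  set W : ℝ → ℝ := fun t => A t * Real.cos (Real.pi * (s - t)) +
    B t / Real.pi * Real.sin (Real.pi * (s - t)) with hW
  set e₁ : ℝ → ℝ := fun t => ((c t - c₀) * u t + (a t - a₀) * v t) * v r +
    ((a t - a₀) * u t + (c t - c₀) * v t) * u r with he₁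
  set e₂ : ℝ → ℝ := fun t =>
    (c₀ * ((c t - c₀) * u t + (a t - a₀) * v t) - a₀ * ((a t - a₀) * u t + (c t - c₀) * v t)) * v r
    + (a₀ * ((c t - c₀) * u t + (a t - a₀) * v t)
      - c₀ * ((a t - a₀) * u t + (c t - c₀) * v t)) * u r with he₂
  have hWd : ∀ t ∈ Set.uIcc r s, HasDerivWithinAt W (e₁ t * Real.cos (Real.pi * (s - t)) +
      e₂ t / Real.pi * Real.sin (Real.pi * (s - t))) (Set.uIcc r s) t := by
    intro t ht
    have h1 := hu t ht
    have h2 := hv t ht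
    have hin : HasDerivAt (fun t => Real.pi * (s - t)) (-Real.pi) t := by
      simpa using ((hasDerivAt_id t).const_sub s).const_mul Real.pi
    have hAd := (h1.mul_const (v r)).sub (h2.mul_const (u r))
    have hBd := (((h1.const_mul c₀).add (h2.const_mul a₀)).mul_const (v r)).add
      (((h1.const_mul a₀).add (h2.const_mul c₀)).mul_const (u r))
    have hWd := (hAd.mul hin.cos).add ((hBd.div_const Real.pi).mul hin.sin)
    refine (hWd.congr_deriv ?_).hasDerivWithinAt
    simp only [he₁, he₂, Pi.add_apply, Pi.sub_apply]
    field_simp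
    linear_combination -(u t * v r - v t * u r) * Real.sin (Real.pi * (s - t)) * hπ
  have hr : r ∈ Set.uIcc r s := Set.left_mem_uIcc
  have hε : 0 ≤ ε := (abs_nonneg _).trans (ha r hr)
  have hk0 : 0 ≤ k := le_trans (by positivity) (hk r hr)
  have huv : ∀ t ∈ Set.uIcc r s, |u t| + |v t| ≤ Real.sqrt (2 * k) := by
    intro t ht
    refine Real.le_sqrt_of_sq_le ?_
    have := hk t ht
    have h1 := sq_abs (u t)
    have h2 := sq_abs (v t)
    nlinarith [sq_nonneg (|u t| - |v t|)]
  have hcomb : ∀ t ∈ Set.uIcc r s, |(c t - c₀) * u t + (a t - a₀) * v t| ≤ ε * Real.sqrt (2 * k) ∧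
      |(a t - a₀) * u t + (c t - c₀) * v t| ≤ ε * Real.sqrt (2 * k) := by
    intro t ht
    have h1 := ha t ht
    have h2 := hc t ht
    have h3 := mul_le_mul_of_nonneg_left (huv t ht) hε
    constructor
    · refine (abs_add_le _ _).trans ?_
      rw [abs_mul, abs_mul]
      have := mul_le_mul_of_nonneg_right h2 (abs_nonneg (u t))
      have := mul_le_mul_of_nonneg_right h1 (abs_nonneg (v t))
      linarith
    · refine (abs_add_le _ _).trans ?_
      rw [abs_mul, abs_mul]
      have := mul_le_mul_of_nonneg_right h1 (abs_nonneg (u t))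
      have := mul_le_mul_of_nonneg_right h2 (abs_nonneg (v t))
      linarith
  have hlin : ∀ {x y b : ℝ}, |x| ≤ b → |y| ≤ b → |x * v r + y * u r| ≤ b * Real.sqrt (2 * k) := by
    intro x y b hx hy
    refine (abs_add_le _ _).trans ?_
    rw [abs_mul, abs_mul]
    have h1 := mul_le_mul_of_nonneg_right hx (abs_nonneg (v r))
    have h2 := mul_le_mul_of_nonneg_right hy (abs_nonneg (u r))
    have h3 := mul_le_mul_of_nonneg_left (huv r hr) ((abs_nonneg x).trans hx)
    linarith
  have hsq : Real.sqrt (2 * k) * Real.sqrt (2 * k) = 2 * k := Real.mul_self_sqrt (by positivity)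
  have hbd : ∀ t ∈ Set.uIcc r s, ‖e₁ t * Real.cos (Real.pi * (s - t)) +
      e₂ t / Real.pi * Real.sin (Real.pi * (s - t))‖ ≤ 4 * (1 + |a₀| + |c₀|) * ε * k := by
    intro t ht
    obtain ⟨h1, h2⟩ := hcomb t ht
    have b1 : |e₁ t| ≤ ε * (2 * k) := by
      have := hlin h1 h2
      rwa [mul_assoc, hsq] at this
    have b2 : |e₂ t| ≤ (|a₀| + |c₀|) * (ε * (2 * k)) := by
      set b := ε * Real.sqrt (2 * k)
      have h3 : ∀ {x y p q : ℝ}, |x| ≤ b → |y| ≤ b → |p * x - q * y| ≤ (|q| + |p|) * b := by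
        intro x y p q hx hy
        refine (abs_sub _ _).trans ?_
        rw [abs_mul, abs_mul]
        have := mul_le_mul_of_nonneg_left hx (abs_nonneg p)
        have := mul_le_mul_of_nonneg_left hy (abs_nonneg q)
        linarith
      have h4 := hlin (h3 (p := c₀) (q := a₀) h1 h2)
        (le_of_le_of_eq (h3 (p := a₀) (q := c₀) h1 h2) (by ring))
      have e : (|a₀| + |c₀|) * b * Real.sqrt (2 * k) = (|a₀| + |c₀|) * (ε * (2 * k)) := by
        show (|a₀| + |c₀|) * (ε * Real.sqrt (2 * k)) * Real.sqrt (2 * k) = _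
        linear_combination ((|a₀| + |c₀|) * ε) * hsq
      rw [← e]; exact h4
    have hcos := Real.abs_cos_le_one (Real.pi * (s - t))
    have hsin := Real.abs_sin_le_one (Real.pi * (s - t))
    have hdiv : |e₂ t / Real.pi| ≤ |e₂ t| := by
      rw [abs_div, abs_of_pos hpi]
      exact div_le_self (abs_nonneg _) (by linarith [Real.pi_gt_three])
    rw [Real.norm_eq_abs]
    refine (abs_add_le _ _).trans ?_
    rw [abs_mul, abs_mul]
    have p1 := mul_le_of_le_one_right (abs_nonneg (e₁ t)) hcos
    have p2 := mul_le_of_le_one_right (abs_nonneg (e₂ t / Real.pi)) hsin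
    have : 0 ≤ ε * k * (1 + |a₀| + |c₀|) := by positivity
    linarith
  have hmv := (convex_uIcc r s).norm_image_sub_le_of_norm_hasDerivWithin_le hWd hbd hr
    Set.right_mem_uIcc
  rw [Real.norm_eq_abs, Real.norm_eq_abs] at hmv
  have e : W s - W r = (u s * v r - v s * u r) -
      (a₀ * u r ^ 2 + 2 * c₀ * (u r * v r) + a₀ * v r ^ 2) *
        (Real.sin (Real.pi * (s - r)) / Real.pi) := by
    simp only [hW, hA, hB]
    simp
    ring
  rwa [e] at hmv

/-- Perturbation of a quotient by the value of its limiting oscillation. -/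
theorem abs_sub_mul_sin_le {A s r a c u v D a₀ c₀ ε k K K' : ℝ} (hsr : s - r ≠ 0) (hA : 0 ≤ A)
    (hK : K = A * D / (s - r)) (hK' : K' = A * (a * u ^ 2 + 2 * c * (u * v) + a * v ^ 2))
    (ha : |a - a₀| ≤ ε) (hc : |c - c₀| ≤ ε) (hk : u ^ 2 + v ^ 2 ≤ k)
    (hD : |D - (a₀ * u ^ 2 + 2 * c₀ * (u * v) + a₀ * v ^ 2) *
      (Real.sin (Real.pi * (s - r)) / Real.pi)| ≤ 4 * (1 + |a₀| + |c₀|) * ε * k * |s - r|) :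
    |K - K' * (Real.sin (Real.pi * (s - r)) / (Real.pi * (s - r)))| ≤
      A * (ε * k * (4 * (1 + |a₀| + |c₀|) +
        2 * |Real.sin (Real.pi * (s - r)) / (Real.pi * (s - r))|)) := by
  have hε : 0 ≤ ε := (abs_nonneg _).trans ha
  generalize hb' : a * u ^ 2 + 2 * c * (u * v) + a * v ^ 2 = b' at hK'
  generalize hb : a₀ * u ^ 2 + 2 * c₀ * (u * v) + a₀ * v ^ 2 = b at hD
  have hbb : |b' - b| ≤ 2 * ε * k := by
    have e : b' - b = (a - a₀) * (u ^ 2 + v ^ 2) + (c - c₀) * (2 * (u * v)) := by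
      rw [← hb, ← hb']; ring
    rw [e]
    refine (abs_add_le _ _).trans ?_
    rw [abs_mul, abs_mul]
    have h1 : |u ^ 2 + v ^ 2| ≤ k := by rwa [abs_of_nonneg (by positivity)]
    have h2 : |2 * (u * v)| ≤ k := by
      refine le_trans ?_ hk
      rw [abs_le]
      constructor <;> nlinarith [sq_nonneg (u - v), sq_nonneg (u + v)]
    have h3 := mul_le_mul ha h1 (abs_nonneg _) hε
    have h4 := mul_le_mul hc h2 (abs_nonneg _) hε
    linarith
  have hsplit : K - K' * (Real.sin (Real.pi * (s - r)) / (Real.pi * (s - r))) =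
      A * ((D - b * (Real.sin (Real.pi * (s - r)) / Real.pi)) / (s - r) -
        (b' - b) * (Real.sin (Real.pi * (s - r)) / (Real.pi * (s - r)))) := by
    rw [hK, hK']
    generalize Real.sin (Real.pi * (s - r)) = q
    have := Real.pi_pos
    generalize s - r = d at hsr
    field_simp
    ring
  rw [hsplit, abs_mul, abs_of_nonneg hA]
  refine mul_le_mul_of_nonneg_left ?_ hA
  generalize Real.sin (Real.pi * (s - r)) / (Real.pi * (s - r)) = S
  have h5 : |(D - b * (Real.sin (Real.pi * (s - r)) / Real.pi)) / (s - r)| ≤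
      4 * (1 + |a₀| + |c₀|) * ε * k := by
    rwa [abs_div, div_le_iff₀ (abs_pos.mpr hsr)]
  have h6 : |(b' - b) * S| ≤ 2 * ε * k * |S| := by
    rw [abs_mul]
    exact mul_le_mul_of_nonneg_right hbb (abs_nonneg _)
  refine (abs_sub _ _).trans ((add_le_add h5 h6).trans (le_of_eq ?_))
  ring

/-- Local comparison of the Laguerre kernel with the sine kernel. -/
theorem abs_lagFunKer_sub_sine_le (α m : ℕ) {y g s r a₀ c₀ ε k : ℝ} (hsr : s ≠ r) (hg : 0 < g)
    (hπ : a₀ ^ 2 - c₀ ^ 2 = Real.pi ^ 2)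
    (h : ∀ t ∈ Set.uIcc r s, |lagCoeff α m / (g * (y + t / g)) - a₀| ≤ ε ∧
      |((m : ℝ) + 1 + (α - (y + t / g)) / 2) / (g * (y + t / g)) - c₀| ≤ ε ∧ 0 < y + t / g ∧
      lagFun α (m + 1) (y + t / g) ^ 2 + lagFun α m (y + t / g) ^ 2 ≤ k) :
    |lagFunKer α m (y + s / g) (y + r / g) -
        lagFunKer α m (y + r / g) (y + r / g) * sineKernel s r| ≤
      g * lagCoeff α m * (ε * k * (4 * (1 + |a₀| + |c₀|) + 2 * |sineKernel s r|)) := by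
  have hsr' : s - r ≠ 0 := sub_ne_zero.mpr hsr
  have ha0 : 0 < lagCoeff α m := lagCoeff_pos _ _
  have hxd : ∀ t, HasDerivAt (fun t => y + t / g) (1 / g) t := fun t =>
    ((hasDerivAt_id t).div_const g).const_add _
  have hosc := abs_det_sub_sin_le (u := fun t => lagFun α (m + 1) (y + t / g))
    (v := fun t => lagFun α m (y + t / g)) (a := fun t => lagCoeff α m / (g * (y + t / g)))
    (c := fun t => ((m : ℝ) + 1 + (α - (y + t / g)) / 2) / (g * (y + t / g))) (r := r) (s := s) hπ
    (fun t ht => by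
      have h0 := (h t ht).2.2.1
      refine ((hasDerivAt_lagFun_succ α m h0).comp t (hxd t)).congr_deriv ?_
      generalize y + t / g = x at h0
      field_simp)
    (fun t ht => by
      have h0 := (h t ht).2.2.1
      refine ((hasDerivAt_lagFun α m h0).comp t (hxd t)).congr_deriv ?_
      generalize y + t / g = x at h0
      field_simp)
    (fun t ht => (h t ht).1) (fun t ht => (h t ht).2.1) (fun t ht => (h t ht).2.2.2)
  obtain ⟨hra, hrc, hrx, hrk⟩ := h r Set.left_mem_uIcc
  have hcd := lagFunKer_christoffelDarboux α m (y + s / g) (y + r / g)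
  have hdiag := lagFunKer_diag α m (y + r / g)
  beta_reduce at hosc
  rw [sineKernel, if_neg hsr]
  refine abs_sub_mul_sin_le hsr' (by positivity) ?_ ?_ hra hrc hrk hosc
  · have e : y + s / g - (y + r / g) = (s - r) / g := by ring
    rw [e, div_mul_eq_mul_div, div_eq_iff hg.ne'] at hcd
    rw [eq_div_iff hsr']
    linarith
  · generalize y + r / g = x at hrx hdiag
    have e : lagFunKer α m x x = x * lagFunKer α m x x / x := by field_simp
    rw [e, hdiag]
    field_simp

end Oscillation

/-! ### Sine kernel limit for the Laguerre kernel -/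

section SineLimit

variable {α : ℕ} {m : ℕ → ℕ} {ξ : ℝ}

/-- The product filter encodes uniformity near ξ; it therefore yields uniformity on windows of width
of order 1/N. -/
theorem eventually_local {P : ℕ → ℝ → Prop} (h : ∀ᶠ p : ℕ × ℝ in atTop ×ˢ 𝓝 ξ, P p.1 p.2) (g R : ℝ) :
    ∀ᶠ N : ℕ in atTop, ∀ σ, |σ| ≤ R → P N (ξ + σ / g / N) := by
  obtain ⟨pa, hpa, pb, hpb, hab⟩ := eventually_prod_iff.mp h
  obtain ⟨δ, hδ, hball⟩ := Metric.eventually_nhds_iff.mp hpb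
  have hlim : Tendsto (fun N : ℕ => R / |g| / N) atTop (𝓝 0) :=
    tendsto_const_div_atTop_nhds_zero_nat _
  filter_upwards [hpa, hlim.eventually (gt_mem_nhds hδ)] with N hN hN2 σ hσ
  refine hab hN (hball ?_)
  rw [Real.dist_eq, add_sub_cancel_left, abs_div, abs_div, Nat.abs_cast]
  refine lt_of_le_of_lt ?_ hN2
  gcongr

theorem tendsto_lagFunKer_local_diag (hm : Tendsto (fun N => (m N : ℝ) / N) atTop (𝓝 1))
    (hξ : ξ ∈ Set.Ioo (0 : ℝ) 4) (s : ℝ) :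
    Tendsto (fun N : ℕ => lagFunKer α (m N) (N * ξ + s / mpDensity ξ) (N * ξ + s / mpDensity ξ))
      atTop (𝓝 (mpDensity ξ)) := by
  rw [Metric.tendsto_nhds]
  intro ε hε
  have h := eventually_local (P := fun N t => dist (lagFunKer α (m N) (N * t) (N * t)) (mpDensity ξ) < ε)
    (Metric.tendsto_nhds.mp (tendsto_lagFunKer_diag (α := α) hm hξ) ε hε) (mpDensity ξ) |s|
  filter_upwards [h, eventually_gt_atTop 0] with N hN hN0
  have hN' : (N : ℝ) ≠ 0 := Nat.cast_ne_zero.mpr (by omega)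
  have := hN s le_rfl
  rwa [mul_add, mul_div_cancel₀ _ hN'] at this

/-- Rescaling by the density is what makes the frequency π, since 1 - (1 - ξ/2)² = ξ(4 - ξ)/4. -/
theorem limit_coeff_sq (hξ : ξ ∈ Set.Ioo (0 : ℝ) 4) :
    (1 / (mpDensity ξ * ξ)) ^ 2 - ((1 - ξ / 2) / (mpDensity ξ * ξ)) ^ 2 = Real.pi ^ 2 := by
  have h1 := hξ.1
  have h2 : 0 < 4 - ξ := by linarith [hξ.2]
  have hs : Real.sqrt (ξ * (4 - ξ)) ^ 2 = ξ * (4 - ξ) := Real.sq_sqrt (by positivity)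
  have hs0 : 0 < Real.sqrt (ξ * (4 - ξ)) := Real.sqrt_pos.mpr (by positivity)
  have e : mpDensity ξ * ξ = Real.sqrt (ξ * (4 - ξ)) / (2 * Real.pi) := by
    have := Real.pi_pos
    rw [mpDensity]; field_simp
  rw [e]
  field_simp
  rw [hs]
  ring

/-- Both a and a - |c| are at least ηN, so u² + v² = O(1/N). This offsets the factor `lagCoeff` of
order N in Christoffel-Darboux. -/
theorem lagFun_sq_add_sq_le {n N : ℕ} {x η b c : ℝ} (hN : (0 : ℝ) < N) (hη : 0 < η)
    (h : η * N ≤ lagCoeff α n - |(n : ℝ) + 1 + (α - N * x) / 2|) (hx0 : 0 ≤ x) (hx : x ≤ b)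
    (hK : lagFunKer α n (N * x) (N * x) ≤ c) :
    lagFun α (n + 1) (N * x) ^ 2 + lagFun α n (N * x) ^ 2 ≤ b * c / (η * η) / N := by
  have hen := energy_le α n (N * x)
  have hw : 0 ≤ lagFun α (n + 1) (N * x) ^ 2 + lagFun α n (N * x) ^ 2 := by positivity
  generalize lagFun α (n + 1) (N * x) ^ 2 + lagFun α n (N * x) ^ 2 = w at hen hw
  have ha0 : 0 < lagCoeff α n := lagCoeff_pos _ _
  have haη : η * N ≤ lagCoeff α n := h.trans (sub_le_self _ (abs_nonneg _))
  have h7 : (η * N) * (η * N) * w ≤ N * x * lagFunKer α n (N * x) (N * x) :=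
    le_trans (mul_le_mul_of_nonneg_right (mul_le_mul haη h (by positivity) ha0.le) hw) hen
  have h8 : N * x * lagFunKer α n (N * x) (N * x) ≤ N * b * c := by
    have := lagFunKer_diag_nonneg α n (N * x)
    have := hx0.trans hx
    gcongr
  rw [div_div, le_div_iff₀ (by positivity)]
  have h9 := h7.trans h8
  have h10 : N * (w * (η * η * N)) ≤ N * (b * c) := by linarith
  exact le_of_mul_le_mul_left h10 hN

/-- The bulk universality of the Laguerre unitary ensemble: sine kernel asymptotics. -/
theorem tendsto_lagFunKer_sine (hm : Tendsto (fun N => (m N : ℝ) / N) atTop (𝓝 1))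
    (hξ : ξ ∈ Set.Ioo (0 : ℝ) 4) (s r : ℝ) :
    Tendsto (fun N : ℕ => lagFunKer α (m N) (N * ξ + s / mpDensity ξ) (N * ξ + r / mpDensity ξ))
      atTop (𝓝 (mpDensity ξ * sineKernel s r)) := by
  by_cases hsr : s = r
  · subst hsr
    rw [sineKernel, if_pos rfl, mul_one]
    exact tendsto_lagFunKer_local_diag hm hξ s
  have hsr' : s - r ≠ 0 := sub_ne_zero.mpr hsr
  set g := mpDensity ξ with hg
  have hg0 : 0 < g := mpDensity_pos hξ
  have hξ0 := hξ.1
  set S := sineKernel s r with hS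
  set a₀ := 1 / (g * ξ) with ha₀
  set c₀ := (1 - ξ / 2) / (g * ξ) with hc₀
  set R := max |s| |r| with hR
  have hmemR : ∀ t ∈ Set.uIcc r s, |t| ≤ R := by
    intro t ht
    rw [Set.mem_uIcc] at ht
    rw [hR, abs_le]
    have := le_max_left |s| |r|
    have := le_max_right |s| |r|
    have := neg_abs_le s
    have := neg_abs_le r
    have := le_abs_self s
    have := le_abs_self r
    rcases ht with ht | ht <;> constructor <;> linarith [ht.1, ht.2]
  obtain ⟨η, hη, hell⟩ := exists_bulk_bound (α := α) hm hξ
  -- the constant in the bound `u ^ 2 + v ^ 2 ≤ k / N`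
  set k := (ξ + 1) * (g + 1) / (η * η) with hk
  have hk0 : 0 < k := by positivity
  suffices H : Tendsto (fun N : ℕ => lagFunKer α (m N) (N * ξ + s / g) (N * ξ + r / g) -
      lagFunKer α (m N) (N * ξ + r / g) (N * ξ + r / g) * S) atTop (𝓝 0) by
    have h1 := H.add ((tendsto_lagFunKer_local_diag (α := α) hm hξ r).mul_const S)
    simpa [← hg] using h1
  -- Since `lagCoeff` is eventually below 2N and u² + v² ≤ k/N, the comparison error is at most T ε.
  set T := 2 * g * k * (4 * (1 + |a₀| + |c₀|) + 2 * |S|) with hT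
  have hT0 : 0 < T := by positivity
  rw [Metric.tendsto_nhds]
  intro ε' hε'
  obtain ⟨ε, hε, hεT⟩ : ∃ ε > 0, T * ε < ε' := by
    refine ⟨ε' / (2 * T), by positivity, ?_⟩
    rw [mul_div_assoc']
    rw [div_lt_iff₀ (by positivity)]
    nlinarith
  have hca : Tendsto (fun p : ℕ × ℝ => lagCoeff α (m p.1) / p.1) (atTop ×ˢ 𝓝 ξ) (𝓝 1) :=
    (tendsto_lagCoeff_div α hm).comp tendsto_fst
  have hsnd : Tendsto (fun p : ℕ × ℝ => g * p.2) (atTop ×ˢ 𝓝 ξ) (𝓝 (g * ξ)) :=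
    tendsto_snd.const_mul g
  have hgξ : g * ξ ≠ 0 := by positivity
  have ea := Metric.tendsto_nhds.mp (hca.div hsnd hgξ) ε hε
  have ec := Metric.tendsto_nhds.mp ((tendsto_div_prod (α := α) hm).div hsnd hgξ) ε hε
  have eK := (tendsto_lagFunKer_diag (α := α) hm hξ).eventually
    (gt_mem_nhds (show g < g + 1 by linarith))
  have et : ∀ᶠ p : ℕ × ℝ in atTop ×ˢ 𝓝 ξ, p.2 < ξ + 1 ∧ 0 < p.2 :=
    tendsto_snd.eventually ((gt_mem_nhds (by linarith)).and (lt_mem_nhds hξ0))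
  have eall := eventually_local (P := fun N t =>
      dist (lagCoeff α (m N) / N / (g * t)) (1 / (g * ξ)) < ε ∧
      dist (((m N : ℝ) + 1 + (α - N * t) / 2) / N / (g * t)) ((1 - ξ / 2) / (g * ξ)) < ε ∧
      lagFunKer α (m N) (N * t) (N * t) < g + 1 ∧ (t < ξ + 1 ∧ 0 < t) ∧
      η * N ≤ lagCoeff α (m N) - |(m N : ℝ) + 1 + (α - N * t) / 2|)
    (ea.and (ec.and (eK.and (et.and hell)))) g R
  have ea2 := (tendsto_lagCoeff_div α hm).eventually (gt_mem_nhds (show (1 : ℝ) < 2 by norm_num))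
  filter_upwards [eall, ea2, eventually_gt_atTop 0] with N hN ha2 hN0
  have hN' : (0 : ℝ) < N := Nat.cast_pos.mpr hN0
  rw [div_lt_iff₀ hN'] at ha2
  have hx : ∀ t, N * ξ + t / g = N * (ξ + t / g / N) := fun t => by field_simp
  have hloc : ∀ t ∈ Set.uIcc r s, |lagCoeff α (m N) / (g * (N * ξ + t / g)) - a₀| ≤ ε ∧
      |((m N : ℝ) + 1 + (α - (N * ξ + t / g)) / 2) / (g * (N * ξ + t / g)) - c₀| ≤ ε ∧
      0 < N * ξ + t / g ∧
      lagFun α (m N + 1) (N * ξ + t / g) ^ 2 + lagFun α (m N) (N * ξ + t / g) ^ 2 ≤ k / N := by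
    intro t ht
    obtain ⟨h1, h2, h3, ⟨h4, h5⟩, h6⟩ := hN t (hmemR t ht)
    rw [hx]
    generalize ξ + t / g / N = x at h1 h2 h3 h4 h5 h6
    have hden : ∀ z : ℝ, z / N / (g * x) = z / (g * (N * x)) := fun z => by
      rw [div_div]; congr 1; ring
    rw [hden, Real.dist_eq] at h1 h2
    exact ⟨h1.le, h2.le, by positivity, lagFun_sq_add_sq_le hN' hη h6 h5.le h4.le h3.le⟩
  have hest := abs_lagFunKer_sub_sine_le α (m N) hsr hg0 (limit_coeff_sq hξ) hloc
  rw [Real.dist_eq, sub_zero]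
  refine hest.trans_lt (lt_of_le_of_lt ?_ hεT)
  have e : g * lagCoeff α (m N) * (ε * (k / N) * (4 * (1 + |a₀| + |c₀|) + 2 * |S|)) =
      lagCoeff α (m N) * (g * k * (4 * (1 + |a₀| + |c₀|) + 2 * |S|) * ε) / N := by ring
  rw [e, div_le_iff₀ hN', hT]
  have h7 : 0 ≤ g * k * (4 * (1 + |a₀| + |c₀|) + 2 * |S|) * ε := by positivity
  refine (mul_le_mul_of_nonneg_right ha2.le h7).trans (le_of_eq ?_)
  ring

end SineLimit

end SampleCov

/-! ### Summation over j and conclusion -/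

namespace SampleCov

/-- The base of the power factors as (Nξ + p)(Nξ + q), so the scaling supplies exactly the weights
of the two Laguerre functions. -/
theorem scaling_eq_sqrtWeight {α N : ℕ} {ξ p q : ℝ} (hp : 0 < N * ξ + p) (hq : 0 < N * ξ + q) :
    scaling α N ξ p q = sqrtWeight α (N * ξ + p) * sqrtWeight α (N * ξ + q) := by
  have hpow : ∀ {x : ℝ}, 0 < x → x ^ ((α : ℝ) / 2) = Real.sqrt x ^ α := fun {x} hx => by
    rw [Real.sqrt_eq_rpow, ← Real.rpow_natCast, ← Real.rpow_mul hx.le]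
    congr 1; ring
  have e : (N : ℝ) ^ 2 * ξ ^ 2 + N * ξ * (p + q) + p * q = (N * ξ + p) * (N * ξ + q) := by ring
  have e2 : Real.exp (-(N * ξ) - (p + q) / 2) =
      Real.exp (-(N * ξ + p) / 2) * Real.exp (-(N * ξ + q) / 2) := by
    rw [← Real.exp_add]; congr 1; ring
  rw [scaling, e, Real.mul_rpow hp.le hq.le, hpow hp, hpow hq, e2, sqrtWeight, sqrtWeight]
  ring

theorem tendsto_natSub_div (c : ℕ) : Tendsto (fun N : ℕ => ((N - c : ℕ) : ℝ) / N) atTop (𝓝 1) := by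
  have h : Tendsto (fun N : ℕ => 1 - (c : ℝ) / N) atTop (𝓝 (1 - 0)) :=
    (tendsto_const_div_atTop_nhds_zero_nat _).const_sub 1
  rw [sub_zero] at h
  refine h.congr' ?_
  filter_upwards [eventually_ge_atTop c, eventually_gt_atTop 0] with N hc hN
  have : (N : ℝ) ≠ 0 := Nat.cast_ne_zero.mpr hN.ne'
  rw [Nat.cast_sub hc]
  field_simp

theorem eventually_pos_local {ξ : ℝ} (hξ : 0 < ξ) (p : ℝ) : ∀ᶠ N : ℕ in atTop, 0 < N * ξ + p :=
  ((tendsto_natCast_atTop_atTop.atTop_mul_const hξ).atTop_add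
    (tendsto_const_nhds (x := p))).eventually_gt_atTop 0

theorem hasSum_pow_div_factorial (κ : ℝ) :
    HasSum (fun j : ℕ => κ ^ j / j.factorial) (Real.exp κ) := by
  rw [Real.exp_eq_exp_ℝ]
  exact NormedSpace.expSeries_div_hasSum_exp κ

/-- Exponentially weighted sums of Laguerre kernels inherit the sine kernel limit. -/
theorem tendsto_sum_lagFunKer (α : ℕ) {ξ : ℝ} (hξ : ξ ∈ Set.Ioo (0 : ℝ) 4) (κ μ ν : ℝ) :
    Tendsto (fun N : ℕ => ∑ j ∈ Finset.range (N - α + 1), κ ^ j / j.factorial *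
      lagFunKer α (N - α - j) (N * ξ + μ / mpDensity ξ) (N * ξ + ν / mpDensity ξ)) atTop
      (𝓝 (Real.exp κ * (mpDensity ξ * sineKernel μ ν))) := by
  set g := mpDensity ξ
  have hsum := (hasSum_pow_div_factorial κ).mul_right (g * sineKernel μ ν)
  rw [← hsum.tsum_eq]
  have hdiag : ∀ s : ℝ, Tendsto (fun N : ℕ => lagFunKer α (N - α) (N * ξ + s / g) (N * ξ + s / g))
      atTop (𝓝 g) := fun s => tendsto_lagFunKer_local_diag (tendsto_natSub_div α) hξ s
  -- All kernels of lower degree are dominated by the diagonal values at degree N - α, which are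
  -- eventually below g + 1.
  have hbound : ∀ᶠ N : ℕ in atTop, ∀ j : ℕ,
      ‖if j ∈ Finset.range (N - α + 1) then κ ^ j / j.factorial *
        lagFunKer α (N - α - j) (N * ξ + μ / g) (N * ξ + ν / g) else 0‖ ≤
      |κ| ^ j / j.factorial * (g + 1) := by
    have hg1 : g < g + 1 := lt_add_one g
    filter_upwards [(hdiag μ).eventually (gt_mem_nhds hg1),
      (hdiag ν).eventually (gt_mem_nhds hg1)] with N h1 h2 j
    have hg0 : 0 ≤ g := (mpDensity_pos hξ).le
    split_ifs
    · rw [norm_mul, norm_div, norm_pow, Real.norm_eq_abs, Real.norm_natCast, Real.norm_eq_abs]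
      refine mul_le_mul_of_nonneg_left ?_ (by positivity)
      have := abs_lagFunKer_le α (Nat.sub_le (N - α) j) (N * ξ + μ / g) (N * ξ + ν / g)
      linarith
    · rw [norm_zero]; positivity
  refine (tendsto_tsum_of_dominated_convergence
    ((hasSum_pow_div_factorial |κ|).mul_right (g + 1)).summable (fun j => ?_) hbound).congr
    fun N => ?_
  · have hm : Tendsto (fun N : ℕ => ((N - α - j : ℕ) : ℝ) / N) atTop (𝓝 1) := by
      simpa only [Nat.sub_sub] using tendsto_natSub_div (α + j)
    refine ((tendsto_lagFunKer_sine (α := α) hm hξ μ ν).const_mul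
      (κ ^ j / j.factorial)).congr' ?_
    filter_upwards [eventually_ge_atTop (α + j)] with N hN
    rw [if_pos (Finset.mem_range.mpr (by omega))]
  · rw [tsum_eq_sum (s := Finset.range (N - α + 1)) fun j hj => if_neg hj]
    exact Finset.sum_congr rfl fun j hj => if_pos hj

theorem scaled_corr_eq {Q : Measure ℝ} [IsProbabilityMeasure Q] {κ : ℝ}
    (h : IsNormalizedLaw (entryLaw Q) κ) {α N : ℕ} (hN : α ≤ N) {ξ p q : ℝ} (C : ℝ)
    (hp : 0 < N * ξ + p) (hq : 0 < N * ξ + q) :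
    ((C * scaling α N ξ p q : ℝ) : ℂ) *
        (corr Q N (N - α) ((N * ξ + p : ℝ) : ℂ) ((N * ξ + q : ℝ) : ℂ) /
          ((N.factorial : ℂ) * ((N - α).factorial : ℂ))) =
      ((C * ∑ j ∈ Finset.range (N - α + 1), κ ^ j / j.factorial *
        lagFunKer α (N - α - j) (N * ξ + p) (N * ξ + q) : ℝ) : ℂ) := by
  have hc := corr_eq_sum h α (N - α) (N * ξ + p) (N * ξ + q)
  rw [Nat.sub_add_cancel hN] at hc
  rw [hc, ← Complex.ofReal_mul, scaling_eq_sqrtWeight hp hq, mul_assoc, Finset.mul_sum]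
  refine congrArg (fun t : ℝ => ((C * t : ℝ) : ℂ)) (Finset.sum_congr rfl fun j _ => ?_)
  rw [lagFunKer_eq]
  ring

end SampleCov

theorem theorem4p1 (Q : Measure ℝ) [IsProbabilityMeasure Q] (b : ℝ)
    (hmean : ∫ x, x ∂Q = 0)
    (hvar : Var[fun x => x; Q] = 1 / 2)
    (hfourth : Integrable (fun x : ℝ => x ^ 4) Q)
    (hb : ∫ x, x ^ 4 ∂Q = b) :
    (∀ n m : ℕ, m ≤ n → ∀ z w : ℂ,
      Integrable (SampleCov.charPolyProd z w) (SampleCov.matrixLaw Q n m)) ∧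
    ∀ (α : ℕ) (ξ : ℝ), ξ ∈ Set.Ioo (0 : ℝ) 4 → ∀ μ ν : ℝ,
      Tendsto
        (fun N : ℕ =>
          (((SampleCov.mpDensity ξ)⁻¹ *
              SampleCov.scaling α N ξ (μ / SampleCov.mpDensity ξ)
                (ν / SampleCov.mpDensity ξ) : ℝ) : ℂ) *
            (SampleCov.corr Q N (N - α)
                ((N * ξ + μ / SampleCov.mpDensity ξ : ℝ) : ℂ)
                ((N * ξ + ν / SampleCov.mpDensity ξ : ℝ) : ℂ) /
              ((N.factorial : ℂ) * ((N - α).factorial : ℂ))))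
        atTop
        (𝓝 ((Real.exp (2 * (b - 3 / 4)) * SampleCov.sineKernel μ ν : ℝ) : ℂ)) := by
  have hlaw := SampleCov.isNormalizedLaw_entryLaw hmean hvar hfourth hb
  refine ⟨fun n m _ z w => SampleCov.integrable_charPolyProd hlaw n m z w,
    fun α ξ hξ μ ν => ?_⟩
  have hg := (SampleCov.mpDensity_pos hξ).ne'
  have hlim := (SampleCov.tendsto_sum_lagFunKer α hξ (2 * (b - 3 / 4)) μ ν).const_mul
    (SampleCov.mpDensity ξ)⁻¹
  have e : (SampleCov.mpDensity ξ)⁻¹ * (Real.exp (2 * (b - 3 / 4)) *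
      (SampleCov.mpDensity ξ * SampleCov.sineKernel μ ν)) =
      Real.exp (2 * (b - 3 / 4)) * SampleCov.sineKernel μ ν := by
    field_simp
  rw [e] at hlim
  refine ((Complex.continuous_ofReal.tendsto _).comp hlim).congr' ?_
  filter_upwards [eventually_ge_atTop α,
    SampleCov.eventually_pos_local hξ.1 (μ / SampleCov.mpDensity ξ),
    SampleCov.eventually_pos_local hξ.1 (ν / SampleCov.mpDensity ξ)] with N hN hp hq
  exact (SampleCov.scaled_corr_eq hlaw hN _ hp hq).symm
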